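/- Let $\lambda=e^{i\pi/4}$, and let $\Omega\subset\mathbb C$ be (the interior of) a simple closed polygon whose sides are parallel to $\lambda$ and $\bar\lambda$, with positively oriented boundary; every vertex is a corner with interior angle $\pi/2$ (convex) or $3\pi/2$ (concave). Suppose that each corner is coloured white or black so that, for some integers $n,m\ge 1$, there are $n+1$ convex and $n-1$ concave white corners, and $m+1$ convex and $m-1$ concave black corners. Let $u_0\ne v_0$ be points of $\partial\Omega$ that are not corners. Denote by $(u_0v_0)$ and $(v_0u_0)$ the open boundary arcs from $u_0$ to $v_0$ and from $v_0$ to $u_0$ in the positive direction. Assume that the colours are compatible with the positions of $u_0,v_0$: the number of white corners on $(u_0v_0)$ is even if the side containing $v_0$ is parallel to $\lambda$, and odd if it is parallel to $\bar\lambda$. Assume that $0\in(u_0v_0)$. Let $f_\Omega$ be the holomorphic function on $\Omega$ such that: $f_\Omega(z)=\frac{\lambda}{z-v_0}+O(1)$ near $v_0$; $f_\Omega$ is bounded near each convex white corner; near each concave white corner each of $\mathrm{Re} f_\Omega$, $\mathrm{Im} f_\Omega$ is bounded from above or bounded from below; and along each boundary arc between consecutive white corners (except at $v_0$) either $\mathrm{Re}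 f_\Omega=0$ or $\mathrm{Im} f_\Omega=0$ (as boundary limits), where the condition changes at every white corner. Let $g_\Omega$ be the holomorphic function on $\Omega$ such that: $g_\Omega(z)=\frac{i}{z-u_0}+O(1)$ near $u_0$; $g_\Omega$ is bounded near each convex black corner; near each concave black corner each of $\mathrm{Re}[\bar\lambda g_\Omega]$, $\mathrm{Re}[\lambda g_\Omega]$ is bounded from above or bounded from below; and along each boundary arc between consecutive black corners (except at $u_0$) either $\mathrm{Re}[\bar\lambda g_\Omega]=0$ or $\mathrm{Re}[\lambda g_\Omega]=0$, where the condition changes at every black corner. Let $\mathrm{hm}_\Omega(\cdot,(v_0u_0))$ be the harmonic measure of the arc $(v_0u_0)$, that is, the unique bounded harmonic function in $\Omega$ with boundary values $1$ on $(v_0u_0)$ and $0$ on $(u_0v_0)$. Then there is a real constant $c\neq 0$ such that for all $w\in\Omega$ $$\int_0^w \mathrm{Re}\,[f_\Omega(z)\,g_\Omega(z)\,dz]=c\cdot \mathrm{hm}_\Omega(w,(v_0u_0)),$$ where the integral, improper at the boundary point $0$, is taken along any piecewise $C^1$ path from $0$ to $w$ that lies in $\Omega$ except for its starting point; it converges and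 does not depend on the path. -/

import Mathlib

open Complex Set Filter Topology Asymptotics MeasureTheory
open scoped Real ComplexConjugate

namespace PolygonHM

/-- The unit vector `λ = e^{iπ/4}`; its conjugate is `e^{-iπ/4}`. -/
noncomputable def lam : ℂ := Complex.exp ((π / 4 : ℝ) * I)

section Polygon

variable {N : ℕ} [NeZero N]

/-- The `k`-th side, as a vector from the vertex `p k` to the next vertex (cyclically). -/
def edge (p : ZMod N → ℂ) (k : ZMod N) : ℂ := p (k + 1) - p k

/-- The `N`-periodic piecewise linear parametrisation of the closed polygonal line with vertices
`p`: the integer `j` is sent to the vertex `p j`, and `[j, j + 1]` to the `j`-th side. -/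
noncomputable def bdry (p : ZMod N → ℂ) (s : ℝ) : ℂ :=
  p ((⌊s⌋ : ℤ) : ZMod N) + ((Int.fract s : ℝ) : ℂ) * edge p ((⌊s⌋ : ℤ) : ZMod N)

/-- For a polygon with positively oriented boundary: the boundary turns left at the vertex `k`
(for sides parallel to `λ` and its conjugate, the interior angle is `π / 2`). -/
def ConvexCorner (p : ZMod N → ℂ) (k : ZMod N) : Prop :=
  0 < (conj (edge p (k - 1)) * edge p k).im

/-- The boundary turns right at the vertex `k` (the interior angle is `3π / 2`). -/
def ConcaveCorner (p : ZMod N → ℂ) (k : ZMod N) : Prop :=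
  (conj (edge p (k - 1)) * edge p k).im < 0

/-- `Ω` is (the interior of) a polygon with sides parallel to `λ` and its conjugate, and `p` is the
list of its corners, in the positive (counterclockwise) order. -/
structure IsPolygon (p : ZMod N → ℂ) (Ω : Set ℂ) : Prop where
  sides : ∀ k, ∃ t : ℝ, edge p k = t * lam ∨ edge p k = t * conj lam
  corners : ∀ k, ConvexCorner p k ∨ ConcaveCorner p k
  /-- the closed polygonal line has no self-intersections -/
  simple : InjOn (bdry p) (Ico 0 (N : ℝ))
  isOpen : IsOpen Ω
  isBounded : Bornology.IsBounded Ω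
  simplyConnected : SimplyConnectedSpace Ω
  frontier_eq : frontier Ω = range (bdry p)
  /-- positive orientation: `Ω` lies to the left of every side -/
  left : ∀ k, ∀ t ∈ Ioo (0 : ℝ) 1,
    ∀ᶠ ε : ℝ in 𝓝[>] 0, p k + (t : ℂ) * edge p k + (ε : ℂ) * (I * edge p k) ∈ Ω

/-- A real-valued function is semi-bounded in a vicinity of the boundary point `ζ` of `Ω`:
it is bounded from above or bounded from below there. -/
def SemiBoundedNear (Ω : Set ℂ) (ζ : ℂ) (u : ℂ → ℝ) : Prop :=
  (∃ C : ℝ, ∀ᶠ z in 𝓝[Ω] ζ, u z ≤ C) ∨ (∃ C : ℝ, ∀ᶠ z in 𝓝[Ω] ζ, C ≤ u z)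

/-- The boundary value problem which determines `f_Ω` and `g_Ω`. Here `M` is the set of marked
corners, `q` the boundary point where the function has a simple pole, `r` its residue, and `ℓ 0`,
`ℓ 1` are the two real components of which one vanishes along each boundary arc between
marked corners; `τ k` says which one vanishes along the `k`-th side. -/
structure IsSolution (p : ZMod N → ℂ) (Ω : Set ℂ) (M : Set (ZMod N)) (q r : ℂ)
    (ℓ : Fin 2 → ℂ → ℝ) (f : ℂ → ℂ) : Prop where
  holomorphic : DifferentiableOn ℂ f Ω
  pole : (fun z => f z - r / (z - q)) =O[𝓝[Ω] q] (fun _ => (1 : ℝ))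
  convex : ∀ k ∈ M, ConvexCorner p k → f =O[𝓝[Ω] (p k)] (fun _ => (1 : ℝ))
  concave : ∀ k ∈ M, ConcaveCorner p k → ∀ i, SemiBoundedNear Ω (p k) (fun z => ℓ i (f z))
  boundary : ∃ τ : ZMod N → Fin 2,
    (∀ k, τ (k - 1) ≠ τ k ↔ k ∈ M) ∧
    ∀ s : ℝ, bdry p s ∉ p '' M → bdry p s ≠ q →
      Tendsto (fun z => ℓ (τ ((⌊s⌋ : ℤ) : ZMod N)) (f z)) (𝓝[Ω] (bdry p s)) (𝓝 0)

/-- `f` is the function `f_Ω`, with pole `λ / (z - v₀)`, for the set `W` of white corners: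
along each arc between white corners `Re f = 0` or `Im f = 0`. -/
def IsF (p : ZMod N → ℂ) (Ω : Set ℂ) (W : Set (ZMod N)) (v₀ : ℂ) (f : ℂ → ℂ) : Prop :=
  IsSolution p Ω W v₀ lam ![fun w => w.re, fun w => w.im] f

/-- `g` is the function `g_Ω`, with pole `i / (z - u₀)`, for the set `B` of black corners:
along each arc between black corners `Re (conj λ * g) = 0` or `Re (λ * g) = 0`. -/
def IsG (p : ZMod N → ℂ) (Ω : Set ℂ) (B : Set (ZMod N)) (u₀ : ℂ) (g : ℂ → ℂ) : Prop :=
  IsSolution p Ω B u₀ I ![fun w => (conj lam * w).re, fun w => (lam * w).re] g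

end Polygon

/-- `h` is, on `Ω`, the harmonic measure `hm_Ω(·, E)` of the open boundary arc `E`: the bounded
harmonic function in `Ω` with boundary values `1` on `E` and `0` on the rest of the boundary
(no condition at the end points of the arc). -/
structure IsHarmonicMeasure (Ω E : Set ℂ) (h : ℂ → ℝ) : Prop where
  harmonic : InnerProductSpace.HarmonicOnNhd h Ω
  bounded : ∃ C : ℝ, ∀ z ∈ Ω, |h z| ≤ C
  one : ∀ ζ ∈ E, Tendsto h (𝓝[Ω] ζ) (𝓝 1)
  zero : ∀ ζ ∈ frontier Ω \ closure E, Tendsto h (𝓝[Ω] ζ) (𝓝 0)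

/-- `γ : [0, 1] → ℂ` is a path from the boundary point `a` to `w`, which lies in `Ω` except for its
starting point. Piecewise continuously differentiable paths are included. -/
structure IsPathFrom (Ω : Set ℂ) (a w : ℂ) (γ : ℝ → ℂ) : Prop where
  continuousOn : ContinuousOn γ (Icc 0 1)
  source : γ 0 = a
  target : γ 1 = w
  mem : ∀ t ∈ Ioc (0 : ℝ) 1, γ t ∈ Ω
  differentiable : ∃ S : Set ℝ, S.Finite ∧ ∀ t ∈ Ioo (0 : ℝ) 1 \ S, DifferentiableAt ℝ γ t
  integrable : ∀ ε ∈ Ioo (0 : ℝ) 1, IntervalIntegrable (deriv γ) volume ε 1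

/-- The line integral `∫_γ Re[F dz]` along `γ : [0, 1] → ℂ`, improper at the starting point,
converges to `J`. -/
def HasReLineIntegral (F : ℂ → ℂ) (γ : ℝ → ℂ) (J : ℝ) : Prop :=
  Tendsto (fun ε : ℝ => ∫ t in ε..1, (F (γ t) * deriv γ t).re) (𝓝[>] 0) (𝓝 J)

end PolygonHM

/-! Since Ω is simply connected, f g has a primitive G (`exists_primitive`), and the integral in
question is an increment of the harmonic function Re G. It suffices that Re G, suitably normalised,
is bounded and has boundary value 0 on the arc through 0 and a constant c ≠ 0 on the other arc:
`harmonic_eq_zero_of_tendsto_zero`, a maximum principle that ignores two boundary points, then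
identifies Re G / c with the harmonic measure.

Along the sides f g dz is purely imaginary (`re_mul_edge_eq_zero`). At each corner the side turns by
a right angle and exactly one of f, g switches its vanishing component, so if the phases match on
one side they match on all (`exists_edge_eq`). They match on the side of u₀: the residues decide
which component of g vanishes there and which component of f vanishes at v₀, and the parity of the
white corners carries the latter from v₀ to u₀. Hence Re G is locally constant inside the sides,
away from u₀ and v₀.

Near a boundary point ζ the domain is exactly one sector (`exists_sector_eq`), and the coordinate w
with z = ζ + κ w^α opens its angle απ to a half plane. A function with a vanishing component extends
across the real axis by reflection (`exists_reflection`), so it is bounded. At a corner of its own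
colour, the other function times dz/dw is O((Im w)^(-1/2)), by boundedness at a convex corner and by
semi-boundedness at a concave one (`IsBdryChart.exists_norm_mul_deriv_le`). This is integrable, so G
has a limit at the corner and the constants on the two sides agree. At u₀ and v₀ the form f g dz has
a simple pole with imaginary residue, so Re G is a bounded function plus a multiple of an argument
(`IsBdryChart.exists_re_primitive_le`).

Finally c ≠ 0: otherwise Re G vanishes identically, then so does f g, then f or g, contradicting the
poles. -/

set_option linter.unusedSectionVars false

namespace PolygonHM

/-! ### Primitives on simply connected domains, by lifting to a covering -/

section Primitive

/-- The complex numbers with the discrete topology: the fibre of the covering whose sections are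
the primitives of a holomorphic function. -/
def PrimitiveFiber : Type := ℂ

instance : TopologicalSpace PrimitiveFiber := ⊥

instance : DiscreteTopology PrimitiveFiber := ⟨rfl⟩

/-- Translation of the fibre. -/
def PrimitiveFiber.shift (c : ℂ) : PrimitiveFiber → PrimitiveFiber := fun v : ℂ => (v + c : ℂ)

/-- The covering of `Ω` by germs of primitives, given by primitives `P x` on balls
`ball x (r x)`. -/
def primitiveCore (Ω : Set ℂ) (r : Ω → ℝ) (hr : ∀ x, 0 < r x) (P : Ω → ℂ → ℂ) (f : ℂ → ℂ)
    (hP : ∀ x : Ω, ∀ z ∈ Metric.ball (x : ℂ) (r x), HasDerivAt (P x) (f z) z) :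
    FiberBundleCore Ω Ω PrimitiveFiber where
  baseSet i := {x | (x : ℂ) ∈ Metric.ball (i : ℂ) (r i)}
  isOpen_baseSet i := Metric.isOpen_ball.preimage continuous_subtype_val
  indexAt x := x
  mem_baseSet_at x := Metric.mem_ball_self (hr x)
  -- The coordinate `v` over ball `i` stands for the primitive `P i + v`. The sign is forced by
  -- keeping this primitive unchanged on passing to `j`.
  coordChange i j x v := PrimitiveFiber.shift (P i x - P j x) v
  coordChange_self i x _ v := by
    change (show ℂ from v) + (P i x - P i x) = v
    rw [sub_self, add_zero]
  continuousOn_coordChange i j := by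
    intro p hp
    have hpc : ((p.1 : Ω) : ℂ) ∈ Metric.ball (i : ℂ) (r i) ∩ Metric.ball (j : ℂ) (r j) := hp.1
    -- Two primitives differ by a constant on the convex intersection of two balls, so the
    -- coordinate change does not depend on the base point.
    have key : ∀ z ∈ Metric.ball (i : ℂ) (r i) ∩ Metric.ball (j : ℂ) (r j),
        P i z - P j z = P i p.1 - P j p.1 := by
      intro z hz
      have hconv := (convex_ball (i : ℂ) (r i)).inter (convex_ball (j : ℂ) (r j))
      have hd : ∀ y ∈ Metric.ball (i : ℂ) (r i) ∩ Metric.ball (j : ℂ) (r j),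
          HasDerivWithinAt (fun z => P i z - P j z) 0
            (Metric.ball (i : ℂ) (r i) ∩ Metric.ball (j : ℂ) (r j)) y := by
        intro y hy
        have := ((hP i y hy.1).sub (hP j y hy.2)).hasDerivWithinAt
          (s := Metric.ball (i : ℂ) (r i) ∩ Metric.ball (j : ℂ) (r j))
        rw [sub_self] at this
        exact this
      have := hconv.norm_image_sub_le_of_norm_hasDerivWithin_le (C := 0) hd
        (by simp) hpc hz
      simpa [sub_eq_zero] using this
    have hc : ContinuousOn (fun q : Ω × PrimitiveFiber =>
        PrimitiveFiber.shift (P i p.1 - P j p.1) q.2)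
        (({q : Ω | (q : ℂ) ∈ Metric.ball (i : ℂ) (r i)} ∩
          {q : Ω | (q : ℂ) ∈ Metric.ball (j : ℂ) (r j)}) ×ˢ univ) :=
      ((continuous_of_discreteTopology (f := PrimitiveFiber.shift _)).comp
        continuous_snd).continuousOn
    refine (hc.congr ?_) p hp
    intro q hq
    simp only [key _ hq.1]
  coordChange_comp i j k x _ v := by
    change ((show ℂ from v) + (P i x - P j x)) + (P j x - P k x)
      = (show ℂ from v) + (P i x - P k x)
    ring

/-- A holomorphic function on a simply connected open set has a primitive. -/
theorem exists_primitive {Ω : Set ℂ} (hΩ : IsOpen Ω) [SimplyConnectedSpace Ω] {f : ℂ → ℂ}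
    (hf : DifferentiableOn ℂ f Ω) : ∃ G : ℂ → ℂ, ∀ z ∈ Ω, HasDerivAt G (f z) z := by
  classical
  have hball : ∀ x : Ω, ∃ r : ℝ, 0 < r ∧ Metric.ball (x : ℂ) r ⊆ Ω := fun x => by
    obtain ⟨r, hr, h⟩ := Metric.isOpen_iff.1 hΩ x x.2
    exact ⟨r, hr, h⟩
  choose r hr hrΩ using hball
  have hprim : ∀ x : Ω, ∃ P : ℂ → ℂ, ∀ z ∈ Metric.ball (x : ℂ) (r x), HasDerivAt P (f z) z :=
    fun x => (hf.mono (hrΩ x)).isExactOn_ball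
  choose P hP using hprim
  set Z := primitiveCore Ω r hr P f hP with hZ
  have cov : IsCoveringMap Z.proj :=
    IsFiberBundle.isCoveringMap fun x => ⟨Z.localTriv (Z.indexAt x), Z.mem_baseSet_at x⟩
  have := hΩ.locallyPathConnectedSpace
  obtain ⟨x₀⟩ : Nonempty Ω := inferInstance
  -- Simple connectedness enters here: the identity lifts to a global section, which is a coherent
  -- choice of the constants of integration.
  obtain ⟨s, ⟨-, hs⟩, -⟩ := cov.existsUnique_continuousMap_lifts (ContinuousMap.id Ω) x₀
    (⟨x₀, (0 : ℂ)⟩ : Z.TotalSpace) rfl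
  have hs1 : ∀ x, (s x).1 = x := fun x => congrFun hs x
  let v : Ω → ℂ := fun x => (s x).2
  refine ⟨fun z => if h : z ∈ Ω then P ⟨z, h⟩ z + v ⟨z, h⟩ else 0, fun z hz => ?_⟩
  let i : Ω := ⟨z, hz⟩
  -- Read in the fixed trivialisation `i`, the section is continuous with discrete values, hence
  -- locally constant; so near `z` the glued function is `P i` plus a constant.
  have hcont : ContinuousAt (fun x => (Z.localTriv i (s x)).2) i := by
    have h1 : ContinuousAt (Z.localTriv i) (s i) :=
      (Z.localTriv i).continuousAt (by
        rw [(Z.localTriv i).mem_source]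
        change (s i).1 ∈ Z.baseSet i
        rw [hs1]
        exact Z.mem_baseSet_at i)
    exact (continuous_snd.continuousAt.comp h1).comp s.continuous.continuousAt
  have hloc : ∀ᶠ x in 𝓝 i, (Z.localTriv i (s x)).2 = (Z.localTriv i (s i)).2 := by
    have := hcont.eventually (IsOpen.mem_nhds (isOpen_discrete {(Z.localTriv i (s i)).2}) rfl)
    exact this
  have hval : ∀ x : Ω, (show ℂ from (Z.localTriv i (s x)).2) = v x + (P x x - P i x) := by
    intro x
    have : (show ℂ from (Z.localTriv i (s x)).2) = v x + (P (s x).1 (s x).1 - P i (s x).1) := rfl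
    rw [this, hs1]
  have hev : ∀ᶠ y in 𝓝 z, ∀ h : y ∈ Ω, v ⟨y, h⟩ + (P ⟨y, h⟩ y - P i y) = v i := by
    have := hΩ.isOpenEmbedding_subtypeVal.map_nhds_eq i
    have h2 : ∀ᶠ y in map Subtype.val (𝓝 i), ∀ h : y ∈ Ω,
        v ⟨y, h⟩ + (P ⟨y, h⟩ y - P i y) = v i := by
      rw [eventually_map]
      filter_upwards [hloc] with x hx h
      have h3 := (hval x).symm.trans (hx.trans (hval i))
      simpa using h3
    rwa [this] at h2
  have hd := (hP i z (Metric.mem_ball_self (hr i))).add_const (v i)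
  refine hd.congr_of_eventuallyEq ?_
  filter_upwards [hev, hΩ.mem_nhds hz] with y hy hyΩ
  rw [dif_pos hyΩ, ← hy hyΩ]
  ring

end Primitive

/-! ### Growth and Hölder estimates on half discs -/

section HalfDisc

/-- The open upper half of the disc of radius `r` around `0`. -/
def halfDisc (r : ℝ) : Set ℂ := {w | 0 < w.im ∧ ‖w‖ < r}

theorem isOpen_halfDisc (r : ℝ) : IsOpen (halfDisc r) :=
  (isOpen_lt continuous_const continuous_im).inter (isOpen_lt continuous_norm continuous_const)

theorem convex_halfDisc (r : ℝ) : Convex ℝ (halfDisc r) := by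
  have h : halfDisc r = {w : ℂ | 0 < w.im} ∩ Metric.ball 0 r := by
    ext w; simp [halfDisc]
  rw [h]
  exact (convex_halfSpace_im_gt 0).inter (convex_ball 0 r)

theorem halfDisc_mono {r s : ℝ} (h : r ≤ s) : halfDisc r ⊆ halfDisc s :=
  fun _ hw => ⟨hw.1, hw.2.trans_le h⟩

theorem halfDisc_mem_nhdsWithin {r : ℝ} {w : ℂ} (hw : ‖w‖ < r) :
    halfDisc r ∈ 𝓝[{w : ℂ | 0 < w.im}] w := by
  refine mem_nhdsWithin.2 ⟨{z | ‖z‖ < r}, isOpen_lt continuous_norm continuous_const, hw, ?_⟩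
  rintro z ⟨h1, h2⟩
  exact ⟨h2, h1⟩

theorem exists_halfDisc_of_eventually {P : ℂ → Prop} (h : ∀ᶠ w in 𝓝[{w : ℂ | 0 < w.im}] 0, P w) :
    ∃ r > 0, ∀ w ∈ halfDisc r, P w := by
  obtain ⟨r, hr, h⟩ := Metric.mem_nhdsWithin_iff.1 h
  exact ⟨r, hr, fun w hw => h ⟨by simpa using hw.2, hw.1⟩⟩

/-- A holomorphic function with values in the closed upper half plane grows at most like the
inverse of the distance to the real axis. -/
theorem exists_norm_le_div_im {r : ℝ} (hr : 0 < r) {P : ℂ → ℂ}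
    (hP : DifferentiableOn ℂ P (halfDisc r)) (hIm : ∀ w ∈ halfDisc r, 0 ≤ (P w).im) :
    ∃ K > 0, ∀ w ∈ halfDisc (r / 4), ‖P w‖ ≤ K / w.im := by
  -- Borel–Carathéodory is applied on the disc of radius R centred at `w.re + R * I`, tangent to the
  -- axis below `w`. The gap R - |w - centre| is then exactly `w.im`, and compactness bounds `P` at
  -- all the centres.
  set R := r / 4 with hR
  have hR0 : 0 < R := by positivity
  have hball : ∀ x : ℝ, |x| ≤ R → ∀ u : ℂ, ‖u‖ < R → (x + R * I + u : ℂ) ∈ halfDisc r := by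
    intro x hx u hu
    have h1 := abs_le.1 ((abs_im_le_norm u).trans hu.le)
    have h2 := (abs_im_le_norm u).trans_lt hu
    constructor
    · simp only [add_im, ofReal_im, mul_im, ofReal_re, I_im, I_re]
      have := (abs_lt.1 h2).1
      linarith
    · calc ‖(x + R * I + u : ℂ)‖ ≤ ‖(x : ℂ)‖ + ‖(R * I : ℂ)‖ + ‖u‖ := norm_add₃_le
        _ = |x| + R + ‖u‖ := by simp [abs_of_pos hR0]
        _ < r := by linarith
  have hcont : ContinuousOn (fun x : ℝ => P (x + R * I)) (Icc (-R) R) := by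
    refine hP.continuousOn.comp (by fun_prop) fun x hx => ?_
    simpa using hball x (abs_le.2 hx) 0 (by simpa using hR0)
  obtain ⟨M, hM⟩ := isCompact_Icc.exists_bound_of_continuousOn hcont
  have hM0 : 0 ≤ M := (norm_nonneg _).trans (hM 0 ⟨by linarith, by linarith⟩)
  refine ⟨2 * R * (1 + M), by positivity, fun w hw => ?_⟩
  have hx : |w.re| ≤ R := (abs_re_le_norm w).trans hw.2.le
  have hy : w.im < R := (le_abs_self _).trans_lt ((abs_im_le_norm w).trans_lt hw.2)
  set F : ℂ → ℂ := fun u => I * P (w.re + R * I + u) with hF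
  have hFd : DifferentiableOn ℂ F (Metric.ball 0 R) := by
    refine (hP.comp (by fun_prop) fun u hu => ?_).const_mul I
    exact hball _ hx u (by simpa using hu)
  have hFm : MapsTo F (Metric.ball 0 R) {z | z.re ≤ 1} := by
    intro u hu
    have := hIm _ (hball _ hx u (by simpa using hu))
    simp only [hF, mem_ofPred_eq, mul_re, I_re, I_im]
    linarith
  have hz : (w - (w.re + R * I) : ℂ) = ((w.im - R : ℝ) : ℂ) * I := by
    apply Complex.ext <;> simp
  have hzn : ‖(w - (w.re + R * I) : ℂ)‖ = R - w.im := by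
    rw [hz, norm_mul, norm_I, mul_one, norm_real, Real.norm_eq_abs, abs_sub_comm, abs_of_pos]
    linarith
  have key := borelCaratheodory one_pos hFd hFm hR0 (z := w - (w.re + R * I))
    (by rw [mem_ball_zero_iff, hzn]; linarith [hw.1])
  rw [hzn] at key
  have e1 : ‖F (w - (w.re + R * I))‖ = ‖P w‖ := by simp [hF]
  have e2 : ‖F 0‖ ≤ M := by
    have := hM w.re (abs_le.1 hx)
    simpa [hF] using this
  rw [e1] at key
  have e3 : R - (R - w.im) = w.im := by ring
  rw [e3, ← add_div] at key
  refine key.trans (div_le_div_of_nonneg_right ?_ hw.1.le)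
  have := hw.1
  nlinarith [norm_nonneg (F 0)]

/-- A holomorphic function with bounded imaginary part on a half disc grows (much) slower than
the inverse square root of the distance to the real axis. -/
theorem exists_norm_le_div_sqrt_im {r : ℝ} (hr : 0 < r) {φ : ℂ → ℂ} {M : ℝ}
    (hφ : DifferentiableOn ℂ φ (halfDisc r)) (hIm : ∀ w ∈ halfDisc r, |(φ w).im| ≤ M) :
    ∃ K > 0, ∀ w ∈ halfDisc (r / 4), ‖φ w‖ ≤ K / √w.im := by
  have hM : 0 ≤ M := (abs_nonneg _).trans (hIm ((r / 2 : ℝ) * I) ⟨by simpa using hr, by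
    simp [abs_of_pos hr]; linarith⟩)
  -- With this c the imaginary part of ±cφ is at most 1 < π / 2, so exp(±cφ) lies in the right half
  -- plane and the preceding estimate applies after multiplication by I. The two signs bound Re φ
  -- from both sides by a logarithm.
  set c := 1 / (M + 1) with hc
  have hc0 : 0 < c := by positivity
  have hpos : ∀ s : ℝ, |s| = c → ∀ w ∈ halfDisc r, 0 ≤ (I * Complex.exp (s * φ w)).im := by
    intro s hs w hw
    have h1 : |(s * φ w).im| ≤ 1 := by
      rw [im_ofReal_mul, abs_mul, hs]
      have := hIm w hw
      calc c * |(φ w).im| ≤ c * (M + 1) := by gcongr; linarith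
        _ = 1 := by rw [hc]; field_simp
    have h2 := abs_le.1 h1
    have h3 : 0 ≤ Real.cos ((s * φ w).im) :=
      Real.cos_nonneg_of_mem_Icc ⟨by linarith [Real.pi_gt_three], by linarith [Real.pi_gt_three]⟩
    rw [mul_im, I_re, I_im, exp_re]
    have := Real.exp_pos (s * φ w).re
    nlinarith
  have hd : ∀ s : ℝ, DifferentiableOn ℂ (fun w => I * Complex.exp (s * φ w)) (halfDisc r) :=
    fun s => ((hφ.const_mul _).cexp).const_mul _
  obtain ⟨K₁, hK₁, h₁⟩ := exists_norm_le_div_im hr (hd c) (hpos c (abs_of_pos hc0))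
  obtain ⟨K₂, hK₂, h₂⟩ := exists_norm_le_div_im hr (hd (-c))
    (hpos (-c) (by rw [abs_neg, abs_of_pos hc0]))
  set K := max K₁ K₂ with hK
  have hK0 : 0 < K := lt_max_of_lt_left hK₁
  have hlog : ∀ s : ℝ, |s| = c → ∀ w ∈ halfDisc (r / 4),
      ‖I * Complex.exp (s * φ w)‖ ≤ K / w.im → s * (φ w).re ≤ 2 * (√K / √w.im) := by
    intro s hs w hw h
    rw [norm_mul, norm_I, one_mul, norm_exp, re_ofReal_mul] at h
    have h4 : s * (φ w).re ≤ Real.log (K / w.im) :=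
      (Real.le_log_iff_exp_le (div_pos hK0 hw.1)).2 h
    have h5 : Real.log (K / w.im) = 2 * Real.log (√(K / w.im)) := by
      rw [Real.log_sqrt (div_pos hK0 hw.1).le]; ring
    rw [← Real.sqrt_div hK0.le]
    have h6 := Real.log_le_sub_one_of_pos (Real.sqrt_pos.2 (div_pos hK0 hw.1))
    linarith
  refine ⟨2 * √K / c + M * √r, by positivity, fun w hw => ?_⟩
  have hsq : 0 < √w.im := Real.sqrt_pos.2 hw.1
  have a1 := hlog c (abs_of_pos hc0) w hw ((h₁ w hw).trans
    (div_le_div_of_nonneg_right (le_max_left _ _) hw.1.le))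
  have a2 := hlog (-c) (by rw [abs_neg, abs_of_pos hc0]) w hw ((h₂ w hw).trans
    (div_le_div_of_nonneg_right (le_max_right _ _) hw.1.le))
  have a3 : |(φ w).re| ≤ 2 * (√K / √w.im) / c := by
    rw [le_div_iff₀ hc0, mul_comm]
    rcases abs_cases (φ w).re with ⟨h, -⟩ | ⟨h, -⟩ <;> rw [h] <;> linarith
  have a4 : M ≤ M * √r / √w.im := by
    rw [le_div_iff₀ hsq]
    refine mul_le_mul_of_nonneg_left (Real.sqrt_le_sqrt ?_) hM
    have := (le_abs_self _).trans ((abs_im_le_norm w).trans hw.2.le)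
    linarith
  have a5 := hIm w (halfDisc_mono (by linarith) hw)
  calc ‖φ w‖ ≤ |(φ w).re| + |(φ w).im| := norm_le_abs_re_add_abs_im _
    _ ≤ 2 * (√K / √w.im) / c + M * √r / √w.im := by linarith
    _ = (2 * √K / c + M * √r) / √w.im := by field_simp

/-- If the derivative is bounded by the inverse square root of the distance to the real axis, then
the function is Hölder continuous. -/
theorem norm_sub_le_sqrt_of_norm_deriv_le {r K : ℝ} {Φ Φ' : ℂ → ℂ}
    (hΦ : ∀ w ∈ halfDisc r, HasDerivAt Φ (Φ' w) w)
    (hK : ∀ w ∈ halfDisc r, ‖Φ' w‖ ≤ K / √w.im) {z₁ z₂ : ℂ} (h₁ : z₁ ∈ halfDisc (r / 4))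
    (h₂ : z₂ ∈ halfDisc (r / 4)) : ‖Φ z₂ - Φ z₁‖ ≤ 5 * K * √‖z₂ - z₁‖ := by
  rcases eq_or_ne z₁ z₂ with rfl | hne
  · simp
  -- The points are joined by going up by δ, across at height at least δ, and down again. The three
  -- pieces cost 2, 1 and 2 times K√δ; since r/4 + δ < r, the detour stays in the half disc.
  set δ := ‖z₂ - z₁‖ with hδ
  have hδ0 : 0 < δ := norm_pos_iff.2 (sub_ne_zero.2 hne.symm)
  have hδr : δ < r / 2 := by
    have := norm_sub_le z₂ z₁
    linarith [h₁.2, h₂.2]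
  have hr : 0 < r := by linarith
  have hK0 : 0 ≤ K := by
    have := (norm_nonneg _).trans (hK z₁ (halfDisc_mono (by linarith) h₁))
    by_contra hneg
    have : K / √z₁.im < 0 := div_neg_of_neg_of_pos (not_le.1 hneg) (Real.sqrt_pos.2 h₁.1)
    linarith
  have hup : ∀ z ∈ halfDisc (r / 4), ∀ t ∈ Icc 0 δ, (z + t * I : ℂ) ∈ halfDisc r := by
    intro z hz t ht
    constructor
    · simp only [add_im, mul_im, ofReal_re, I_im, ofReal_im, I_re]
      have := hz.1
      linarith [ht.1]
    · calc ‖(z + t * I : ℂ)‖ ≤ ‖z‖ + ‖(t * I : ℂ)‖ := norm_add_le _ _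
        _ = ‖z‖ + t := by simp [abs_of_nonneg ht.1]
        _ < r := by linarith [hz.2, ht.2]
  have hvert : ∀ z ∈ halfDisc (r / 4), ‖Φ (z + δ * I) - Φ z‖ ≤ 2 * K * √δ := by
    intro z hz
    have him : ∀ t : ℝ, (z + t * I : ℂ).im = z.im + t := fun t => by simp
    have hder : ∀ t ∈ Icc 0 δ,
        HasDerivAt (fun t : ℝ => Φ (z + t * I) - Φ z) (Φ' (z + t * I) * I) t := by
      intro t ht
      have h1 : HasDerivAt (fun u : ℂ => z + u * I) (1 * I) (t : ℂ) :=
        ((hasDerivAt_id (t : ℂ)).mul_const I).const_add z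
      rw [one_mul] at h1
      exact (((hΦ _ (hup z hz t ht)).comp (t : ℂ) h1).comp_ofReal).sub_const _
    have hB : ∀ t ∈ Icc 0 δ,
        HasDerivAt (fun t : ℝ => 2 * K * (√(z.im + t) - √z.im)) (K / √(z.im + t)) t := by
      intro t ht
      have hp : z.im + t ≠ 0 := by linarith [hz.1, ht.1]
      have h1 : HasDerivAt (fun t : ℝ => 2 * K * (√(z.im + t) - √z.im))
          (2 * K * (1 / (2 * √(z.im + t)))) t :=
        ((((hasDerivAt_id t).const_add z.im).sqrt hp).sub_const (√z.im)).const_mul (2 * K)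
      have e : 2 * K * (1 / (2 * √(z.im + t))) = K / √(z.im + t) := by ring
      rwa [e] at h1
    have := image_norm_le_of_norm_deriv_right_le_deriv_boundary' (a := 0) (b := δ)
      (f := fun t : ℝ => Φ (z + t * I) - Φ z) (f' := fun t : ℝ => Φ' (z + t * I) * I)
      (B := fun t : ℝ => 2 * K * (√(z.im + t) - √z.im)) (B' := fun t => K / √(z.im + t))
      (fun t ht => (hder t ht).continuousAt.continuousWithinAt)
      (fun t ht => (hder t (Ico_subset_Icc_self ht)).hasDerivWithinAt) (by simp)
      (fun t ht => (hB t ht).continuousAt.continuousWithinAt)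
      (fun t ht => (hB t (Ico_subset_Icc_self ht)).hasDerivWithinAt)
      (fun t ht => by
        rw [norm_mul, norm_I, mul_one, ← him]
        exact hK _ (hup z hz t (Ico_subset_Icc_self ht)))
      (right_mem_Icc.2 hδ0.le)
    refine this.trans ?_
    have hs : √(z.im + δ) ≤ √z.im + √δ := by
      rw [Real.sqrt_le_left (by positivity)]
      have e1 := Real.sq_sqrt hz.1.le
      have e2 := Real.sq_sqrt hδ0.le
      nlinarith [mul_nonneg (Real.sqrt_nonneg z.im) (Real.sqrt_nonneg δ)]
    exact mul_le_mul_of_nonneg_left (by linarith) (by positivity)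
  have hhor : ‖Φ (z₂ + δ * I) - Φ (z₁ + δ * I)‖ ≤ K * √δ := by
    set S : Set ℂ := halfDisc r ∩ {w | δ ≤ w.im} with hS
    have hconv : Convex ℝ S := (convex_halfDisc r).inter (convex_halfSpace_im_ge δ)
    have hmem : ∀ z ∈ halfDisc (r / 4), (z + δ * I : ℂ) ∈ S := by
      intro z hz
      refine ⟨hup z hz δ (right_mem_Icc.2 hδ0.le), ?_⟩
      have := hz.1
      simp only [mem_ofPred_eq, add_im, mul_im, ofReal_re, I_im, ofReal_im, I_re]
      linarith
    have := hconv.norm_image_sub_le_of_norm_hasDerivWithin_le (f := Φ) (f' := Φ') (C := K / √δ)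
      (fun w hw => (hΦ w hw.1).hasDerivWithinAt)
      (fun w hw => (hK w hw.1).trans
        (div_le_div_of_nonneg_left hK0 (Real.sqrt_pos.2 hδ0) (Real.sqrt_le_sqrt hw.2)))
      (hmem _ h₁) (hmem _ h₂)
    rw [add_sub_add_right_eq_sub, ← hδ] at this
    refine this.trans (le_of_eq ?_)
    rw [div_mul_eq_mul_div, mul_div_assoc, Real.div_sqrt]
  have v₁ := hvert z₁ h₁
  have v₂ := hvert z₂ h₂
  rw [norm_sub_rev] at v₂
  calc ‖Φ z₂ - Φ z₁‖ = ‖(Φ z₂ - Φ (z₂ + δ * I)) + (Φ (z₂ + δ * I) - Φ (z₁ + δ * I))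
        + (Φ (z₁ + δ * I) - Φ z₁)‖ := by ring_nf
    _ ≤ _ := norm_add₃_le
    _ ≤ 5 * K * √δ := by linarith

end HalfDisc

/-! ### Schwarz reflection from the boundary values of one component -/

section Reflection

/-- Points of the closed upper half plane are accumulation points of the open one. -/
theorem nhdsWithin_upper_neBot {w : ℂ} (hw : 0 ≤ w.im) : (𝓝[{w : ℂ | 0 < w.im}] w).NeBot := by
  rw [← mem_closure_iff_nhdsWithin_neBot, Complex.closure_setOfPred_lt_im]
  exact hw

theorem nhdsWithin_halfDisc {r : ℝ} {w : ℂ} (hw : ‖w‖ < r) :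
    𝓝[halfDisc r] w = 𝓝[{w : ℂ | 0 < w.im}] w :=
  le_antisymm (nhdsWithin_mono _ fun _ h => h.1)
    (nhdsWithin_le_iff.2 (halfDisc_mem_nhdsWithin hw))

/-- If the derivative is bounded by the inverse square root of the distance to the real axis, then
the function has limits at the real axis. -/
theorem exists_tendsto_of_norm_deriv_le {r K : ℝ} {Φ Φ' : ℂ → ℂ}
    (hΦ : ∀ w ∈ halfDisc r, HasDerivAt Φ (Φ' w) w)
    (hK : ∀ w ∈ halfDisc r, ‖Φ' w‖ ≤ K / √w.im) {w : ℂ} (hw : 0 ≤ w.im) (hwr : ‖w‖ < r / 4) :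
    ∃ y, Tendsto Φ (𝓝[{w : ℂ | 0 < w.im}] w) (𝓝 y) := by
  have huc : UniformContinuousOn Φ (halfDisc (r / 4)) := by
    rw [Metric.uniformContinuousOn_iff]
    intro ε hε
    have hc : ContinuousAt (fun t : ℝ => 5 * K * √t) 0 := by fun_prop
    have h0 : (fun t : ℝ => 5 * K * √t) 0 < ε := by simpa using hε
    obtain ⟨δ, hδ, h⟩ := Metric.eventually_nhds_iff.1 (hc.eventually (gt_mem_nhds h0))
    refine ⟨δ, hδ, fun x hx y hy hxy => ?_⟩
    rw [dist_eq_norm]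
    refine (norm_sub_le_sqrt_of_norm_deriv_le hΦ hK hy hx).trans_lt (h ?_)
    rw [Real.dist_eq, sub_zero, abs_norm, ← dist_eq_norm]
    exact hxy
  have := nhdsWithin_upper_neBot hw
  rw [← nhdsWithin_halfDisc hwr] at this ⊢
  have hcau : Cauchy (𝓝[halfDisc (r / 4)] w) := cauchy_nhds.mono inf_le_left
  exact cauchy_map_iff_exists_tendsto.1 (hcau.map_of_le huc inf_le_right)

/-- A continuous function which is holomorphic off the real axis is holomorphic. -/
theorem differentiableOn_ball_of_continuousOn_of_im_ne_zero {r : ℝ} {Ψ : ℂ → ℂ}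
    (hc : ContinuousOn Ψ (Metric.ball 0 r))
    (hd : ∀ w ∈ Metric.ball (0 : ℂ) r, w.im ≠ 0 → DifferentiableAt ℂ Ψ w) :
    DifferentiableOn ℂ Ψ (Metric.ball 0 r) := by
  -- Morera with rectangles. Those whose interior misses the axis are covered by Cauchy's theorem
  -- with continuity up to the boundary; the others are cut along the axis.
  have base : ∀ z w : ℂ, Rectangle z w ⊆ Metric.ball 0 r →
      (0 : ℝ) ∉ Ioo (min z.im w.im) (max z.im w.im) →
      wedgeIntegral z w Ψ + wedgeIntegral w z Ψ = 0 := by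
    intro z w h h0
    rw [wedgeIntegral_add_wedgeIntegral_eq]
    refine integral_boundary_rect_eq_zero_of_continuousOn_of_differentiableOn Ψ z w
      (hc.mono h) fun u hu => (hd u (h ?_) ?_).differentiableWithinAt
    · exact ⟨Ioo_subset_Icc_self hu.1, Ioo_subset_Icc_self hu.2⟩
    · intro hu0
      exact h0 (hu0 ▸ hu.2)
  refine ((isConservativeOn_and_continuousOn_iff_isDifferentiableOn Metric.isOpen_ball).1
    ⟨fun z w h => ?_, hc⟩)
  rw [← add_eq_zero_iff_eq_neg]
  by_cases h0 : (0 : ℝ) ∈ Ioo (min z.im w.im) (max z.im w.im)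
  swap
  · exact base z w h h0
  have h0' : (0 : ℝ) ∈ uIcc z.im w.im := Ioo_subset_Icc_self h0
  have hsub1 : Rectangle z (w.re : ℂ) ⊆ Rectangle z w := by
    rintro u ⟨h1, h2⟩
    refine ⟨by simpa using h1, ?_⟩
    rw [ofReal_im] at h2
    exact uIcc_subset_uIcc_left h0' h2
  have hsub2 : Rectangle (z.re : ℂ) w ⊆ Rectangle z w := by
    rintro u ⟨h1, h2⟩
    refine ⟨by simpa using h1, ?_⟩
    rw [ofReal_im] at h2
    exact uIcc_subset_uIcc_right h0' h2
  have b1 := base z (w.re : ℂ) (hsub1.trans h) (by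
    rw [ofReal_im]
    rintro ⟨h1, h2⟩
    rcases le_total z.im 0 with h3 | h3
    · rw [max_eq_right h3] at h2; exact lt_irrefl _ h2
    · rw [min_eq_right h3] at h1; exact lt_irrefl _ h1)
  have b2 := base (z.re : ℂ) w (hsub2.trans h) (by
    rw [ofReal_im]
    rintro ⟨h1, h2⟩
    rcases le_total w.im 0 with h3 | h3
    · rw [max_eq_left h3] at h2; exact lt_irrefl _ h2
    · rw [min_eq_left h3] at h1; exact lt_irrefl _ h1)
  have hint : ∀ a ∈ uIcc z.re w.re, ∀ c ∈ uIcc z.im w.im, ∀ d ∈ uIcc z.im w.im,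
      IntervalIntegrable (fun y : ℝ => Ψ (a + y * I)) volume c d := by
    intro a ha c hcm d hdm
    refine ContinuousOn.intervalIntegrable (hc.comp (by fun_prop) fun y hy => h ?_)
    refine ⟨by simpa using ha, ?_⟩
    have := uIcc_subset_uIcc hcm hdm hy
    simpa using this
  have i1 := intervalIntegral.integral_add_adjacent_intervals
    (hint w.re right_mem_uIcc _ left_mem_uIcc _ h0') (hint w.re right_mem_uIcc _ h0' _ right_mem_uIcc)
  have i2 := intervalIntegral.integral_add_adjacent_intervals
    (hint z.re left_mem_uIcc _ left_mem_uIcc _ h0') (hint z.re left_mem_uIcc _ h0' _ right_mem_uIcc)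
  rw [wedgeIntegral_add_wedgeIntegral_eq] at b1 b2 ⊢
  simp only [ofReal_re, ofReal_im] at b1 b2
  rw [← i1, ← i2, smul_add, smul_add]
  linear_combination b1 + b2

/-- **Schwarz reflection principle**: if the imaginary part of a holomorphic function on a half
disc vanishes on the real axis, then the function extends holomorphically across the real axis. -/
theorem exists_reflection {r : ℝ} (hr : 0 < r) {φ : ℂ → ℂ}
    (hφ : DifferentiableOn ℂ φ (halfDisc r))
    (hIm : ∀ x : ℝ, |x| < r → Tendsto (fun w => (φ w).im) (𝓝[{w : ℂ | 0 < w.im}] (x : ℂ)) (𝓝 0)) :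
    ∃ ρ > 0, ρ ≤ r ∧ ∃ ψ : ℂ → ℂ, DifferentiableOn ℂ ψ (Metric.ball 0 ρ) ∧
      (∀ w ∈ halfDisc ρ, ψ w = φ w) ∧ ∀ x : ℝ, |x| < ρ → (ψ x).im = 0 := by
  obtain ⟨r₁, hr₁, h1⟩ : ∃ r₁ > 0, ∀ w ∈ halfDisc r₁, |(φ w).im| ≤ 1 := by
    have h0 := hIm 0 (by simpa using hr)
    rw [ofReal_zero] at h0
    refine exists_halfDisc_of_eventually ?_
    filter_upwards [h0.eventually (Metric.closedBall_mem_nhds (0 : ℝ) one_pos)] with w hw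
    simpa [Real.dist_eq] using hw
  set r₂ := min r r₁ with hr₂
  have hr₂0 : 0 < r₂ := lt_min hr hr₁
  obtain ⟨K, hK0, hK⟩ := exists_norm_le_div_sqrt_im hr₂0 (hφ.mono (halfDisc_mono (min_le_left _ _)))
    fun w hw => h1 w (halfDisc_mono (min_le_right _ _) hw)
  have hφ₂ : DifferentiableOn ℂ φ (halfDisc (r₂ / 4)) :=
    hφ.mono (halfDisc_mono (by linarith [min_le_left r r₁]))
  have hne : (halfDisc (r₂ / 4)).Nonempty :=
    ⟨((r₂ / 8 : ℝ) : ℂ) * I, by simpa using hr₂0, by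
      rw [norm_mul, norm_I, mul_one, norm_real, Real.norm_eq_abs, abs_of_pos] <;> linarith⟩
  have := (convex_halfDisc (r₂ / 4)).contractibleSpace hne
  obtain ⟨Φ, hΦ⟩ := exists_primitive (isOpen_halfDisc (r₂ / 4)) hφ₂
  set ρ := r₂ / 4 / 4 with hρ
  have hρ0 : 0 < ρ := by positivity
  have hρr : ρ ≤ r := by linarith [min_le_left r r₁]
  have hlim : ∀ w : ℂ, 0 ≤ w.im → ‖w‖ < ρ → ∃ y, Tendsto Φ (𝓝[{w : ℂ | 0 < w.im}] w) (𝓝 y) :=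
    fun w hw hwr => exists_tendsto_of_norm_deriv_le hΦ hK hw hwr
  set U : Set ℂ := {w : ℂ | 0 < w.im} with hU
  set E : ℂ → ℂ := extendFrom U Φ with hE
  have hEt : ∀ w : ℂ, 0 ≤ w.im → ‖w‖ < ρ → Tendsto Φ (𝓝[U] w) (𝓝 (E w)) :=
    fun w hw hwr => tendsto_extendFrom (hlim w hw hwr)
  have hEΦ : ∀ w ∈ halfDisc ρ, E w = Φ w := by
    intro w hw
    refine extendFrom_eq (subset_closure hw.1) ?_
    exact (hΦ w (halfDisc_mono (by linarith) hw)).continuousAt.continuousWithinAt.tendsto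
  have hEc : ContinuousOn E {w | 0 ≤ w.im ∧ ‖w‖ < ρ} := by
    refine continuousOn_extendFrom ?_ fun w hw => hlim w hw.1 hw.2
    rw [hU, Complex.closure_setOfPred_lt_im]
    exact fun w hw => hw.1
  -- the imaginary part of `E` is constant on the real axis
  have hder : ∀ x : ℝ, |x| < ρ → HasDerivAt (fun x : ℝ => (E x).im) 0 x := by
    intro x hx
    rw [hasDerivAt_iff_isLittleO, isLittleO_iff]
    intro ε hε
    have hev := (hIm x (hx.trans_le hρr)).eventually (Metric.closedBall_mem_nhds (0 : ℝ) hε)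
    obtain ⟨δ, hδ, hball⟩ := Metric.mem_nhdsWithin_iff.1 hev
    have hδ' : 0 < min δ (ρ - |x|) := lt_min hδ (by linarith)
    filter_upwards [Metric.ball_mem_nhds x hδ'] with y hy
    rw [Metric.mem_ball, Real.dist_eq] at hy
    have hyδ : |y - x| < δ := hy.trans_le (min_le_left _ _)
    have hyρ : |y| < ρ := by
      have h1 := hy.trans_le (min_le_right _ _)
      have h2 := abs_add_le (y - x) x
      rw [sub_add_cancel] at h2
      linarith
    set S : Set ℂ := Metric.ball (x : ℂ) δ ∩ halfDisc ρ with hS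
    have hSconv : Convex ℝ S := (convex_ball _ _).inter (convex_halfDisc ρ)
    have hup : ∀ t : ℝ, |t - x| < δ → |t| < ρ → ∀ᶠ s : ℝ in 𝓝[>] 0, (t + s * I : ℂ) ∈ S := by
      intro t ht htρ
      have hcont : Tendsto (fun s : ℝ => (t + s * I : ℂ)) (𝓝[>] 0) (𝓝 (t : ℂ)) := by
        have : Continuous (fun s : ℝ => (t + s * I : ℂ)) := by fun_prop
        simpa using (this.tendsto 0).mono_left nhdsWithin_le_nhds
      have m1 : Metric.ball (x : ℂ) δ ∈ 𝓝 (t : ℂ) := by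
        refine Metric.isOpen_ball.mem_nhds ?_
        rw [Metric.mem_ball, dist_eq_norm, ← ofReal_sub, norm_real]
        exact ht
      have m2 : Metric.ball (0 : ℂ) ρ ∈ 𝓝 (t : ℂ) := by
        refine Metric.isOpen_ball.mem_nhds ?_
        rw [mem_ball_zero_iff, norm_real]
        exact htρ
      filter_upwards [hcont.eventually m1, hcont.eventually m2, self_mem_nhdsWithin] with s a b c
      refine ⟨a, ?_, by simpa using b⟩
      simpa using c
    have hTend : ∀ t : ℝ, |t - x| < δ → |t| < ρ →
        Tendsto (fun s : ℝ => (Φ (t + s * I)).im) (𝓝[>] 0) (𝓝 (E t).im) := by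
      intro t ht htρ
      refine (continuous_im.tendsto _).comp ((hEt t (by simp) (by simpa using htρ)).comp ?_)
      refine tendsto_nhdsWithin_iff.2 ⟨?_, ?_⟩
      · have : Continuous (fun s : ℝ => (t + s * I : ℂ)) := by fun_prop
        simpa using (this.tendsto 0).mono_left nhdsWithin_le_nhds
      · filter_upwards [hup t ht htρ] with s hs using hs.2.1
    have hx0 : |x - x| < δ := by simpa using hδ
    -- The increment is estimated on a horizontal segment at height s, where the derivative of Im Φ
    -- is Im φ, of size at most ε; then s tends to 0.
    have hle : ∀ᶠ s : ℝ in 𝓝[>] 0,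
        ‖(Φ (y + s * I)).im - (Φ (x + s * I)).im‖ ≤ ε * ‖y - x‖ := by
      filter_upwards [hup y hyδ hyρ, hup x hx0 hx, self_mem_nhdsWithin] with s hs1 hs2 hs0
      set γ : ℝ → ℂ := fun t => t + s * I with hγ
      have hseg : ∀ t ∈ uIcc x y, γ t ∈ S := by
        intro t ht
        rw [← segment_eq_uIcc] at ht
        obtain ⟨a, b, ha, hb, hab, rfl⟩ := ht
        have h3 : γ (a • x + b • y) = a • γ x + b • γ y := by
          simp only [hγ, smul_eq_mul, ofReal_add, ofReal_mul, real_smul]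
          have : (a : ℂ) + b = 1 := by exact_mod_cast hab
          linear_combination -(s * I) * this
        rw [h3]
        exact hSconv hs2 hs1 ha hb hab
      have hgd : ∀ t ∈ uIcc x y, HasDerivWithinAt (fun t : ℝ => (Φ (γ t)).im) ((φ (γ t)).im)
          (uIcc x y) t := by
        intro t ht
        have e1 : HasDerivAt (fun u : ℂ => u + s * I) 1 (t : ℂ) := (hasDerivAt_id (t : ℂ)).add_const _
        have e2 := ((hΦ (γ t) (halfDisc_mono (by linarith) (hseg t ht).2)).comp (t : ℂ) e1).comp_ofReal
        rw [mul_one] at e2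
        have e3 : HasDerivAt (fun t : ℝ => (Φ (γ t)).im) ((φ (γ t)).im) t :=
          imCLM.hasFDerivAt.comp_hasDerivAt t e2
        exact e3.hasDerivWithinAt
      have := (convex_uIcc x y).norm_image_sub_le_of_norm_hasDerivWithin_le hgd (C := ε)
        (fun t ht => by
          have := hball ⟨(hseg t ht).1, (hseg t ht).2.1⟩
          simpa [Real.dist_eq] using this) left_mem_uIcc right_mem_uIcc
      exact this
    have := le_of_tendsto (((hTend y hyδ hyρ).sub (hTend x hx0 hx)).norm) hle
    simpa using this
  have hconst : ∀ x : ℝ, |x| < ρ → (E x).im = (E 0).im := by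
    intro x hx
    have hd : ∀ t ∈ Ioo (-ρ) ρ, HasDerivWithinAt (fun x : ℝ => (E x).im) 0 (Ioo (-ρ) ρ) t :=
      fun t ht => (hder t (abs_lt.2 ht)).hasDerivWithinAt
    have := (convex_Ioo (-ρ) ρ).norm_image_sub_le_of_norm_hasDerivWithin_le (C := 0) hd (by simp)
      (x := 0) (y := x) ⟨by linarith, hρ0⟩ (abs_lt.1 hx)
    simpa [sub_eq_zero] using this
  -- Subtracting this constant makes the primitive real on the axis, so the two branches of Ψ agree
  -- there.
  set c : ℂ := ((E 0).im : ℂ) * I with hcdef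
  classical
  set Ψ : ℂ → ℂ := fun w => if 0 ≤ w.im then E w - c else conj (E (conj w) - c) with hΨ
  have hΨc : ContinuousOn Ψ (Metric.ball 0 ρ) := by
    refine ContinuousOn.if ?_ ?_ ?_
    · rintro w ⟨hw, hf⟩
      rw [Complex.frontier_setOfPred_le_im] at hf
      have hwr : w = (w.re : ℂ) := by apply Complex.ext; simp; simpa using hf
      have hn : |w.re| < ρ := (abs_re_le_norm w).trans_lt (by simpa using hw)
      rw [hwr, conj_ofReal]
      apply Complex.ext
      · simp
      · have := hconst _ hn
        simp [hcdef, this]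
    · rw [(isClosed_le continuous_const continuous_im).closure_eq]
      exact (hEc.mono fun w hw => ⟨hw.2, by simpa using hw.1⟩).sub continuousOn_const
    · have hcl : closure {w : ℂ | ¬ 0 ≤ w.im} = {w | w.im ≤ 0} := by
        simp only [not_le]
        exact Complex.closure_setOfPred_im_lt 0
      rw [hcl]
      refine continuous_conj.comp_continuousOn (ContinuousOn.sub ?_ continuousOn_const)
      refine hEc.comp continuous_conj.continuousOn fun w hw => ⟨?_, ?_⟩
      · have := hw.2
        simpa using this
      · simpa using hw.1
  have hΨU : ∀ w ∈ halfDisc ρ, HasDerivAt Ψ (φ w) w := by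
    intro w hw
    refine ((hΦ w (halfDisc_mono (by linarith) hw)).sub_const c).congr_of_eventuallyEq ?_
    filter_upwards [(isOpen_halfDisc ρ).mem_nhds hw] with u hu
    simp only [hΨ, if_pos hu.1.le, hEΦ u hu]
  have hΨd : DifferentiableOn ℂ Ψ (Metric.ball 0 ρ) := by
    refine differentiableOn_ball_of_continuousOn_of_im_ne_zero hΨc fun w hw hw0 => ?_
    rcases lt_or_gt_of_ne hw0 with h | h
    · have hw' : conj w ∈ halfDisc ρ := ⟨by simpa using h, by simpa using hw⟩
      have hd := (hΨU _ hw').differentiableAt.conj_conj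
      rw [conj_conj] at hd
      refine hd.congr_of_eventuallyEq ?_
      filter_upwards [(isOpen_lt continuous_im continuous_const).mem_nhds h] with u hu
      have h1 : ¬ 0 ≤ u.im := not_le.2 hu
      have h2 : 0 ≤ (conj u).im := by simpa using hu.le
      simp only [hΨ, if_neg h1, Function.comp, if_pos h2]
    · exact (hΨU w ⟨h, by simpa using hw⟩).differentiableAt
  have hdd := hΨd.deriv Metric.isOpen_ball
  refine ⟨ρ, hρ0, hρr, deriv Ψ, hdd, fun w hw => (hΨU w hw).deriv, fun x hx => ?_⟩
  have hxb : (x : ℂ) ∈ Metric.ball (0 : ℂ) ρ := by simpa using hx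
  have hcont : Tendsto (fun w => (deriv Ψ w).im) (𝓝[U] (x : ℂ)) (𝓝 (deriv Ψ x).im) :=
    (continuous_im.continuousAt.comp
      (hdd.continuousOn.continuousAt (Metric.isOpen_ball.mem_nhds hxb))).tendsto.mono_left
      nhdsWithin_le_nhds
  have := nhdsWithin_upper_neBot (w := (x : ℂ)) (by simp)
  refine tendsto_nhds_unique hcont ((hIm x (hx.trans_le hρr)).congr' ?_)
  filter_upwards [halfDisc_mem_nhdsWithin (r := ρ) (w := (x : ℂ)) (by simpa using hx)] with w hw
  rw [(hΨU w hw).deriv]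

end Reflection

/-! ### Maximum principle with two exceptional boundary points -/

section MaximumPrinciple

open InnerProductSpace

/-- A function `u + δ |z|²` with `u` harmonic and `δ > 0` has no interior maximum. -/
theorem not_isMaxOn_harmonic_add_sq {Ω : Set ℂ} (hΩ : IsOpen Ω) {u : ℂ → ℝ}
    (hu : HarmonicOnNhd u Ω) {δ : ℝ} (hδ : 0 < δ) {z₁ : ℂ} (hz₁ : z₁ ∈ Ω) :
    ¬ ∀ z ∈ Ω, u z + δ * ‖z‖ ^ 2 ≤ u z₁ + δ * ‖z₁‖ ^ 2 := by
  intro hmax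
  obtain ⟨r, hr, hball⟩ := Metric.nhds_basis_closedBall.mem_iff.1 (hΩ.mem_nhds hz₁)
  -- On the circle of radius r around z₁, ‖z‖² = ‖z₁‖² + r² + l z with l harmonic and l z₁ = 0. The
  -- mean value property of u + δ l then contradicts maximality by δ r².
  set l : ℂ → ℝ := fun z => (2 * conj z₁ * (z - z₁)).re with hl
  have hlh : HarmonicOnNhd l Ω := by
    intro z _
    have : AnalyticAt ℂ (fun z : ℂ => 2 * conj z₁ * (z - z₁)) z := by fun_prop
    exact this.harmonicAt_re
  have hv : HarmonicOnNhd (u + δ • l) Ω := hu.add (hlh.const_smul (c := δ))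
  have havg := (hv.mono (by rwa [abs_of_pos hr]) : HarmonicOnNhd (u + δ • l)
    (Metric.closedBall z₁ |r|)).circleAverage_eq
  have hci : CircleIntegrable (u + δ • l) z₁ r := by
    refine ContinuousOn.circleIntegrable hr.le ?_
    exact fun z hz => ((hv z (hball (Metric.sphere_subset_closedBall hz))).1.continuousAt).continuousWithinAt
  have hle := Real.circleAverage_mono_on_of_le_circle (a := u z₁ - δ * r ^ 2) hci (by
    rw [abs_of_pos hr]
    intro z hz
    have hzΩ := hball (Metric.sphere_subset_closedBall hz)
    have h1 := hmax z hzΩ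
    have h2 : ‖z‖ ^ 2 = ‖z₁‖ ^ 2 + r ^ 2 + l z := by
      have h3 : ‖z - z₁‖ = r := by simpa [dist_eq_norm] using hz
      rw [← h3, ← normSq_eq_norm_sq, ← normSq_eq_norm_sq, ← normSq_eq_norm_sq]
      simp only [hl, normSq_apply, mul_re, sub_re, sub_im, conj_re, conj_im, mul_im, re_ofNat,
        im_ofNat]
      ring
    rw [h2] at h1
    simp only [Pi.add_apply, Pi.smul_apply, smul_eq_mul]
    linarith)
  rw [havg] at hle
  simp only [Pi.add_apply, Pi.smul_apply, smul_eq_mul, hl, sub_self, mul_zero, zero_re] at hle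
  nlinarith [mul_pos hδ (pow_pos hr 2)]

/-- A bounded harmonic function whose boundary values vanish except at two points is
nonpositive. -/
theorem harmonic_nonpos_of_tendsto_zero {Ω : Set ℂ} (hΩ : IsOpen Ω)
    (hb : Bornology.IsBounded Ω) {u : ℂ → ℝ} (hu : HarmonicOnNhd u Ω) {C : ℝ}
    (hC : ∀ z ∈ Ω, |u z| ≤ C) {A B : ℂ} (hA : A ∉ Ω) (hB : B ∉ Ω)
    (h0 : ∀ ζ ∈ frontier Ω, ζ ≠ A → ζ ≠ B → Tendsto u (𝓝[Ω] ζ) (𝓝 0)) :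
    ∀ z ∈ Ω, u z ≤ 0 := by
  intro z₀ hz₀
  by_contra hpos
  push Not at hpos
  obtain ⟨R, hR0, hR⟩ := hb.exists_pos_norm_le
  set M := R + ‖A‖ + ‖B‖ + 1 with hM
  have hM0 : 0 < M := by positivity
  have hlogle : ∀ Q : ℂ, ‖Q‖ ≤ ‖A‖ + ‖B‖ → ∀ z ∈ Ω, z ≠ Q → Real.log ‖z - Q‖ ≤ Real.log M := by
    intro Q hQ z hz hne
    refine Real.log_le_log (norm_pos_iff.2 (sub_ne_zero.2 hne)) ?_
    have := norm_sub_le z Q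
    linarith [hR z hz]
  have hneA : ∀ z ∈ Ω, z ≠ A := fun z hz h => hA (h ▸ hz)
  have hneB : ∀ z ∈ Ω, z ≠ B := fun z hz h => hB (h ▸ hz)
  have hlA := fun z hz => hlogle A (by linarith [norm_nonneg B]) z hz (hneA z hz)
  have hlB := fun z hz => hlogle B (by linarith [norm_nonneg A]) z hz (hneB z hz)
  -- A nonpositive harmonic function tending to -∞ at A and B: a small multiple of it beats the
  -- bound C near the exceptional points.
  set q : ℂ → ℝ := fun z => Real.log ‖z - A‖ + Real.log ‖z - B‖ - 2 * Real.log M with hq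
  have hq0 : ∀ z ∈ Ω, q z ≤ 0 := fun z hz => by
    have := hlA z hz; have := hlB z hz; simp only [hq]; linarith
  have hlogh : ∀ Q : ℂ, Q ∉ Ω → HarmonicOnNhd (fun z => Real.log ‖z - Q‖) Ω := by
    intro Q hQ z hz
    have h1 : AnalyticAt ℂ (fun z : ℂ => z - Q) z := by fun_prop
    exact h1.harmonicAt_log_norm (sub_ne_zero.2 fun h => hQ (h ▸ hz))
  have hqh : HarmonicOnNhd q Ω := by
    have h1 := ((hlogh A hA).add (hlogh B hB)).sub
      (harmonicOnNhd_const (s := Ω) (2 * Real.log M))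
    exact h1
  -- choose small perturbation parameters
  obtain ⟨ε, hε, hεz⟩ : ∃ ε > 0, 0 < u z₀ + ε * q z₀ := by
    have h1 : 0 < 1 - q z₀ := by linarith [hq0 z₀ hz₀]
    refine ⟨u z₀ / (2 * (1 - q z₀)), by positivity, ?_⟩
    have h2 : u z₀ / (2 * (1 - q z₀)) * (2 * (1 - q z₀)) = u z₀ := div_mul_cancel₀ _ (by positivity)
    nlinarith [div_pos hpos (mul_pos two_pos h1)]
  obtain ⟨δ, hδ, hδz⟩ : ∃ δ > 0, δ * R ^ 2 < u z₀ + ε * q z₀ := by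
    refine ⟨(u z₀ + ε * q z₀) / (2 * R ^ 2), by positivity, ?_⟩
    have h2 : (u z₀ + ε * q z₀) / (2 * R ^ 2) * R ^ 2 = (u z₀ + ε * q z₀) / 2 := by field_simp
    rw [h2]; linarith
  set U : ℂ → ℝ := u + ε • q with hU
  have hUh : HarmonicOnNhd U Ω := hu.add (hqh.const_smul (c := ε))
  set v : ℂ → ℝ := fun z => U z + δ * ‖z‖ ^ 2 with hv
  have hUc : ContinuousOn U Ω := fun z hz => (hUh z hz).1.continuousAt.continuousWithinAt
  have hvc : ContinuousOn v Ω := hUc.add (by fun_prop)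
  have hUz : ∀ z, U z = u z + ε * q z := fun z => by simp [hU]
  have hsmall : ∀ ζ ∈ frontier Ω, ∀ᶠ z in 𝓝[Ω] ζ, v z < v z₀ := by
    intro ζ hζ
    have hv0 : U z₀ ≤ v z₀ := by
      simp only [hv]; have : 0 ≤ δ * ‖z₀‖ ^ 2 := by positivity
      linarith
    have hlt : δ * R ^ 2 < v z₀ := by rw [hUz] at hv0; linarith
    have hbound : ∀ z ∈ Ω, v z ≤ U z + δ * R ^ 2 := by
      intro z hz
      simp only [hv]
      have := hR z hz
      gcongr
    have hpole : ∀ Q : ℂ, (∀ z ∈ Ω, q z ≤ Real.log ‖z - Q‖ - Real.log M) → Q ∉ Ω →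
        ∀ᶠ z in 𝓝[Ω] Q, v z < v z₀ := by
      intro Q hQ hQΩ
      have ht : Tendsto (fun z : ℂ => ‖z - Q‖) (𝓝[Ω] Q) (𝓝[>] 0) := by
        refine tendsto_nhdsWithin_iff.2 ⟨?_, ?_⟩
        · have : Continuous (fun z : ℂ => ‖z - Q‖) := by fun_prop
          simpa using (this.tendsto Q).mono_left nhdsWithin_le_nhds
        · filter_upwards [self_mem_nhdsWithin] with z hz
          exact norm_pos_iff.2 (sub_ne_zero.2 fun h => hQΩ (h ▸ hz))
      have ht2 := Real.tendsto_log_nhdsGT_zero.comp ht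
      filter_upwards [ht2.eventually (eventually_lt_atBot (Real.log M - C / ε)),
        self_mem_nhdsWithin] with z h1 hz
      have h2 := hbound z hz
      have h3 := hQ z hz
      have h4 := (abs_le.1 (hC z hz)).2
      simp only [Function.comp] at h1
      have h5 : q z < - (C / ε) := by linarith
      have h6 : ε * q z < - C := by
        have := mul_lt_mul_of_pos_left h5 hε
        have h7 : ε * -(C / ε) = -C := by field_simp
        linarith
      rw [hUz] at h2
      linarith
    by_cases hζA : ζ = A
    · subst hζA
      exact hpole ζ (fun z hz => by have := hlB z hz; simp only [hq]; linarith) hA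
    by_cases hζB : ζ = B
    · subst hζB
      exact hpole ζ (fun z hz => by have := hlA z hz; simp only [hq]; linarith) hB
    filter_upwards [(h0 ζ hζ hζA hζB).eventually (gt_mem_nhds (sub_pos.2 hlt)),
      self_mem_nhdsWithin] with z h1 hz
    have h2 := hbound z hz
    have h3 : ε * q z ≤ 0 := mul_nonpos_of_nonneg_of_nonpos hε.le (hq0 z hz)
    rw [hUz] at h2
    linarith
  -- Near every frontier point v < v z₀, so this superlevel set stays away from the frontier, is
  -- compact, and v attains an interior maximum.
  set K : Set ℂ := {z ∈ Ω | v z₀ ≤ v z} with hK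
  have hKcl : IsClosed K := by
    refine isClosed_of_closure_subset fun ζ hζ => ?_
    have hζΩ : ζ ∈ closure Ω := closure_mono (fun z hz => hz.1) hζ
    have hfreq := mem_closure_iff_frequently.1 hζ
    by_cases hζo : ζ ∈ Ω
    · refine ⟨hζo, ?_⟩
      by_contra hlt
      push Not at hlt
      have h1 := (hvc.continuousAt (hΩ.mem_nhds hζo)).eventually (gt_mem_nhds hlt)
      obtain ⟨z, hz, hz'⟩ := (hfreq.and_eventually h1).exists
      exact absurd hz' (not_lt.2 hz.2)
    · exfalso
      have hfr : ζ ∈ frontier Ω := by rw [hΩ.frontier_eq]; exact ⟨hζΩ, hζo⟩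
      have h1 := eventually_nhdsWithin_iff.1 (hsmall ζ hfr)
      obtain ⟨z, hz, hz'⟩ := (hfreq.and_eventually h1).exists
      exact absurd (hz' hz.1) (not_lt.2 hz.2)
  have hKc : IsCompact K := Metric.isCompact_of_isClosed_isBounded hKcl (hb.subset fun z hz => hz.1)
  obtain ⟨z₁, hz₁, hmax⟩ := hKc.exists_isMaxOn ⟨z₀, hz₀, le_rfl⟩ (hvc.mono fun z hz => hz.1)
  refine not_isMaxOn_harmonic_add_sq hΩ hUh hδ hz₁.1 fun z hz => ?_
  by_cases h : v z₀ ≤ v z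
  · exact hmax ⟨hz, h⟩
  · exact (not_le.1 h).le.trans hz₁.2

/-- A bounded harmonic function whose boundary values vanish except at two points is zero. -/
theorem harmonic_eq_zero_of_tendsto_zero {Ω : Set ℂ} (hΩ : IsOpen Ω)
    (hb : Bornology.IsBounded Ω) {u : ℂ → ℝ} (hu : HarmonicOnNhd u Ω) {C : ℝ}
    (hC : ∀ z ∈ Ω, |u z| ≤ C) {A B : ℂ} (hA : A ∉ Ω) (hB : B ∉ Ω)
    (h0 : ∀ ζ ∈ frontier Ω, ζ ≠ A → ζ ≠ B → Tendsto u (𝓝[Ω] ζ) (𝓝 0)) :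
    ∀ z ∈ Ω, u z = 0 := by
  intro z hz
  refine le_antisymm (harmonic_nonpos_of_tendsto_zero hΩ hb hu hC hA hB h0 z hz) ?_
  have := harmonic_nonpos_of_tendsto_zero hΩ hb (u := -u) hu.neg (C := C)
    (fun z hz => by simpa using hC z hz) hA hB
    (fun ζ hζ h1 h2 => by
      have h := (h0 ζ hζ h1 h2).neg
      rw [neg_zero] at h
      exact h) z hz
  simpa using this

end MaximumPrinciple

/-! ### The boundary curve and its local shape -/

section Boundary

variable {N : ℕ} [NeZero N] (p : ZMod N → ℂ)

/-- The right end point is included because side `k` ends where side `k + 1` begins; this gives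
continuity at the corners. -/
theorem bdry_eq_of_mem_Icc {k : ℤ} {s : ℝ} (hs : s ∈ Icc (k : ℝ) (k + 1)) :
    bdry p s = p (k : ZMod N) + ((s - k : ℝ) : ℂ) * edge p (k : ZMod N) := by
  rcases hs.2.eq_or_lt with h | h
  · subst h
    have hf : ⌊(k : ℝ) + 1⌋ = k + 1 := by
      rw [Int.floor_add_one, Int.floor_intCast]
    have hr : Int.fract ((k : ℝ) + 1) = 0 := by simp
    rw [bdry, hf, hr]
    simp [edge]
  · have hf : ⌊s⌋ = k := Int.floor_eq_iff.2 ⟨hs.1, h⟩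
    rw [bdry, Int.fract, hf]

theorem bdry_intCast (k : ℤ) : bdry p k = p (k : ZMod N) := by
  rw [bdry_eq_of_mem_Icc p (k := k) ⟨le_rfl, by linarith⟩]
  simp

theorem bdry_add_int_mul (s : ℝ) (n : ℤ) : bdry p (s + n * N) = bdry p s := by
  have h : s + n * N = s + ((n * N : ℤ) : ℝ) := by push_cast; ring
  rw [h, bdry, bdry, Int.floor_add_intCast, Int.fract_add_intCast]
  push_cast
  simp

theorem bdry_add_period (s : ℝ) : bdry p (s + N) = bdry p s := by
  simpa using bdry_add_int_mul p s 1

theorem bdry_add_of_le {s σ : ℝ} (h0 : 0 ≤ σ) (h1 : s + σ ≤ ⌊s⌋ + 1) :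
    bdry p (s + σ) = bdry p s + σ * edge p (⌊s⌋ : ZMod N) := by
  have hs := Int.floor_le s
  rw [bdry_eq_of_mem_Icc p (k := ⌊s⌋) (s := s + σ) ⟨by linarith, h1⟩,
    bdry_eq_of_mem_Icc p (k := ⌊s⌋) (s := s) ⟨hs, by linarith⟩]
  push_cast
  ring

/-- The index `⌈s⌉ - 1` selects the arriving side and `⌊s⌋` the departing one; they differ exactly
when `s` is an integer. -/
theorem bdry_sub_of_le {s σ : ℝ} (h0 : 0 ≤ σ) (h1 : ⌈s⌉ - 1 ≤ s - σ) :
    bdry p (s - σ) = bdry p s - σ * edge p ((⌈s⌉ - 1 : ℤ) : ZMod N) := by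
  have hs := Int.le_ceil s
  rw [bdry_eq_of_mem_Icc p (k := ⌈s⌉ - 1) (s := s - σ) ⟨by push_cast; linarith, by push_cast; linarith⟩,
    bdry_eq_of_mem_Icc p (k := ⌈s⌉ - 1) (s := s) ⟨by push_cast; linarith, by push_cast; linarith⟩]
  push_cast
  ring

theorem continuous_bdry : Continuous (bdry p) := by
  rw [continuous_iff_continuousAt]
  intro s
  rw [continuousAt_iff_continuous_left_right]
  have hs1 := Int.floor_le s
  have hs2 := Int.lt_floor_add_one s
  have hs3 := Int.le_ceil s
  have hs4 := Int.ceil_lt_add_one s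
  constructor
  · have hc : Continuous fun u : ℝ => p ((⌈s⌉ - 1 : ℤ) : ZMod N)
        + ((u - ((⌈s⌉ - 1 : ℤ) : ℝ) : ℝ) : ℂ) * edge p ((⌈s⌉ - 1 : ℤ) : ZMod N) := by fun_prop
    refine hc.continuousWithinAt.congr_of_eventuallyEq ?_
      (bdry_eq_of_mem_Icc p ⟨by push_cast; linarith, by push_cast; linarith⟩)
    filter_upwards [self_mem_nhdsWithin, nhdsWithin_le_nhds
      (Ioi_mem_nhds (show ((⌈s⌉ - 1 : ℤ) : ℝ) < s by push_cast; linarith))] with u h1 h2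
    refine bdry_eq_of_mem_Icc p ⟨le_of_lt h2, ?_⟩
    have : u ≤ s := h1
    push_cast; linarith
  · have hc : Continuous fun u : ℝ => p (⌊s⌋ : ZMod N)
        + ((u - (⌊s⌋ : ℝ) : ℝ) : ℂ) * edge p (⌊s⌋ : ZMod N) := by fun_prop
    refine hc.continuousWithinAt.congr_of_eventuallyEq ?_
      (bdry_eq_of_mem_Icc p ⟨hs1, hs2.le⟩)
    filter_upwards [self_mem_nhdsWithin, nhdsWithin_le_nhds (Iio_mem_nhds hs2)] with u h1 h2
    have : s ≤ u := h1
    exact bdry_eq_of_mem_Icc p ⟨by linarith, le_of_lt h2⟩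

variable {p} {Ω : Set ℂ}

theorem exists_bdry_mem_Ico (s c : ℝ) : ∃ n : ℤ, s + n * N ∈ Ico c (c + N) := by
  have hN : (0 : ℝ) < N := Nat.cast_pos.2 (NeZero.pos N)
  refine ⟨-toIcoDiv hN c s, ?_⟩
  have h := sub_toIcoDiv_zsmul_mem_Ico hN c s
  rw [zsmul_eq_mul] at h
  push_cast
  convert h using 1
  ring

theorem bdry_eq_bdry_iff (hΩ : IsPolygon p Ω) {s t : ℝ} :
    bdry p s = bdry p t ↔ ∃ n : ℤ, t = s + n * N := by
  constructor
  · intro h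
    obtain ⟨n, hn⟩ := exists_bdry_mem_Ico (N := N) s 0
    obtain ⟨m, hm⟩ := exists_bdry_mem_Ico (N := N) t 0
    rw [zero_add] at hn hm
    have := hΩ.simple hn hm (by rw [bdry_add_int_mul, bdry_add_int_mul, h])
    refine ⟨n - m, ?_⟩
    push_cast
    linarith
  · rintro ⟨n, rfl⟩
    rw [bdry_add_int_mul]

theorem bdry_injOn_Ico (hΩ : IsPolygon p Ω) (c : ℝ) : InjOn (bdry p) (Ico c (c + N)) := by
  intro s hs t ht h
  obtain ⟨n, hn⟩ := (bdry_eq_bdry_iff hΩ).1 h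
  have hN : (0 : ℝ) < N := Nat.cast_pos.2 (NeZero.pos N)
  have h1 : (n : ℝ) < 1 := by
    by_contra hc
    push Not at hc
    nlinarith [hs.1, ht.2]
  have h2 : (-1 : ℝ) < n := by
    by_contra hc
    push Not at hc
    nlinarith [hs.2, ht.1]
  have h3 : n = 0 := by
    have : n < 1 := by exact_mod_cast h1
    have : -1 < n := by exact_mod_cast h2
    omega
  rw [hn, h3]
  simp

theorem edge_ne_zero (hΩ : IsPolygon p Ω) (k : ZMod N) : edge p k ≠ 0 := by
  intro h
  have := hΩ.corners k
  simp [ConvexCorner, ConcaveCorner, h] at this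

theorem bdry_not_mem (hΩ : IsPolygon p Ω) (s : ℝ) : bdry p s ∉ Ω := by
  have h : bdry p s ∈ frontier Ω := hΩ.frontier_eq ▸ mem_range_self s
  rw [hΩ.isOpen.frontier_eq] at h
  exact h.2

/-- Near each of its points the boundary consists of two segments. -/
theorem exists_mem_range_bdry_iff (hΩ : IsPolygon p Ω) (s : ℝ) :
    ∃ r > 0, ∀ z, ‖z - bdry p s‖ < r → (z ∈ range (bdry p) ↔
      (∃ σ : ℝ, 0 ≤ σ ∧ z = bdry p s + σ * edge p (⌊s⌋ : ZMod N)) ∨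
      (∃ σ : ℝ, 0 ≤ σ ∧ z = bdry p s - σ * edge p ((⌈s⌉ - 1 : ℤ) : ZMod N))) := by
  have hN : (0 : ℝ) < N := Nat.cast_pos.2 (NeZero.pos N)
  set k := edge p (⌊s⌋ : ZMod N) with hk
  set k' := edge p ((⌈s⌉ - 1 : ℤ) : ZMod N) with hk'
  have hk0 : 0 < ‖k‖ := norm_pos_iff.2 (edge_ne_zero hΩ _)
  have hk'0 : 0 < ‖k'‖ := norm_pos_iff.2 (edge_ne_zero hΩ _)
  -- Within parameter distance δ the curve meets no further corner. The rest of the period is a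
  -- compact curve missing the point, by simplicity, hence at positive distance from it.
  set δ := min ((⌊s⌋ : ℝ) + 1 - s) (s - (⌈s⌉ - 1)) with hδ
  have hδ0 : 0 < δ := lt_min (by linarith [Int.lt_floor_add_one s]) (by linarith [Int.ceil_lt_add_one s])
  have hδ1 : δ ≤ (⌊s⌋ : ℝ) + 1 - s := min_le_left _ _
  have hδ2 : δ ≤ s - (⌈s⌉ - 1) := min_le_right _ _
  set K := bdry p '' Icc (s + δ) (s + N - δ) with hK
  have hKc : IsCompact K := isCompact_Icc.image (continuous_bdry p)
  have hsK : bdry p s ∈ Kᶜ := by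
    rintro ⟨t, ht, hts⟩
    obtain ⟨n, hn⟩ := (bdry_eq_bdry_iff hΩ).1 hts
    have h1 : (n : ℝ) < 0 := by
      by_contra hc
      push Not at hc
      nlinarith [ht.1]
    have h2 : (-1 : ℝ) < n := by
      by_contra hc
      push Not at hc
      nlinarith [ht.2]
    have : n < 0 := by exact_mod_cast h1
    have : -1 < n := by exact_mod_cast h2
    omega
  obtain ⟨r₁, hr₁, hball⟩ := Metric.isOpen_iff.1 hKc.isClosed.isOpen_compl _ hsK
  refine ⟨min r₁ (min (δ * ‖k‖) (δ * ‖k'‖)), by positivity, fun z hz => ?_⟩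
  have hz1 : ‖z - bdry p s‖ < r₁ := hz.trans_le (min_le_left _ _)
  have hz2 : ‖z - bdry p s‖ < δ * ‖k‖ := hz.trans_le ((min_le_right _ _).trans (min_le_left _ _))
  have hz3 : ‖z - bdry p s‖ < δ * ‖k'‖ := hz.trans_le ((min_le_right _ _).trans (min_le_right _ _))
  constructor
  · rintro ⟨t, rfl⟩
    obtain ⟨n, hn⟩ := exists_bdry_mem_Ico (N := N) t (s - δ)
    rw [← bdry_add_int_mul p t n] at hz1 ⊢
    set t' := t + n * N
    rcases lt_or_ge t' (s + δ) with h | h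
    · rcases le_total s t' with h' | h'
      · left
        refine ⟨t' - s, by linarith, ?_⟩
        have := bdry_add_of_le p (s := s) (σ := t' - s) (by linarith) (by linarith)
        rw [← this]; congr 1; ring
      · right
        refine ⟨s - t', by linarith, ?_⟩
        have := bdry_sub_of_le p (s := s) (σ := s - t') (by linarith) (by linarith [hn.1])
        rw [← this]; congr 1; ring
    · exfalso
      refine hball (by rwa [Metric.mem_ball, dist_eq_norm]) ⟨t', ⟨h, ?_⟩, rfl⟩
      linarith [hn.2]
  · rintro (⟨σ, hσ, rfl⟩ | ⟨σ, hσ, rfl⟩)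
    · rw [add_sub_cancel_left, norm_mul, norm_real, Real.norm_of_nonneg hσ] at hz2
      have := lt_of_mul_lt_mul_right hz2 hk0.le
      exact ⟨s + σ, bdry_add_of_le p hσ (by linarith)⟩
    · rw [sub_sub_cancel_left, norm_neg, norm_mul, norm_real, Real.norm_of_nonneg hσ] at hz3
      have := lt_of_mul_lt_mul_right hz3 hk'0.le
      exact ⟨s - σ, bdry_sub_of_le p hσ (by linarith)⟩

/-- `α π` is the interior angle of the polygon at the boundary point `bdry p s`. -/
def InteriorAngle (p : ZMod N → ℂ) (s α : ℝ) : Prop :=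
  (α = 1 ∧ ∀ k : ℤ, s ≠ k) ∨ (α = 1 / 2 ∧ ∃ k : ℤ, s = k ∧ ConvexCorner p k) ∨
    (α = 3 / 2 ∧ ∃ k : ℤ, s = k ∧ ConcaveCorner p k)

theorem InteriorAngle.half_le {s α : ℝ} (h : InteriorAngle p s α) : 1 / 2 ≤ α := by
  rcases h with ⟨rfl, -⟩ | ⟨rfl, -⟩ | ⟨rfl, -⟩ <;> norm_num

theorem InteriorAngle.le_three_halves {s α : ℝ} (h : InteriorAngle p s α) : α ≤ 3 / 2 := by
  rcases h with ⟨rfl, -⟩ | ⟨rfl, -⟩ | ⟨rfl, -⟩ <;> norm_num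

theorem lam_mul_conj_lam : lam * conj lam = 1 := by
  rw [mul_conj, normSq_eq_norm_sq, lam, norm_exp_ofReal_mul_I]
  simp

theorem lam_mul_lam : lam * lam = I := by
  rw [lam, ← Complex.exp_add, ← add_mul]
  have : ((π / 4 : ℝ) : ℂ) + ((π / 4 : ℝ) : ℂ) = (π : ℂ) / 2 := by push_cast; ring
  rw [this, Complex.exp_pi_div_two_mul_I]

theorem conj_lam_mul_conj_lam : conj lam * conj lam = -I := by
  rw [← map_mul, lam_mul_lam, conj_I]

theorem conj_lam_eq : conj lam = -I * lam := by
  linear_combination lam * conj_lam_mul_conj_lam - conj lam * lam_mul_conj_lam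

theorem lam_eq : lam = I * conj lam := by
  linear_combination conj lam * lam_mul_lam - lam * lam_mul_conj_lam

/-- Consecutive sides are perpendicular. -/
theorem edge_succ_eq (hΩ : IsPolygon p Ω) (k : ZMod N) :
    ∃ c : ℝ, edge p k = c * (I * edge p (k - 1)) ∧ (0 < c ↔ ConvexCorner p k) ∧
      (c < 0 ↔ ConcaveCorner p k) := by
  have key : ∃ c : ℝ, edge p k = c * (I * edge p (k - 1)) := by
    obtain ⟨a, ha⟩ := hΩ.sides (k - 1)
    obtain ⟨b, hb⟩ := hΩ.sides k
    have hne := edge_ne_zero hΩ (k - 1)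
    have ha0 : (a : ℂ) ≠ 0 := by
      rintro h
      rcases ha with ha | ha <;> rw [h, zero_mul] at ha <;> exact hne ha
    have hc := hΩ.corners k
    simp only [ConvexCorner, ConcaveCorner] at hc
    -- Parallel consecutive sides would have zero cross product, so the vertex would be no corner.
    have hpar : ∀ l : ℂ, edge p (k - 1) = a * l → edge p k = b * l → False := by
      intro l h1 h2
      have : conj (edge p (k - 1)) * edge p k = ((a * b * normSq l : ℝ) : ℂ) := by
        rw [h1, h2, map_mul, conj_ofReal]
        push_cast
        rw [normSq_eq_conj_mul_self]
        ring
      rw [this, ofReal_im] at hc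
      simp at hc
    rcases ha with ha | ha <;> rcases hb with hb | hb
    · exact (hpar _ ha hb).elim
    · refine ⟨-b / a, ?_⟩
      rw [ha, hb]
      push_cast
      field_simp
      linear_combination (b : ℂ) * conj_lam_eq
    · refine ⟨b / a, ?_⟩
      rw [ha, hb]
      push_cast
      field_simp
      linear_combination (b : ℂ) * lam_eq
    · exact (hpar _ ha hb).elim
  obtain ⟨c, hc⟩ := key
  have hne : 0 < normSq (edge p (k - 1)) := normSq_pos.2 (edge_ne_zero hΩ (k - 1))
  have him : (conj (edge p (k - 1)) * edge p k).im = c * normSq (edge p (k - 1)) := by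
    have : conj (edge p (k - 1)) * edge p k = ((c * normSq (edge p (k - 1)) : ℝ) : ℂ) * I := by
      rw [hc]
      push_cast
      rw [normSq_eq_conj_mul_self]
      ring
    rw [this]
    simp
  refine ⟨c, hc, ?_, ?_⟩
  · rw [ConvexCorner, him, mul_pos_iff_of_pos_right hne]
  · rw [ConcaveCorner, him, mul_neg_iff]
    constructor
    · exact fun h => Or.inr ⟨h, hne⟩
    · rintro (⟨-, h⟩ | ⟨h, -⟩)
      · exact absurd h (not_lt.2 hne.le)
      · exact h

theorem floor_eq_ceil_sub_one {s : ℝ} (hs : ∀ k : ℤ, s ≠ k) : ⌈s⌉ - 1 = ⌊s⌋ := by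
  have h1 := Int.floor_le s
  have h2 := Int.lt_floor_add_one s
  have : ⌈s⌉ = ⌊s⌋ + 1 := by
    rw [Int.ceil_eq_iff]
    push_cast
    refine ⟨?_, h2.le⟩
    rw [add_sub_cancel_right]
    exact lt_of_le_of_ne h1 (hs _).symm
  omega

/-- The direction of the boundary arriving at `bdry p s`, in terms of the interior angle. -/
theorem exists_interiorAngle (hΩ : IsPolygon p Ω) (s : ℝ) :
    ∃ α t : ℝ, InteriorAngle p s α ∧ 0 < t ∧
      -edge p ((⌈s⌉ - 1 : ℤ) : ZMod N) = t * Complex.exp ((α * π : ℝ) * I) * edge p (⌊s⌋ : ZMod N) := by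
  by_cases hs : ∀ k : ℤ, s ≠ k
  · refine ⟨1, 1, Or.inl ⟨rfl, hs⟩, one_pos, ?_⟩
    rw [floor_eq_ceil_sub_one hs, one_mul, Complex.exp_pi_mul_I]
    simp
  · push Not at hs
    obtain ⟨k, rfl⟩ := hs
    obtain ⟨c, hc, h1, h2⟩ := edge_succ_eq hΩ (k : ZMod N)
    rw [Int.ceil_intCast, Int.floor_intCast]
    push_cast
    have hc0 : (c : ℂ) ≠ 0 := by
      rintro h
      rw [h, zero_mul] at hc
      exact edge_ne_zero hΩ _ hc
    rcases hΩ.corners (k : ZMod N) with h | h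
    · refine ⟨1 / 2, 1 / c, Or.inr (Or.inl ⟨rfl, k, rfl, h⟩), one_div_pos.2 (h1.2 h), ?_⟩
      have e : ((1 / 2 : ℝ) : ℂ) * (π : ℂ) * I = π / 2 * I := by push_cast; ring
      rw [e, Complex.exp_pi_div_two_mul_I, hc]
      push_cast
      field_simp
      linear_combination (-edge p ((k : ZMod N) - 1)) * I_sq
    · have hc' := h2.2 h
      refine ⟨3 / 2, -1 / c, Or.inr (Or.inr ⟨rfl, k, rfl, h⟩),
        div_pos_of_neg_of_neg (by norm_num) hc', ?_⟩
      have e : ((3 / 2 : ℝ) : ℂ) * (π : ℂ) * I = π / 2 * I + π * I := by push_cast; ring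
      rw [e, Complex.exp_add, Complex.exp_pi_div_two_mul_I, Complex.exp_pi_mul_I, hc]
      push_cast
      field_simp
      linear_combination (-edge p ((k : ZMod N) - 1)) * I_sq

end Boundary

/-! ### Near a boundary point the domain is one circular sector -/

section Sector

/-- Polar coordinates with origin `ζ` and polar axis `κ`. -/
noncomputable def polarPoint (ζ κ : ℂ) (x : ℝ × ℝ) : ℂ :=
  ζ + x.1 * Complex.exp (x.2 * I) * κ

theorem continuous_polarPoint (ζ κ : ℂ) : Continuous (polarPoint ζ κ) := by
  unfold polarPoint
  fun_prop

/-- The open circular sector with radius `R * ‖κ‖` and angles in `(a, b)`. -/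
def sector (ζ κ : ℂ) (R a b : ℝ) : Set ℂ := polarPoint ζ κ '' (Ioo 0 R ×ˢ Ioo a b)

theorem isPreconnected_sector (ζ κ : ℂ) (R a b : ℝ) : IsPreconnected (sector ζ κ R a b) :=
  (isPreconnected_Ioo.prod isPreconnected_Ioo).image _ (continuous_polarPoint ζ κ).continuousOn

theorem polarPoint_mem_closure_sector {ζ κ : ℂ} {R a b ρ θ : ℝ} (hρ : ρ ∈ Ico 0 R)
    (hθ : θ ∈ Icc a b) (hab : a < b) : polarPoint ζ κ (ρ, θ) ∈ closure (sector ζ κ R a b) := by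
  refine image_closure_subset_closure_image (continuous_polarPoint ζ κ) (mem_image_of_mem _ ?_)
  rw [closure_prod_eq, closure_Ioo (hρ.1.trans_lt hρ.2).ne, closure_Ioo hab.ne]
  exact ⟨⟨hρ.1, hρ.2.le⟩, hθ⟩

theorem norm_polarPoint_sub {ζ κ : ℂ} {ρ θ : ℝ} (hρ : 0 ≤ ρ) :
    ‖polarPoint ζ κ (ρ, θ) - ζ‖ = ρ * ‖κ‖ := by
  simp only [polarPoint, add_sub_cancel_left, norm_mul, norm_real, norm_exp_ofReal_mul_I,
    Real.norm_of_nonneg hρ, mul_one]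

theorem exists_polar_Ico (u : ℂ) : ∃ θ ∈ Ico 0 (2 * π), u = ‖u‖ * Complex.exp (θ * I) := by
  have h := norm_mul_exp_arg_mul_I u
  rcases le_or_gt 0 u.arg with h0 | h0
  · exact ⟨u.arg, ⟨h0, by linarith [arg_le_pi u, Real.pi_pos]⟩, h.symm⟩
  · refine ⟨u.arg + 2 * π, ⟨by linarith [neg_pi_lt_arg u], by linarith⟩, ?_⟩
    push_cast
    rw [add_mul, Complex.exp_add, Complex.exp_two_pi_mul_I, mul_one, h]

theorem exists_polarPoint_eq {ζ κ : ℂ} (hκ : κ ≠ 0) (z : ℂ) :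
    ∃ ρ θ : ℝ, 0 ≤ ρ ∧ ‖z - ζ‖ = ρ * ‖κ‖ ∧ θ ∈ Ico 0 (2 * π) ∧ z = polarPoint ζ κ (ρ, θ) := by
  obtain ⟨θ, hθ, h⟩ := exists_polar_Ico ((z - ζ) / κ)
  have hκ' : ‖κ‖ ≠ 0 := norm_ne_zero_iff.2 hκ
  refine ⟨‖(z - ζ) / κ‖, θ, norm_nonneg _, by rw [norm_div, div_mul_cancel₀ _ hκ'], hθ, ?_⟩
  rw [polarPoint]
  dsimp only
  rw [← h, div_mul_cancel₀ _ hκ]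
  ring

theorem polar_inj {ρ σ θ θ' : ℝ} (hρ : 0 < ρ) (hσ : 0 ≤ σ)
    (h : (ρ : ℂ) * Complex.exp (θ * I) = σ * Complex.exp (θ' * I)) (hθ : |θ - θ'| < 2 * π) :
    θ = θ' := by
  have hn := congrArg norm h
  simp only [norm_mul, norm_real, norm_exp_ofReal_mul_I, mul_one, Real.norm_of_nonneg hρ.le,
    Real.norm_of_nonneg hσ] at hn
  subst hn
  have hρ' : (ρ : ℂ) ≠ 0 := ofReal_ne_zero.2 hρ.ne'
  obtain ⟨n, hn⟩ := Complex.exp_eq_exp_iff_exists_int.1 (mul_left_cancel₀ hρ' h)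
  have h2 : ((θ - θ' : ℝ) : ℂ) * I = ((n * (2 * π) : ℝ) : ℂ) * I := by
    push_cast
    linear_combination hn
  have h3 : θ - θ' = n * (2 * π) := ofReal_injective (mul_right_cancel₀ I_ne_zero h2)
  have hp := Real.two_pi_pos
  rw [h3, abs_mul, abs_of_pos hp] at hθ
  have h4 : |(n : ℝ)| < 1 := by
    by_contra hc
    push Not at hc
    nlinarith
  have h5 : n = 0 := by
    have : |n| < 1 := by exact_mod_cast h4
    exact Int.abs_lt_one_iff.1 this
  rw [h5] at h3
  simp at h3
  linarith

variable {N : ℕ} [NeZero N] {p : ZMod N → ℂ} {Ω : Set ℂ}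

/-- Near the point `bdry p s`, the complement of the boundary consists of two sectors. -/
theorem exists_two_sectors (hΩ : IsPolygon p Ω) (s : ℝ) : ∃ α R : ℝ, InteriorAngle p s α ∧ 0 < R ∧
    (∃ t : ℝ, 0 < t ∧ -edge p ((⌈s⌉ - 1 : ℤ) : ZMod N)
      = t * Complex.exp ((α * π : ℝ) * I) * edge p (⌊s⌋ : ZMod N)) ∧
    ∀ ρ θ : ℝ, 0 ≤ ρ → ρ < R → θ ∈ Ico 0 (2 * π) →
      (polarPoint (bdry p s) (edge p (⌊s⌋ : ZMod N)) (ρ, θ) ∈ range (bdry p) ↔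
        ρ = 0 ∨ θ = 0 ∨ θ = α * π) := by
  obtain ⟨α, t, hα, ht, hdir⟩ := exists_interiorAngle hΩ s
  obtain ⟨r, hr, hJ⟩ := exists_mem_range_bdry_iff hΩ s
  set κ := edge p (⌊s⌋ : ZMod N) with hκ
  have hκ0 : κ ≠ 0 := edge_ne_zero hΩ _
  have hκn : 0 < ‖κ‖ := norm_pos_iff.2 hκ0
  refine ⟨α, r / ‖κ‖, hα, by positivity, ⟨t, ht, hdir⟩, fun ρ θ h0 hR hθ => ?_⟩
  have hlt : ‖polarPoint (bdry p s) κ (ρ, θ) - bdry p s‖ < r := by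
    rw [norm_polarPoint_sub h0]
    exact (lt_div_iff₀ hκn).1 hR
  rw [hJ _ hlt]
  have h1 := hα.half_le
  have h2 := hα.le_three_halves
  have hπ := Real.pi_pos
  constructor
  · intro h
    rw [or_iff_not_imp_left]
    intro hρ
    have hρ0 : 0 < ρ := lt_of_le_of_ne h0 (Ne.symm hρ)
    rcases h with ⟨σ, hσ, h⟩ | ⟨σ, hσ, h⟩
    · left
      refine polar_inj hρ0 hσ (θ' := 0) ?_ (by rw [sub_zero, abs_of_nonneg hθ.1]; exact hθ.2)
      refine mul_right_cancel₀ hκ0 ?_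
      simp only [polarPoint] at h
      simp only [ofReal_zero, zero_mul, Complex.exp_zero, mul_one]
      exact add_left_cancel h
    · right
      refine polar_inj hρ0 (mul_nonneg hσ ht.le) (θ' := α * π) ?_ ?_
      · refine mul_right_cancel₀ hκ0 ?_
        simp only [polarPoint] at h
        rw [ofReal_mul σ t]
        linear_combination h + σ * hdir
      · rw [abs_lt]; constructor <;> nlinarith [hθ.1, hθ.2]
  · rintro (rfl | rfl | rfl)
    · left; exact ⟨0, le_rfl, by simp [polarPoint]⟩
    · left; exact ⟨ρ, h0, by simp [polarPoint]⟩
    · right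
      refine ⟨ρ / t, by positivity, ?_⟩
      have ht' : (t : ℂ) ≠ 0 := ofReal_ne_zero.2 ht.ne'
      simp only [polarPoint]
      rw [ofReal_div]
      have : (ρ / t : ℂ) * t = ρ := div_mul_cancel₀ _ ht'
      linear_combination (-(ρ / t) : ℂ) * hdir - Complex.exp ((α * π : ℝ) * I) * κ * this

/-- Off the frontier, the plane is the disjoint union of the open sets Ω and the complement of its
closure; a preconnected set lies in one of them. -/
theorem subset_or_disjoint_of_isPreconnected {T : Set ℂ} (hΩ : IsOpen Ω) (hT : IsPreconnected T)
    (h : Disjoint T (frontier Ω)) : T ⊆ Ω ∨ Disjoint T Ω := by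
  have hdis : Disjoint Ω (closure Ω)ᶜ :=
    disjoint_compl_right_iff_subset.2 subset_closure
  have hsub : T ⊆ Ω ∪ (closure Ω)ᶜ := by
    intro z hz
    by_cases hzc : z ∈ closure Ω
    · left
      by_contra hz'
      refine disjoint_left.1 h hz ?_
      rw [hΩ.frontier_eq]
      exact ⟨hzc, hz'⟩
    · exact Or.inr hzc
  rcases hT.subset_or_subset hΩ isClosed_closure.isOpen_compl hdis hsub with h1 | h1
  · exact Or.inl h1
  · exact Or.inr (hdis.symm.mono_left h1)

theorem disjoint_sector_range {s α R : ℝ} {a b : ℝ} (h0 : 0 ≤ a) (hb : b ≤ 2 * π)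
    (hα : α * π ∉ Ioo a b)
    (hJ : ∀ ρ θ : ℝ, 0 ≤ ρ → ρ < R → θ ∈ Ico 0 (2 * π) →
      (polarPoint (bdry p s) (edge p (⌊s⌋ : ZMod N)) (ρ, θ) ∈ range (bdry p) ↔
        ρ = 0 ∨ θ = 0 ∨ θ = α * π)) :
    Disjoint (sector (bdry p s) (edge p (⌊s⌋ : ZMod N)) R a b) (range (bdry p)) := by
  rw [disjoint_left]
  rintro _ ⟨⟨ρ, θ⟩, ⟨hρ, hθ⟩, rfl⟩ hmem
  rw [hJ ρ θ hρ.1.le hρ.2 ⟨h0.trans hθ.1.le, hθ.2.trans_le hb⟩] at hmem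
  rcases hmem with h | h | h
  · exact hρ.1.ne' h
  · exact (h0.trans_lt hθ.1).ne' h
  · rw [h] at hθ; exact hα hθ

/-- The orientation hypothesis gives a point of Ω just left of the departing side. Relative to that
side its argument lies in (0, π/2), which fits in the sector because α ≥ 1/2. -/
theorem exists_mem_sector_inter (hΩ : IsPolygon p Ω) (s : ℝ) {α R : ℝ} (hα : 1 / 2 ≤ α)
    (hR : 0 < R) :
    ∃ z ∈ sector (bdry p s) (edge p (⌊s⌋ : ZMod N)) R 0 (α * π), z ∈ Ω := by
  set k := ⌊s⌋ with hk
  have hs1 : (k : ℝ) ≤ s := Int.floor_le s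
  have hs2 : s < k + 1 := Int.lt_floor_add_one s
  set σ := min (R / 2) ((k + 1 - s) / 2) with hσ
  have hσ0 : 0 < σ := lt_min (by linarith) (by linarith)
  have hσ1 : σ ≤ R / 2 := min_le_left _ _
  have hσ2 : σ ≤ (k + 1 - s) / 2 := min_le_right _ _
  have hleft := hΩ.left (k : ZMod N) (s + σ - k) ⟨by linarith, by linarith⟩
  obtain ⟨ε, hε, hε0, hεR⟩ := (hleft.and ((eventually_mem_nhdsWithin (s := Ioi (0 : ℝ))).and
    (nhdsWithin_le_nhds (Iio_mem_nhds (show (0 : ℝ) < R / 2 by linarith))))).exists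
  have hε0' : 0 < ε := hε0
  refine ⟨_, ?_, hε⟩
  set u : ℂ := σ + ε * I with hu
  have hre : u.re = σ := by simp [hu]
  have him : u.im = ε := by simp [hu]
  refine ⟨(‖u‖, u.arg), ⟨⟨?_, ?_⟩, ?_, ?_⟩, ?_⟩
  · refine norm_pos_iff.2 fun h => ?_
    rw [h] at hre
    exact hσ0.ne hre
  · calc ‖u‖ ≤ |u.re| + |u.im| := norm_le_abs_re_add_abs_im u
      _ = σ + ε := by rw [hre, him, abs_of_pos hσ0, abs_of_pos hε0']
      _ < R := by have : ε < R / 2 := hεR; linarith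
  · refine lt_of_le_of_ne (arg_nonneg_iff.2 (him ▸ hε0'.le)) fun h => ?_
    have := (arg_eq_zero_iff.1 h.symm).2
    rw [him] at this
    exact hε0'.ne' this
  · have h := (abs_lt.1 (abs_arg_lt_pi_div_two_iff.2 (Or.inl (hre ▸ hσ0)))).2
    refine h.trans_le ?_
    nlinarith [Real.pi_pos]
  · rw [polarPoint]
    dsimp only
    rw [norm_mul_exp_arg_mul_I, bdry_eq_of_mem_Icc p (k := k) ⟨hs1, hs2.le⟩, hu]
    push_cast
    ring

/-- The polygon lies only to the left of its boundary. -/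
theorem union_range_bdry_not_mem_nhds (hΩ : IsPolygon p Ω) (s : ℝ) :
    Ω ∪ range (bdry p) ∉ 𝓝 (bdry p s) := by
  -- The parameters where Ω lies on both sides of the curve form a clopen set. By connectedness of ℝ
  -- it is empty or everything, and in the latter case the closure of Ω would be clopen in the
  -- plane, contradicting boundedness.
  set A : Set ℝ := {s | Ω ∪ range (bdry p) ∈ 𝓝 (bdry p s)} with hA
  have hAo : IsOpen A := by
    have : A = bdry p ⁻¹' (interior (Ω ∪ range (bdry p))) := by
      ext s; exact mem_interior_iff_mem_nhds.symm
    rw [this]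
    exact isOpen_interior.preimage (continuous_bdry p)
  have hAc : IsOpen Aᶜ := by
    rw [isOpen_iff_mem_nhds]
    intro s hs
    obtain ⟨α, R, hα, hR, -, hJ⟩ := exists_two_sectors hΩ s
    have hπ := Real.pi_pos
    have h1 := hα.half_le
    have h2 := hα.le_three_halves
    set κ := edge p (⌊s⌋ : ZMod N) with hκ
    have hκ0 : κ ≠ 0 := edge_ne_zero hΩ _
    have hκn : 0 < ‖κ‖ := norm_pos_iff.2 hκ0
    have hαπ : 0 < α * π := by positivity
    have hαπ2 : α * π < 2 * π := by nlinarith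
    have hball : Metric.ball (bdry p s) (R * ‖κ‖) ∈ 𝓝 (bdry p s) :=
      Metric.ball_mem_nhds _ (by positivity)
    have hL := disjoint_sector_range (p := p) le_rfl hαπ2.le (by simp) hJ
    have hRr := disjoint_sector_range (p := p) hαπ.le le_rfl (by simp) hJ
    have hLΩ : sector (bdry p s) κ R 0 (α * π) ⊆ Ω := by
      rcases subset_or_disjoint_of_isPreconnected hΩ.isOpen (isPreconnected_sector _ _ _ _ _)
        (hΩ.frontier_eq ▸ hL) with h | h
      · exact h
      · obtain ⟨z, hz, hz'⟩ := exists_mem_sector_inter hΩ s h1 hR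
        exact (disjoint_left.1 h hz hz').elim
    have hRΩ : Disjoint (sector (bdry p s) κ R (α * π) (2 * π)) Ω := by
      rcases subset_or_disjoint_of_isPreconnected hΩ.isOpen (isPreconnected_sector _ _ _ _ _)
        (hΩ.frontier_eq ▸ hRr) with h | h
      · exfalso
        refine hs (mem_of_superset hball fun z hz => ?_)
        obtain ⟨ρ, θ, h0, hn, hθ, rfl⟩ := exists_polarPoint_eq (ζ := bdry p s) hκ0 z
        rw [Metric.mem_ball, dist_eq_norm, hn] at hz
        have hρR : ρ < R := lt_of_mul_lt_mul_right hz hκn.le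
        by_cases hmem : polarPoint (bdry p s) κ (ρ, θ) ∈ range (bdry p)
        · exact Or.inr hmem
        · left
          rw [hJ ρ θ h0 hρR hθ] at hmem
          push Not at hmem
          have hρ0 := lt_of_le_of_ne h0 (Ne.symm hmem.1)
          have hθ0 := lt_of_le_of_ne hθ.1 (Ne.symm hmem.2.1)
          rcases lt_or_gt_of_ne hmem.2.2 with h3 | h3
          · exact hLΩ ⟨(ρ, θ), ⟨⟨hρ0, hρR⟩, hθ0, h3⟩, rfl⟩
          · exact h ⟨(ρ, θ), ⟨⟨hρ0, hρR⟩, h3, hθ.2⟩, rfl⟩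
      · exact h
    -- All boundary points near `bdry p s` are limits of the right sector, which is disjoint from Ω
    -- and from the curve. The departing side is reached at angle 2π instead of 0.
    filter_upwards [(continuous_bdry p).continuousAt.preimage_mem_nhds hball] with s' hs' hA'
    obtain ⟨ρ, θ, h0, hn, hθ, hz⟩ := exists_polarPoint_eq (ζ := bdry p s) hκ0 (bdry p s')
    rw [mem_preimage, Metric.mem_ball, dist_eq_norm, hn] at hs'
    have hρR : ρ < R := lt_of_mul_lt_mul_right hs' hκn.le
    have hcl : bdry p s' ∈ closure (sector (bdry p s) κ R (α * π) (2 * π)) := by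
      have hmem : polarPoint (bdry p s) κ (ρ, θ) ∈ range (bdry p) := hz ▸ mem_range_self s'
      rw [hJ ρ θ h0 hρR hθ] at hmem
      rw [hz]
      rcases hmem with h | h | h
      · have : polarPoint (bdry p s) κ (ρ, θ) = polarPoint (bdry p s) κ (ρ, 2 * π) := by
          simp [polarPoint, h]
        rw [this]
        exact polarPoint_mem_closure_sector ⟨h0, hρR⟩ ⟨hαπ2.le, le_rfl⟩ hαπ2
      · have : polarPoint (bdry p s) κ (ρ, θ) = polarPoint (bdry p s) κ (ρ, 2 * π) := by
          simp [polarPoint, h, Complex.exp_two_pi_mul_I]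
        rw [this]
        exact polarPoint_mem_closure_sector ⟨h0, hρR⟩ ⟨hαπ2.le, le_rfl⟩ hαπ2
      · exact polarPoint_mem_closure_sector ⟨h0, hρR⟩ ⟨h.ge, h ▸ hαπ2.le⟩ hαπ2
    obtain ⟨z, hz1, hz2⟩ := mem_closure_iff_nhds.1 hcl _ hA'
    rcases hz1 with h | h
    · exact disjoint_left.1 hRΩ hz2 h
    · exact disjoint_left.1 hRr hz2 h
  have hclopen : IsClopen A := ⟨⟨hAc⟩, hAo⟩
  rcases isClopen_iff.1 hclopen with h | h
  · intro hs
    have : s ∈ A := hs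
    rw [h] at this
    exact this
  · exfalso
    have hcl : closure Ω = Ω ∪ range (bdry p) := by
      rw [closure_eq_self_union_frontier, hΩ.frontier_eq]
    have ho : IsOpen (closure Ω) := by
      rw [hcl, isOpen_iff_mem_nhds]
      rintro z (hz | ⟨s', rfl⟩)
      · exact mem_of_superset (hΩ.isOpen.mem_nhds hz) subset_union_left
      · have : s' ∈ A := h ▸ mem_univ s'
        exact this
    have hc2 : IsClopen (closure Ω) := ⟨isClosed_closure, ho⟩
    have := hΩ.simplyConnected
    obtain ⟨z⟩ : Nonempty Ω := inferInstance
    rcases isClopen_iff.1 hc2 with h' | h'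
    · have : (z : ℂ) ∈ closure Ω := subset_closure z.2
      rw [h'] at this
      exact this
    · have hb := hΩ.isBounded.closure
      rw [h'] at hb
      exact NormedSpace.unbounded_univ ℝ ℂ hb

/-- Near a boundary point, the polygon is a circular sector. -/
theorem exists_sector_eq (hΩ : IsPolygon p Ω) (s : ℝ) : ∃ α R : ℝ, InteriorAngle p s α ∧ 0 < R ∧
    (∃ t : ℝ, 0 < t ∧ -edge p ((⌈s⌉ - 1 : ℤ) : ZMod N)
      = t * Complex.exp ((α * π : ℝ) * I) * edge p (⌊s⌋ : ZMod N)) ∧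
    Ω ∩ Metric.ball (bdry p s) (R * ‖edge p (⌊s⌋ : ZMod N)‖)
      = sector (bdry p s) (edge p (⌊s⌋ : ZMod N)) R 0 (α * π) := by
  obtain ⟨α, R, hα, hR, hdir, hJ⟩ := exists_two_sectors hΩ s
  have hπ := Real.pi_pos
  have h1 := hα.half_le
  have h2 := hα.le_three_halves
  set κ := edge p (⌊s⌋ : ZMod N) with hκ
  have hκ0 : κ ≠ 0 := edge_ne_zero hΩ _
  have hκn : 0 < ‖κ‖ := norm_pos_iff.2 hκ0
  have hαπ : 0 < α * π := by positivity
  have hαπ2 : α * π < 2 * π := by nlinarith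
  have hball : Metric.ball (bdry p s) (R * ‖κ‖) ∈ 𝓝 (bdry p s) :=
    Metric.ball_mem_nhds _ (by positivity)
  have hL := disjoint_sector_range (p := p) le_rfl hαπ2.le (by simp) hJ
  have hRr := disjoint_sector_range (p := p) hαπ.le le_rfl (by simp) hJ
  have hLΩ : sector (bdry p s) κ R 0 (α * π) ⊆ Ω := by
    rcases subset_or_disjoint_of_isPreconnected hΩ.isOpen (isPreconnected_sector _ _ _ _ _)
      (hΩ.frontier_eq ▸ hL) with h | h
    · exact h
    · obtain ⟨z, hz, hz'⟩ := exists_mem_sector_inter hΩ s h1 hR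
      exact (disjoint_left.1 h hz hz').elim
  have hcases : ∀ z ∈ Metric.ball (bdry p s) (R * ‖κ‖), z ∉ range (bdry p) →
      z ∈ sector (bdry p s) κ R 0 (α * π) ∨ z ∈ sector (bdry p s) κ R (α * π) (2 * π) := by
    intro z hz hmem
    obtain ⟨ρ, θ, h0, hn, hθ, rfl⟩ := exists_polarPoint_eq (ζ := bdry p s) hκ0 z
    rw [Metric.mem_ball, dist_eq_norm, hn] at hz
    have hρR : ρ < R := lt_of_mul_lt_mul_right hz hκn.le
    rw [hJ ρ θ h0 hρR hθ] at hmem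
    push Not at hmem
    have hρ0 := lt_of_le_of_ne h0 (Ne.symm hmem.1)
    have hθ0 := lt_of_le_of_ne hθ.1 (Ne.symm hmem.2.1)
    rcases lt_or_gt_of_ne hmem.2.2 with h3 | h3
    · exact Or.inl ⟨(ρ, θ), ⟨⟨hρ0, hρR⟩, hθ0, h3⟩, rfl⟩
    · exact Or.inr ⟨(ρ, θ), ⟨⟨hρ0, hρR⟩, h3, hθ.2⟩, rfl⟩
  have hRΩ : Disjoint (sector (bdry p s) κ R (α * π) (2 * π)) Ω := by
    rcases subset_or_disjoint_of_isPreconnected hΩ.isOpen (isPreconnected_sector _ _ _ _ _)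
      (hΩ.frontier_eq ▸ hRr) with h | h
    · exfalso
      refine union_range_bdry_not_mem_nhds hΩ s (mem_of_superset hball fun z hz => ?_)
      by_cases hmem : z ∈ range (bdry p)
      · exact Or.inr hmem
      · exact Or.inl ((hcases z hz hmem).elim (fun h' => hLΩ h') fun h' => h h')
    · exact h
  refine ⟨α, R, hα, hR, hdir, Subset.antisymm ?_ ?_⟩
  · rintro z ⟨hz, hzb⟩
    have hmem : z ∉ range (bdry p) := by
      rintro ⟨t, rfl⟩
      exact bdry_not_mem hΩ t hz
    rcases hcases z hzb hmem with h | h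
    · exact h
    · exact (disjoint_left.1 hRΩ h hz).elim
  · rintro z hz
    refine ⟨hLΩ hz, ?_⟩
    obtain ⟨⟨ρ, θ⟩, ⟨hρ, -⟩, rfl⟩ := hz
    rw [Metric.mem_ball, dist_eq_norm, norm_polarPoint_sub hρ.1.le]
    exact mul_lt_mul_of_pos_right hρ.2 hκn

end Sector

/-! ### Power coordinates at boundary points -/

section Chart

/-- The map `w ↦ ζ + κ w ^ α`, which opens up a sector with angle `α π` at `ζ` to the upper half
plane. -/
noncomputable def chart (ζ κ : ℂ) (α : ℝ) (w : ℂ) : ℂ := ζ + w ^ (α : ℂ) * κ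

theorem polar_cpow {ρ θ α : ℝ} (hρ : 0 ≤ ρ) (hα : 0 < α) (h1 : -π < θ) (h2 : θ ≤ π) :
    ((ρ : ℂ) * Complex.exp (θ * I)) ^ (α : ℂ)
      = ((ρ ^ α : ℝ) : ℂ) * Complex.exp ((α * θ : ℝ) * I) := by
  rcases hρ.eq_or_lt with rfl | hρ
  · have : (α : ℂ) ≠ 0 := ofReal_ne_zero.2 hα.ne'
    rw [ofReal_zero, zero_mul, zero_cpow this, Real.zero_rpow hα.ne', ofReal_zero, zero_mul]
  · have hne : (ρ : ℂ) * Complex.exp (θ * I) ≠ 0 :=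
      mul_ne_zero (ofReal_ne_zero.2 hρ.ne') (Complex.exp_ne_zero _)
    rw [cpow_def_of_ne_zero hne, Complex.log_ofReal_mul hρ (Complex.exp_ne_zero _),
      Complex.log_exp (by simpa using h1) (by simpa using h2), add_mul, Complex.exp_add,
      Real.rpow_def_of_pos hρ, ofReal_exp]
    push_cast
    congr 2
    ring

theorem chart_polar (ζ κ : ℂ) {ρ θ α : ℝ} (hρ : 0 ≤ ρ) (hα : 0 < α) (h1 : -π < θ) (h2 : θ ≤ π) :
    chart ζ κ α (ρ * Complex.exp (θ * I)) = polarPoint ζ κ (ρ ^ α, α * θ) := by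
  rw [chart, polar_cpow hρ hα h1 h2, polarPoint]

theorem chart_ofReal_nonneg (ζ κ : ℂ) {α x : ℝ} (hx : 0 ≤ x) :
    chart ζ κ α x = ζ + ((x ^ α : ℝ) : ℂ) * κ := by
  rw [chart, ofReal_cpow hx]

theorem chart_ofReal_nonpos (ζ κ : ℂ) {α x : ℝ} (hα : 0 < α) (hx : x ≤ 0) :
    chart ζ κ α x = ζ + (((-x) ^ α : ℝ) : ℂ) * Complex.exp ((α * π : ℝ) * I) * κ := by
  have h : (x : ℂ) = ((-x : ℝ) : ℂ) * Complex.exp ((π : ℝ) * I) := by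
    rw [Complex.exp_pi_mul_I]; push_cast; ring
  rw [h, chart_polar ζ κ (neg_nonneg.2 hx) hα (by linarith [Real.pi_pos]) le_rfl, polarPoint]

theorem upper_mem_slitPlane {w : ℂ} (hw : 0 < w.im) : w ∈ slitPlane := Or.inr hw.ne'

theorem hasDerivAt_chart (ζ κ : ℂ) (α : ℝ) {w : ℂ} (hw : 0 < w.im) :
    HasDerivAt (chart ζ κ α) (α * w ^ ((α : ℂ) - 1) * κ) w := by
  have h := ((((hasDerivAt_id w).cpow_const (c := (α : ℂ)) (upper_mem_slitPlane hw)).mul_const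
    κ).const_add ζ)
  simp only [id, mul_one] at h
  exact h

theorem norm_deriv_chart (κ : ℂ) {α : ℝ} (hα : 0 < α) (w : ℂ) :
    ‖α * w ^ ((α : ℂ) - 1) * κ‖ = α * ‖w‖ ^ (α - 1) * ‖κ‖ := by
  have : (α : ℂ) - 1 = ((α - 1 : ℝ) : ℂ) := by push_cast; rfl
  rw [norm_mul, norm_mul, this, norm_cpow_real, norm_real, Real.norm_of_nonneg hα.le]

theorem tendsto_chart (ζ κ : ℂ) {α : ℝ} (hα : 0 < α) (x : ℝ) :
    Tendsto (chart ζ κ α) (𝓝[{w : ℂ | 0 < w.im}] (x : ℂ)) (𝓝 (chart ζ κ α x)) := by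
  suffices Tendsto (fun w : ℂ => w ^ (α : ℂ)) (𝓝[{w : ℂ | 0 < w.im}] (x : ℂ)) (𝓝 ((x : ℂ) ^ (α : ℂ))) from
    (this.mul_const κ).const_add ζ
  rcases le_or_gt 0 x with hx | hx
  · exact (continuousAt_cpow_const_of_re_pos (Or.inl (by simpa using hx))
      (by simpa using hα)).tendsto.mono_left nhdsWithin_le_nhds
  -- The negative axis is the branch cut of the logarithm, which is nevertheless continuous there
  -- from the upper side.
  · have hlog := (continuousWithinAt_log_of_re_neg_of_im_zero (z := (x : ℂ)) (by simpa using hx)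
      (by simp)).mono (show {w : ℂ | 0 < w.im} ⊆ {w : ℂ | 0 ≤ w.im} from fun w (hw : 0 < w.im) => hw.le)
    have hx0 : (x : ℂ) ≠ 0 := ofReal_ne_zero.2 hx.ne
    rw [cpow_def_of_ne_zero hx0]
    refine ((continuous_exp.tendsto _).comp (hlog.tendsto.mul_const (α : ℂ))).congr' ?_
    filter_upwards [self_mem_nhdsWithin] with w hw
    have hw0 : w ≠ 0 := by
      rintro rfl
      exact lt_irrefl _ (show (0 : ℝ) < (0 : ℂ).im from hw)
    rw [cpow_def_of_ne_zero hw0]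
    rfl

theorem chart_zero (ζ κ : ℂ) {α : ℝ} (hα : 0 < α) : chart ζ κ α 0 = ζ := by
  have : (α : ℂ) ≠ 0 := ofReal_ne_zero.2 hα.ne'
  simp [chart, zero_cpow this]

variable {N : ℕ} [NeZero N] {p : ZMod N → ℂ} {Ω : Set ℂ}

theorem InteriorAngle.pos {s α : ℝ} (h : InteriorAngle p s α) : 0 < α := by
  linarith [h.half_le]

/-- The chart at the point `bdry p s`. -/
noncomputable def bdryChart (p : ZMod N → ℂ) (s α : ℝ) : ℂ → ℂ :=
  chart (bdry p s) (edge p (⌊s⌋ : ZMod N)) α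

/-- The polygon `Ω` near `bdry p s`, in the coordinate given by `bdryChart`, is the upper half
plane near `0`. -/
structure IsBdryChart (p : ZMod N → ℂ) (Ω : Set ℂ) (s α : ℝ) : Prop where
  angle : InteriorAngle p s α
  mem : ∀ᶠ w in 𝓝[{w : ℂ | 0 < w.im}] 0, bdryChart p s α w ∈ Ω
  le_map : 𝓝[Ω] (bdry p s) ≤ map (bdryChart p s α) (𝓝[{w : ℂ | 0 < w.im}] 0)
  real : ∀ P : ℝ → Prop, (∀ᶠ s' in 𝓝 s, P s') →
    ∀ᶠ x : ℝ in 𝓝 0, ∃ s', P s' ∧ bdry p s' = bdryChart p s α x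

/-- In polar coordinates w ↦ w^α is (ρ, θ) ↦ (ρ^α, αθ), a bijection from the half plane to the
sector of angle απ. Since that sector is all of Ω near the point, neighbourhoods pull back
(`le_map`); the two half axes go to the two sides (`real`). -/
theorem exists_isBdryChart (hΩ : IsPolygon p Ω) (s : ℝ) : ∃ α, IsBdryChart p Ω s α := by
  obtain ⟨α, R, hα, hR, ⟨t, ht, hdir⟩, hsec⟩ := exists_sector_eq hΩ s
  set κ := edge p (⌊s⌋ : ZMod N) with hκ
  have hκn : 0 < ‖κ‖ := norm_pos_iff.2 (edge_ne_zero hΩ _)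
  have hα0 := hα.pos
  have hπ := Real.pi_pos
  refine ⟨α, ⟨hα, ?_, ?_, ?_⟩⟩ <;> unfold bdryChart
  · have hc : ContinuousAt (fun w : ℂ => ‖w‖ ^ α) 0 :=
      (continuous_norm.continuousAt).rpow_const (Or.inr hα0.le)
    have h0 : (fun w : ℂ => ‖w‖ ^ α) 0 < R := by simpa [Real.zero_rpow hα0.ne'] using hR
    filter_upwards [self_mem_nhdsWithin, nhdsWithin_le_nhds (hc.eventually (gt_mem_nhds h0))]
      with w hw hwR
    have hw' : 0 < w.im := hw
    have hne : w ≠ 0 := by rintro rfl; exact lt_irrefl _ hw'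
    have harg0 : 0 < w.arg := by
      refine lt_of_le_of_ne (arg_nonneg_iff.2 hw'.le) fun h => ?_
      exact hw'.ne' (arg_eq_zero_iff.1 h.symm).2
    have hargπ : w.arg < π := by
      refine lt_of_le_of_ne (arg_le_pi w) fun h => ?_
      exact hw'.ne' (arg_eq_pi_iff.1 h).2
    have h2 : chart (bdry p s) κ α w = polarPoint (bdry p s) κ (‖w‖ ^ α, α * w.arg) := by
      rw [← chart_polar _ _ (norm_nonneg w) hα0 (neg_pi_lt_arg w) (arg_le_pi w),
        norm_mul_exp_arg_mul_I]
    rw [h2]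
    refine (hsec.ge ⟨_, ⟨⟨?_, hwR⟩, ?_, ?_⟩, rfl⟩ : _ ∈ Ω ∩ _).1
    · exact Real.rpow_pos_of_pos (norm_pos_iff.2 hne) _
    · exact mul_pos hα0 harg0
    · exact mul_lt_mul_of_pos_left hargπ hα0
  · intro T hT
    obtain ⟨r, hr, hrT⟩ := exists_halfDisc_of_eventually (mem_map.1 hT)
    have hrα : 0 < r ^ α := Real.rpow_pos_of_pos hr α
    have hb1 : Metric.ball (bdry p s) (R * ‖κ‖) ∈ 𝓝 (bdry p s) :=
      Metric.ball_mem_nhds _ (by positivity)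
    have hb2 : Metric.ball (bdry p s) (r ^ α * ‖κ‖) ∈ 𝓝 (bdry p s) :=
      Metric.ball_mem_nhds _ (by positivity)
    filter_upwards [self_mem_nhdsWithin, nhdsWithin_le_nhds hb1, nhdsWithin_le_nhds hb2]
      with z hz hz1 hz2
    obtain ⟨⟨ρ, θ⟩, ⟨hρ, hθ⟩, rfl⟩ := hsec.le ⟨hz, hz1⟩
    dsimp only at hρ hθ
    rw [Metric.mem_ball, dist_eq_norm, norm_polarPoint_sub hρ.1.le] at hz2
    have hρr := lt_of_mul_lt_mul_right hz2 hκn.le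
    have hinv : 0 < ρ ^ α⁻¹ := Real.rpow_pos_of_pos hρ.1 _
    have h1 : α * (θ / α) = θ := by field_simp
    have h2 : 0 < θ / α := div_pos hθ.1 hα0
    have h3 : θ / α < π := by rw [div_lt_iff₀ hα0]; linarith [hθ.2]
    have h4 : (ρ ^ α⁻¹) ^ α = ρ := Real.rpow_inv_rpow hρ.1.le hα0.ne'
    have key := hrT ((ρ ^ α⁻¹ : ℝ) * Complex.exp ((θ / α : ℝ) * I)) ⟨?_, ?_⟩
    · rw [chart_polar _ _ hinv.le hα0 (by linarith) h3.le, h4, h1] at key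
      exact key
    · rw [im_ofReal_mul, exp_ofReal_mul_I_im]
      exact mul_pos hinv (Real.sin_pos_of_pos_of_lt_pi h2 h3)
    · rw [norm_mul, norm_exp_ofReal_mul_I, mul_one, norm_real, Real.norm_of_nonneg hinv.le]
      refine (Real.rpow_lt_rpow_iff hinv.le hr.le hα0).1 ?_
      rwa [h4]
  · intro P hP
    -- For x ≥ 0 the curve parameter advances by |x|^α along the departing side. For x ≤ 0 it
    -- recedes by |x|^α / t, since t is the ratio of the lengths of the arriving and departing
    -- sides.
    have hc1 : Tendsto (fun x : ℝ => s + |x| ^ α) (𝓝 0) (𝓝 s) := by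
      have : ContinuousAt (fun x : ℝ => s + |x| ^ α) 0 :=
        continuousAt_const.add (continuous_abs.continuousAt.rpow_const (Or.inr hα0.le))
      simpa [ContinuousAt, Real.zero_rpow hα0.ne'] using this
    have hc2 : Tendsto (fun x : ℝ => s - |x| ^ α / t) (𝓝 0) (𝓝 s) := by
      have : ContinuousAt (fun x : ℝ => s - |x| ^ α / t) 0 :=
        continuousAt_const.sub
          ((continuous_abs.continuousAt.rpow_const (Or.inr hα0.le)).div_const t)
      simpa [ContinuousAt, Real.zero_rpow hα0.ne'] using this
    filter_upwards [hc1.eventually hP, hc2.eventually hP,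
      hc1.eventually (gt_mem_nhds (Int.lt_floor_add_one s)),
      hc2.eventually (lt_mem_nhds (show (⌈s⌉ : ℝ) - 1 < s by linarith [Int.ceil_lt_add_one s]))]
      with x h1 h2 h3 h4
    have habs : 0 ≤ |x| ^ α := Real.rpow_nonneg (abs_nonneg x) α
    rcases le_total 0 x with hx | hx
    · refine ⟨_, h1, ?_⟩
      rw [bdry_add_of_le p habs h3.le, chart_ofReal_nonneg _ _ hx, abs_of_nonneg hx]
    · refine ⟨_, h2, ?_⟩
      rw [bdry_sub_of_le p (by positivity) h4.le, chart_ofReal_nonpos _ _ hα0 hx, abs_of_nonpos hx]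
      have ht' : (t : ℂ) ≠ 0 := ofReal_ne_zero.2 ht.ne'
      rw [ofReal_div]
      have e : ((((-x) ^ α : ℝ) : ℂ) / t : ℂ) * t = (((-x) ^ α : ℝ) : ℂ) := div_mul_cancel₀ _ ht'
      linear_combination ((((-x) ^ α : ℝ) : ℂ) / t : ℂ) * hdir
        + Complex.exp ((α * π : ℝ) * I) * κ * e

end Chart

/-! ### Local behaviour of solutions and of the primitive of their product -/

section Local

variable {N : ℕ} [NeZero N] {p : ZMod N → ℂ} {Ω : Set ℂ} {s α : ℝ}

theorem hasDerivAt_bdryChart (p : ZMod N → ℂ) (s α : ℝ) {w : ℂ} (hw : 0 < w.im) :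
    HasDerivAt (bdryChart p s α) (α * w ^ ((α : ℂ) - 1) * edge p (⌊s⌋ : ZMod N)) w :=
  hasDerivAt_chart _ _ _ hw

theorem tendsto_bdryChart (p : ZMod N → ℂ) (s : ℝ) (hα : 0 < α) :
    Tendsto (bdryChart p s α) (𝓝[{w : ℂ | 0 < w.im}] 0) (𝓝 (bdry p s)) := by
  have := tendsto_chart (bdry p s) (edge p (⌊s⌋ : ZMod N)) hα 0
  rwa [ofReal_zero, chart_zero _ _ hα] at this

theorem IsBdryChart.tendsto (h : IsBdryChart p Ω s α) :
    Tendsto (bdryChart p s α) (𝓝[{w : ℂ | 0 < w.im}] 0) (𝓝[Ω] (bdry p s)) :=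
  tendsto_nhdsWithin_iff.2 ⟨tendsto_bdryChart p s h.angle.pos, h.mem⟩

theorem nhdsWithin_bdry_neBot (hΩ : IsPolygon p Ω) (s : ℝ) : (𝓝[Ω] (bdry p s)).NeBot := by
  rw [← mem_closure_iff_nhdsWithin_neBot]
  exact frontier_subset_closure (hΩ.frontier_eq ▸ mem_range_self s)

/-- A holomorphic function on the polygon, one component of which vanishes along the boundary
near `bdry p s`, is holomorphic at this point as a function of the coordinate. -/
theorem IsBdryChart.exists_extension (h : IsBdryChart p Ω s α) {φ : ℂ → ℂ}
    (hΩ : IsOpen Ω) (hφ : DifferentiableOn ℂ φ Ω) {c : ℂ} (hc : c ≠ 0)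
    (h0 : ∀ᶠ s' in 𝓝 s, Tendsto (fun z => (c * φ z).re) (𝓝[Ω] (bdry p s')) (𝓝 0)) :
    ∃ r > 0, ∃ ψ : ℂ → ℂ, DifferentiableOn ℂ ψ (Metric.ball 0 r) ∧
      (∀ w ∈ halfDisc r, bdryChart p s α w ∈ Ω ∧ ψ w = φ (bdryChart p s α w)) ∧
      ∀ x : ℝ, |x| < r → (c * ψ x).re = 0 := by
  obtain ⟨r₁, hr₁, hmem⟩ := exists_halfDisc_of_eventually h.mem
  obtain ⟨r₂, hr₂, hreal⟩ := Metric.eventually_nhds_iff.1 (h.real _ h0)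
  set r₀ := min r₁ r₂
  have hr₀ : 0 < r₀ := lt_min hr₁ hr₂
  have hm : ∀ w ∈ halfDisc r₀, bdryChart p s α w ∈ Ω :=
    fun w hw => hmem w (halfDisc_mono (min_le_left _ _) hw)
  -- The factor I turns the vanishing real part of c φ into the vanishing imaginary part required
  -- for reflection.
  have hd : DifferentiableOn ℂ (fun w => I * (c * φ (bdryChart p s α w))) (halfDisc r₀) := by
    intro w hw
    have h1 := (hφ.differentiableAt (hΩ.mem_nhds (hm w hw))).comp w
      (hasDerivAt_bdryChart p s α hw.1).differentiableAt
    exact ((h1.const_mul c).const_mul I).differentiableWithinAt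
  obtain ⟨ρ, hρ, hρr, ψ, hψ, hψφ, hψ0⟩ := exists_reflection hr₀ hd (fun x hx => by
    obtain ⟨s', hs', hbs'⟩ := hreal (y := x) (by
      rw [Real.dist_eq, sub_zero]; exact hx.trans_le (min_le_right _ _))
    have ht : Tendsto (bdryChart p s α) (𝓝[{w : ℂ | 0 < w.im}] (x : ℂ)) (𝓝[Ω] (bdry p s')) := by
      rw [hbs']
      refine tendsto_nhdsWithin_iff.2 ⟨tendsto_chart _ _ h.angle.pos x, ?_⟩
      filter_upwards [halfDisc_mem_nhdsWithin (r := r₀) (w := (x : ℂ)) (by simpa using hx)]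
        with w hw using hm w hw
    refine (hs'.comp ht).congr fun w => ?_
    simp)
  refine ⟨ρ, hρ, fun w => (I * c)⁻¹ * ψ w, hψ.const_mul _, fun w hw => ⟨hm w (halfDisc_mono hρr hw),
    ?_⟩, fun x hx => ?_⟩
  · dsimp only
    rw [hψφ w hw, ← mul_assoc I c, inv_mul_cancel_left₀ (mul_ne_zero I_ne_zero hc)]
  · have h1 := hψ0 x hx
    have h2 : c * ((I * c)⁻¹ * ψ x) = -(I * ψ x) := by
      rw [mul_inv, inv_I]
      field_simp
    rw [h2]
    simpa using h1

theorem one_le_inv_sqrt_im {w : ℂ} (hw : w ∈ halfDisc 1) : 1 ≤ 1 / √w.im := by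
  have him : w.im ≤ 1 := (le_abs_self _).trans ((abs_im_le_norm w).trans hw.2.le)
  rw [le_div_iff₀ (Real.sqrt_pos.2 hw.1), one_mul]
  exact Real.sqrt_le_one.2 him

/-- A semi-bounded holomorphic function grows at most like the inverse square root of the distance
to the real axis. -/
theorem exists_norm_le_of_semibounded {r : ℝ} (hr : 0 < r) {φ : ℂ → ℂ}
    (hφ : DifferentiableOn ℂ φ (halfDisc r)) {C : ℝ}
    (hre : (∀ w ∈ halfDisc r, (φ w).re ≤ C) ∨ ∀ w ∈ halfDisc r, -C ≤ (φ w).re)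
    (him : (∀ w ∈ halfDisc r, (φ w).im ≤ C) ∨ ∀ w ∈ halfDisc r, -C ≤ (φ w).im) :
    ∃ K > 0, ∃ ρ > 0, ∀ w ∈ halfDisc ρ, ‖φ w‖ ≤ K / √w.im := by
  -- A rotation by a fourth root of unity makes both parts bounded below, and a shift moves the
  -- values into the first quadrant. Their squares lie in the upper half plane, and the half plane
  -- estimate for the squares yields the inverse square root.
  obtain ⟨c, hc, hq⟩ : ∃ c : ℂ, ‖c‖ = 1 ∧
      ∀ w ∈ halfDisc r, -C ≤ (c * φ w).re ∧ -C ≤ (c * φ w).im := by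
    rcases hre with h1 | h1 <;> rcases him with h2 | h2
    · refine ⟨-1, by simp, fun w hw => ?_⟩
      simpa using ⟨h1 w hw, h2 w hw⟩
    · refine ⟨-I, by simp, fun w hw => ?_⟩
      simpa using ⟨h2 w hw, h1 w hw⟩
    · refine ⟨I, by simp, fun w hw => ?_⟩
      simpa using ⟨h2 w hw, h1 w hw⟩
    · refine ⟨1, by simp, fun w hw => ?_⟩
      simpa using ⟨h1 w hw, h2 w hw⟩
  set τ : ℂ → ℂ := fun w => c * φ w + C * (1 + I) with hτ
  have hτre : ∀ w ∈ halfDisc r, 0 ≤ (τ w).re := fun w hw => by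
    have := (hq w hw).1
    simp only [hτ, add_re, re_ofReal_mul, one_re, I_re, add_zero, mul_one]
    linarith
  have hτim : ∀ w ∈ halfDisc r, 0 ≤ (τ w).im := fun w hw => by
    have := (hq w hw).2
    simp only [hτ, add_im, im_ofReal_mul, one_im, I_im, zero_add, mul_one]
    linarith
  obtain ⟨K, hK, hb⟩ := exists_norm_le_div_im hr (P := fun w => τ w ^ 2)
    (((hφ.const_mul c).add_const _).pow 2) (fun w hw => by
      rw [sq, mul_im]
      have := mul_nonneg (hτre w hw) (hτim w hw)
      linarith)
  have hMnn : 0 ≤ ‖(C * (1 + I) : ℂ)‖ := norm_nonneg _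
  refine ⟨√K + ‖(C * (1 + I) : ℂ)‖, by positivity, min (r / 4) 1, by positivity, fun w hw => ?_⟩
  have h1 := hb w (halfDisc_mono (min_le_left _ _) hw)
  rw [norm_pow] at h1
  have h2 : ‖τ w‖ ≤ √K / √w.im := by
    rw [← Real.sqrt_div hK.le]
    exact Real.le_sqrt_of_sq_le h1
  have h3 := one_le_inv_sqrt_im (halfDisc_mono (min_le_right _ _) hw)
  have h4 : ‖φ w‖ ≤ ‖τ w‖ + ‖(C * (1 + I) : ℂ)‖ := by
    have : ‖φ w‖ = ‖c * φ w‖ := by rw [norm_mul, hc, one_mul]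
    rw [this]
    have h5 : c * φ w = τ w - C * (1 + I) := by simp [hτ]
    rw [h5]
    exact norm_sub_le _ _
  rw [add_div]
  have h6 : ‖(C * (1 + I) : ℂ)‖ ≤ ‖(C * (1 + I) : ℂ)‖ / √w.im := by
    rw [div_eq_mul_one_div]
    exact le_mul_of_one_le_right hMnn h3
  linarith

/-- At a corner where `φ` is bounded, if it is convex, and semi-bounded, if it is concave, the
differential `φ dz` is integrable. -/
theorem IsBdryChart.exists_norm_mul_deriv_le (h : IsBdryChart p Ω s α) {φ : ℂ → ℂ}
    (hΩ : IsOpen Ω) (hφ : DifferentiableOn ℂ φ Ω) {k : ℤ} (hs : s = k)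
    (hconv : ConvexCorner p k → φ =O[𝓝[Ω] (bdry p s)] (fun _ => (1 : ℝ))) {c : ℂ} (hc : c ≠ 0)
    (hconc : ConcaveCorner p k → SemiBoundedNear Ω (bdry p s) (fun z => (c * φ z).re) ∧
      SemiBoundedNear Ω (bdry p s) (fun z => (c * φ z).im)) :
    ∃ K > 0, ∃ r > 0, ∀ w ∈ halfDisc r,
      ‖φ (bdryChart p s α w) * (α * w ^ ((α : ℂ) - 1) * edge p (⌊s⌋ : ZMod N))‖ ≤ K / √w.im := by
  have hα := h.angle.pos
  set κ := edge p (⌊s⌋ : ZMod N) with hκ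
  -- At a convex corner φ is bounded and the chart derivative is of order ‖w‖^(-1/2); at a concave
  -- one φ is O((Im w)^(-1/2)) and the derivative, of order ‖w‖^(1/2), is bounded.
  rcases h.angle with ⟨-, h1⟩ | ⟨h1, k', hk', hk⟩ | ⟨h1, k', hk', hk⟩
  · exact (h1 k hs).elim
  · have hkk : k' = k := by rw [hs] at hk'; exact_mod_cast hk'.symm
    rw [hkk] at hk
    obtain ⟨C, hC0, hC⟩ := (hconv hk).exists_pos
    obtain ⟨r, hr, hb⟩ := exists_halfDisc_of_eventually (h.tendsto.eventually hC.bound)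
    refine ⟨C * (α * ‖κ‖) + 1, by positivity, r, hr, fun w hw => ?_⟩
    have hb' : ‖φ (bdryChart p s α w)‖ ≤ C := by simpa using hb w hw
    have hn : ‖w‖ ^ (α - 1) ≤ 1 / √w.im := by
      have e : α - 1 = -(1 / 2) := by rw [h1]; norm_num
      rw [e, Real.rpow_neg (norm_nonneg w), ← Real.sqrt_eq_rpow, one_div]
      exact inv_anti₀ (Real.sqrt_pos.2 hw.1)
        (Real.sqrt_le_sqrt ((le_abs_self _).trans (abs_im_le_norm w)))
    have hs0 : 0 < √w.im := Real.sqrt_pos.2 hw.1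
    rw [norm_mul, norm_deriv_chart κ hα]
    calc ‖φ (bdryChart p s α w)‖ * (α * ‖w‖ ^ (α - 1) * ‖κ‖)
        ≤ C * (α * (1 / √w.im) * ‖κ‖) := by gcongr
      _ = C * (α * ‖κ‖) / √w.im := by ring
      _ ≤ (C * (α * ‖κ‖) + 1) / √w.im := by gcongr; linarith
  · have hkk : k' = k := by rw [hs] at hk'; exact_mod_cast hk'.symm
    rw [hkk] at hk
    have hsemi : ∀ u : ℂ → ℝ, SemiBoundedNear Ω (bdry p s) u → ∃ r > 0, ∃ C : ℝ,
        (∀ w ∈ halfDisc r, u (bdryChart p s α w) ≤ C) ∨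
        (∀ w ∈ halfDisc r, -C ≤ u (bdryChart p s α w)) := by
      rintro u (⟨C, hC⟩ | ⟨C, hC⟩)
      · obtain ⟨r, hr, hb⟩ := exists_halfDisc_of_eventually (h.tendsto.eventually hC)
        exact ⟨r, hr, C, Or.inl hb⟩
      · obtain ⟨r, hr, hb⟩ := exists_halfDisc_of_eventually (h.tendsto.eventually hC)
        exact ⟨r, hr, -C, Or.inr (by simpa using hb)⟩
    obtain ⟨r₁, hr₁, C₁, h₁⟩ := hsemi _ (hconc hk).1
    obtain ⟨r₂, hr₂, C₂, h₂⟩ := hsemi _ (hconc hk).2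
    obtain ⟨r₃, hr₃, hmem⟩ := exists_halfDisc_of_eventually h.mem
    set r := min r₁ (min r₂ r₃) with hr
    have hr0 : 0 < r := by positivity
    have hm1 : halfDisc r ⊆ halfDisc r₁ := halfDisc_mono (min_le_left _ _)
    have hm2 : halfDisc r ⊆ halfDisc r₂ := halfDisc_mono ((min_le_right _ _).trans (min_le_left _ _))
    have hm3 : halfDisc r ⊆ halfDisc r₃ := halfDisc_mono ((min_le_right _ _).trans (min_le_right _ _))
    have hd : DifferentiableOn ℂ (fun w => c * φ (bdryChart p s α w)) (halfDisc r) := by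
      intro w hw
      have h1 := (hφ.differentiableAt (hΩ.mem_nhds (hmem w (hm3 hw)))).comp w
        (hasDerivAt_bdryChart p s α hw.1).differentiableAt
      exact (h1.const_mul c).differentiableWithinAt
    obtain ⟨K, hK, ρ, hρ, hb⟩ := exists_norm_le_of_semibounded hr0 hd (C := max C₁ C₂)
      (h₁.imp (fun h w hw => (h w (hm1 hw)).trans (le_max_left _ _))
        fun h w hw => (neg_le_neg (le_max_left _ _)).trans (h w (hm1 hw)))
      (h₂.imp (fun h w hw => (h w (hm2 hw)).trans (le_max_right _ _))
        fun h w hw => (neg_le_neg (le_max_right _ _)).trans (h w (hm2 hw)))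
    have hcn : 0 < ‖c‖ := norm_pos_iff.2 hc
    refine ⟨K / ‖c‖ * (α * ‖κ‖) + 1, by positivity, min ρ 1, by positivity, fun w hw => ?_⟩
    have h5 := hb w (halfDisc_mono (min_le_left _ _) hw)
    have hs0 : 0 < √w.im := Real.sqrt_pos.2 hw.1
    have h6 : ‖φ (bdryChart p s α w)‖ ≤ K / ‖c‖ / √w.im := by
      rw [norm_mul] at h5
      rw [div_right_comm, le_div_iff₀ hcn]
      linarith
    have h7 : ‖w‖ ^ (α - 1) ≤ 1 :=
      Real.rpow_le_one (norm_nonneg w) (hw.2.trans_le (min_le_right _ _)).le (by rw [h1]; norm_num)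
    rw [norm_mul, norm_deriv_chart κ hα]
    calc ‖φ (bdryChart p s α w)‖ * (α * ‖w‖ ^ (α - 1) * ‖κ‖)
        ≤ K / ‖c‖ / √w.im * (α * 1 * ‖κ‖) := by gcongr
      _ = K / ‖c‖ * (α * ‖κ‖) / √w.im := by ring
      _ ≤ (K / ‖c‖ * (α * ‖κ‖) + 1) / √w.im := by gcongr; linarith

/-- If the differential `φ ψ dz` is integrable at `bdry p s` and `ψ` is bounded there, then the
primitive of `φ ψ` has a limit. -/
theorem IsBdryChart.exists_tendsto_primitive (h : IsBdryChart p Ω s α) {φ ψ G : ℂ → ℂ}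
    (hG : ∀ z ∈ Ω, HasDerivAt G (φ z * ψ z) z) {K r : ℝ} (hr : 0 < r)
    (hφ : ∀ w ∈ halfDisc r,
      ‖φ (bdryChart p s α w) * (α * w ^ ((α : ℂ) - 1) * edge p (⌊s⌋ : ZMod N))‖ ≤ K / √w.im)
    {M : ℝ} (hψ : ∀ᶠ w in 𝓝[{w : ℂ | 0 < w.im}] 0, ‖ψ (bdryChart p s α w)‖ ≤ M) :
    ∃ L, Tendsto G (𝓝[Ω] (bdry p s)) (𝓝 L) := by
  obtain ⟨r₁, hr₁, hb⟩ := exists_halfDisc_of_eventually (hψ.and h.mem)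
  have hmono1 : halfDisc (min r r₁) ⊆ halfDisc r := halfDisc_mono (min_le_left _ _)
  have hmono2 : halfDisc (min r r₁) ⊆ halfDisc r₁ := halfDisc_mono (min_le_right _ _)
  have hr₂ : 0 < min r r₁ := lt_min hr hr₁
  obtain ⟨L, hL⟩ := exists_tendsto_of_norm_deriv_le (r := min r r₁) (K := K * M)
    (Φ := fun w => G (bdryChart p s α w))
    (Φ' := fun w => φ (bdryChart p s α w) * ψ (bdryChart p s α w) *
      (α * w ^ ((α : ℂ) - 1) * edge p (⌊s⌋ : ZMod N)))
    (fun w hw => (hG _ (hb w (hmono2 hw)).2).comp w (hasDerivAt_bdryChart p s α hw.1))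
    (fun w hw => by
      rw [mul_right_comm, norm_mul, mul_div_right_comm]
      exact mul_le_mul (hφ w (hmono1 hw)) (hb w (hmono2 hw)).1 (norm_nonneg _)
        ((norm_nonneg _).trans (hφ w (hmono1 hw))))
    (w := 0) (by simp) (by simpa using hr₂)
  exact ⟨L, (tendsto_map'_iff.2 hL).mono_left h.le_map⟩

theorem bdryChart_one (p : ZMod N → ℂ) (s : ℝ) (w : ℂ) :
    bdryChart p s 1 w = bdry p s + w * edge p (⌊s⌋ : ZMod N) := by
  simp [bdryChart, chart]

theorem IsBdryChart.eq_one (h : IsBdryChart p Ω s α) (hs : ∀ k : ℤ, s ≠ k) : α = 1 := by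
  rcases h.angle with ⟨h, -⟩ | ⟨-, k, hk, -⟩ | ⟨-, k, hk, -⟩
  · exact h
  · exact (hs k hk).elim
  · exact (hs k hk).elim

/-- Inside a side of the polygon, the points of `Ω` correspond to points of the upper half
plane. -/
theorem IsBdryChart.eventually_mem_halfDisc (hΩ : IsPolygon p Ω) (h : IsBdryChart p Ω s 1) {r : ℝ}
    (hr : 0 < r) : ∀ᶠ z in 𝓝[Ω] (bdry p s), (z - bdry p s) / edge p (⌊s⌋ : ZMod N) ∈ halfDisc r ∧
      bdryChart p s 1 ((z - bdry p s) / edge p (⌊s⌋ : ZMod N)) = z := by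
  have hκ := edge_ne_zero hΩ (⌊s⌋ : ZMod N)
  refine h.le_map (mem_map.2 ?_)
  filter_upwards [halfDisc_mem_nhdsWithin (r := r) (w := 0) (by simpa using hr)] with w hw
  have e : (bdryChart p s 1 w - bdry p s) / edge p (⌊s⌋ : ZMod N) = w := by
    rw [bdryChart_one, add_sub_cancel_left, mul_div_cancel_right₀ _ hκ]
  simp only [mem_preimage, mem_ofPred_eq, e, and_true]
  exact hw

/-- If both `φ` and `ψ` extend across a side, and `φ ψ dz` is imaginary along it, then the real
part of the primitive of `φ ψ` is constant along the side. -/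
theorem IsBdryChart.exists_tendsto_re_primitive (hΩ : IsPolygon p Ω) (h : IsBdryChart p Ω s 1)
    (hs : ∀ k : ℤ, s ≠ k) {f g G : ℂ → ℂ} (hG : ∀ z ∈ Ω, HasDerivAt G (f z * g z) z)
    (hf : DifferentiableOn ℂ f Ω) (hg : DifferentiableOn ℂ g Ω) {c d : ℂ} (hc : c ≠ 0) (hd : d ≠ 0)
    (hf0 : ∀ᶠ s' in 𝓝 s, Tendsto (fun z => (c * f z).re) (𝓝[Ω] (bdry p s')) (𝓝 0))
    (hg0 : ∀ᶠ s' in 𝓝 s, Tendsto (fun z => (d * g z).re) (𝓝[Ω] (bdry p s')) (𝓝 0))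
    (hcd : ∀ x y : ℂ, (c * x).re = 0 → (d * y).re = 0 →
      (x * y * edge p (⌊s⌋ : ZMod N)).re = 0) :
    ∃ L : ℝ, ∀ᶠ s' in 𝓝 s, Tendsto (fun z => (G z).re) (𝓝[Ω] (bdry p s')) (𝓝 L) := by
  set κ := edge p (⌊s⌋ : ZMod N) with hκdef
  have hκ : κ ≠ 0 := edge_ne_zero hΩ _
  obtain ⟨r₁, hr₁, ψ₁, hψ₁, hfψ, hψ₁0⟩ := h.exists_extension hΩ.isOpen hf hc hf0
  obtain ⟨r₂, hr₂, ψ₂, hψ₂, hgψ, hψ₂0⟩ := h.exists_extension hΩ.isOpen hg hd hg0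
  set r := min r₁ r₂ with hr
  have hr0 : 0 < r := lt_min hr₁ hr₂
  have hle1 : r ≤ r₁ := min_le_left _ _
  have hle2 : r ≤ r₂ := min_le_right _ _
  have hdiff : DifferentiableOn ℂ (fun w => ψ₁ w * ψ₂ w * κ) (Metric.ball 0 r) :=
    ((hψ₁.mono (Metric.ball_subset_ball hle1)).mul
      (hψ₂.mono (Metric.ball_subset_ball hle2))).mul_const κ
  obtain ⟨Ψ, hΨ⟩ : ∃ Ψ : ℂ → ℂ, ∀ z ∈ Metric.ball (0 : ℂ) r, HasDerivAt Ψ (ψ₁ z * ψ₂ z * κ) z :=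
    hdiff.isExactOn_ball
  have hκd : ∀ w, 0 < w.im → HasDerivAt (bdryChart p s 1) κ w := by
    intro w hw
    have := hasDerivAt_bdryChart p s 1 hw
    simpa using this
  obtain ⟨w₀, hw₀⟩ : (halfDisc r).Nonempty :=
    ⟨((r / 2 : ℝ) : ℂ) * I, by simpa using hr0, by
      rw [norm_mul, norm_I, mul_one, norm_real, Real.norm_eq_abs, abs_of_pos] <;> linarith⟩
  -- G in the chart and Ψ have the same derivative on the half disc, so G inherits from Ψ its
  -- continuity up to the side. The real part of Ψ is constant on the axis because its derivative
  -- there is imaginary.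
  set a := G (bdryChart p s 1 w₀) - Ψ w₀ with ha
  have hGΨ : ∀ w ∈ halfDisc r, G (bdryChart p s 1 w) = Ψ w + a := by
    intro w hw
    have hder : ∀ w ∈ halfDisc r, HasDerivWithinAt (fun w => G (bdryChart p s 1 w) - Ψ w) 0
        (halfDisc r) w := by
      intro w hw
      have m1 := hfψ w (halfDisc_mono hle1 hw)
      have m2 := hgψ w (halfDisc_mono hle2 hw)
      have h1 := (hG _ m1.1).comp w (hκd w hw.1)
      have h2 := (h1.sub (hΨ w (by simpa using hw.2))).hasDerivWithinAt (s := halfDisc r)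
      rw [m1.2, m2.2, sub_self] at h2
      exact h2
    have := (convex_halfDisc r).norm_image_sub_le_of_norm_hasDerivWithin_le (C := 0) hder
      (by simp) hw₀ hw
    rw [zero_mul, norm_le_zero_iff, sub_eq_zero] at this
    rw [ha, ← this]
    ring
  have hΨre : ∀ x : ℝ, |x| < r → (Ψ x).re = (Ψ 0).re := by
    intro x hx
    have hder : ∀ t ∈ Ioo (-r) r, HasDerivWithinAt (fun t : ℝ => (Ψ t).re) 0 (Ioo (-r) r) t := by
      intro t ht
      have ht' : |t| < r := abs_lt.2 ht
      have h1 := (hΨ t (by simpa using ht')).comp_ofReal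
      have h2 : HasDerivAt (fun t : ℝ => (Ψ t).re) ((ψ₁ t * ψ₂ t * κ).re) t :=
        reCLM.hasFDerivAt.comp_hasDerivAt t h1
      rw [hcd _ _ (hψ₁0 t (ht'.trans_le hle1)) (hψ₂0 t (ht'.trans_le hle2))] at h2
      exact h2.hasDerivWithinAt
    have := (convex_Ioo (-r) r).norm_image_sub_le_of_norm_hasDerivWithin_le (C := 0) hder
      (by simp) (x := 0) (y := x) ⟨by linarith, hr0⟩ (abs_lt.1 hx)
    simpa [sub_eq_zero] using this
  refine ⟨(Ψ 0).re + a.re, ?_⟩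
  have hev : ∀ᶠ z in 𝓝[Ω] (bdry p s), G z = Ψ ((z - bdry p s) / κ) + a := by
    filter_upwards [h.eventually_mem_halfDisc hΩ hr0] with z hz
    rw [← hGΨ _ hz.1, hz.2]
  have hev2 := (continuous_bdry p).continuousAt.eventually (eventually_nhds_nhdsWithin.2 hev)
  have hfl : ∀ᶠ s' in 𝓝 s, bdry p s' = bdry p s + ((s' - s : ℝ) : ℂ) * κ := by
    have h1 : (⌊s⌋ : ℝ) < s := lt_of_le_of_ne (Int.floor_le s) (hs _).symm
    filter_upwards [lt_mem_nhds h1, gt_mem_nhds (Int.lt_floor_add_one s)] with s' h2 h3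
    rw [bdry_eq_of_mem_Icc p (k := ⌊s⌋) ⟨h2.le, h3.le⟩,
      bdry_eq_of_mem_Icc p (k := ⌊s⌋) ⟨h1.le, (Int.lt_floor_add_one s).le⟩]
    push_cast
    ring
  filter_upwards [hev2, hfl, Metric.ball_mem_nhds s hr0] with s' h1 h2 h3
  have hx : |s' - s| < r := by simpa [Real.dist_eq] using h3
  have hx' : ((s' - s : ℝ) : ℂ) ∈ Metric.ball (0 : ℂ) r := by
    rw [mem_ball_zero_iff, norm_real]; exact hx
  have hval : (bdry p s' - bdry p s) / κ = ((s' - s : ℝ) : ℂ) := by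
    rw [h2, add_sub_cancel_left, mul_div_cancel_right₀ _ hκ]
  have hcont : ContinuousAt (fun z => (Ψ ((z - bdry p s) / κ) + a).re) (bdry p s') := by
    have hc1 : ContinuousAt Ψ ((bdry p s' - bdry p s) / κ) := by
      rw [hval]; exact (hΨ _ hx').continuousAt
    have hc2 : ContinuousAt (fun z : ℂ => (z - bdry p s) / κ) (bdry p s') := by fun_prop
    have hc3 : ContinuousAt (fun z => Ψ ((z - bdry p s) / κ)) (bdry p s') :=
      ContinuousAt.comp (f := fun z : ℂ => (z - bdry p s) / κ) hc1 hc2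
    exact continuous_re.continuousAt.comp (hc3.add continuousAt_const)
  have hlim := hcont.tendsto.mono_left (nhdsWithin_le_nhds (s := Ω))
  rw [hval, add_re, hΨre _ hx] at hlim
  refine hlim.congr' ?_
  filter_upwards [h1] with z hz
  rw [hz]

/-- Near a simple pole `ρ / (z - bdry p s)` of `φ`, the primitive of `φ ψ` has bounded real part,
if `ρ ψ` is imaginary at the pole. -/
theorem IsBdryChart.exists_re_primitive_le (h : IsBdryChart p Ω s 1)
    (hΩ : IsPolygon p Ω) {φ ψ G : ℂ → ℂ} (hG : ∀ z ∈ Ω, HasDerivAt G (φ z * ψ z) z) {ρ : ℂ}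
    (hφ : (fun z => φ z - ρ / (z - bdry p s)) =O[𝓝[Ω] (bdry p s)] (fun _ => (1 : ℝ)))
    (hψ : DifferentiableOn ℂ ψ Ω) {d : ℂ} (hd : d ≠ 0)
    (hψ0 : ∀ᶠ s' in 𝓝 s, Tendsto (fun z => (d * ψ z).re) (𝓝[Ω] (bdry p s')) (𝓝 0))
    (hdρ : ∀ y : ℂ, (d * y).re = 0 → (ρ * y).re = 0) :
    ∃ C : ℝ, ∀ᶠ z in 𝓝[Ω] (bdry p s), |(G z).re| ≤ C := by
  set κ := edge p (⌊s⌋ : ZMod N) with hκdef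
  have hκ : κ ≠ 0 := edge_ne_zero hΩ _
  obtain ⟨r₁, hr₁, ψ₁, hψ₁, hψψ, hψ₁0⟩ := h.exists_extension hΩ.isOpen hψ hd hψ0
  have hψ0d : DifferentiableAt ℂ ψ₁ 0 :=
    hψ₁.differentiableAt (Metric.ball_mem_nhds 0 hr₁)
  obtain ⟨C₁, hC₁, h1⟩ := hφ.exists_pos
  obtain ⟨C₂, hC₂, h2⟩ := hψ0d.isBigO_sub.exists_pos
  have h3 : ∀ᶠ w in 𝓝 (0 : ℂ), ‖ψ₁ w‖ < ‖ψ₁ 0‖ + 1 :=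
    hψ0d.continuousAt.norm.eventually (gt_mem_nhds (by linarith))
  obtain ⟨r₂, hr₂, hb⟩ := exists_halfDisc_of_eventually ((h.tendsto.eventually h1.bound).and
    ((h2.bound.filter_mono nhdsWithin_le_nhds).and (h3.filter_mono nhdsWithin_le_nhds)))
  set r := min r₁ r₂ with hr
  have hr0 : 0 < r := lt_min hr₁ hr₂
  have hle1 : r ≤ r₁ := min_le_left _ _
  have hle2 : r ≤ r₂ := min_le_right _ _
  set b := (ρ * ψ₁ 0).im with hbdef
  have hbI : ρ * ψ₁ 0 = b * I := by
    have h0 := hdρ _ (by simpa using hψ₁0 0 (by simpa using hr₁))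
    apply Complex.ext
    · simpa using h0
    · simp [hbdef]
  have hκd : ∀ w, 0 < w.im → HasDerivAt (bdryChart p s 1) κ w := by
    intro w hw
    have := hasDerivAt_bdryChart p s 1 hw
    simpa using this
  -- Removing b I log w leaves a function with bounded derivative, and Re (b I log w) = -b arg w is
  -- itself bounded.
  set H : ℂ → ℂ := fun w => G (bdryChart p s 1 w) - b * I * Complex.log w with hH
  set B := C₁ * (‖ψ₁ 0‖ + 1) * ‖κ‖ + ‖ρ‖ * C₂ with hB
  have hHd : ∀ w ∈ halfDisc r, HasDerivWithinAt H
      (φ (bdryChart p s 1 w) * ψ (bdryChart p s 1 w) * κ - b * I * w⁻¹) (halfDisc r) w := by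
    intro w hw
    have m1 := hψψ w (halfDisc_mono hle1 hw)
    exact (((hG _ m1.1).comp w (hκd w hw.1)).sub
      ((Complex.hasDerivAt_log (upper_mem_slitPlane hw.1)).const_mul (b * I))).hasDerivWithinAt
  have hHb : ∀ w ∈ halfDisc r,
      ‖φ (bdryChart p s 1 w) * ψ (bdryChart p s 1 w) * κ - b * I * w⁻¹‖ ≤ B := by
    intro w hw
    have m1 := hψψ w (halfDisc_mono hle1 hw)
    obtain ⟨b1, b2, b3⟩ := hb w (halfDisc_mono hle2 hw)
    have hw0 : w ≠ 0 := by
      rintro rfl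
      have := hw.1
      simp at this
    rw [bdryChart_one, add_sub_cancel_left, ← bdryChart_one, ← hκdef, norm_one, mul_one] at b1
    rw [sub_zero] at b2
    set E := φ (bdryChart p s 1 w) - ρ / (w * κ) with hE
    -- The first term contains the bounded error E at the pole, the second the bounded difference
    -- quotient of ψ₁ at 0.
    have e : φ (bdryChart p s 1 w) * ψ (bdryChart p s 1 w) * κ - b * I * w⁻¹
        = E * ψ₁ w * κ + ρ * ((ψ₁ w - ψ₁ 0) / w) := by
      rw [← hbI, ← m1.2, hE]
      field_simp
      ring
    rw [e, hB]
    refine (norm_add_le _ _).trans (add_le_add ?_ ?_)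
    · rw [norm_mul, norm_mul]
      gcongr
    · rw [norm_mul, norm_div]
      gcongr
      exact (div_le_iff₀ (norm_pos_iff.2 hw0)).2 b2
  obtain ⟨w₀, hw₀⟩ : (halfDisc r).Nonempty :=
    ⟨((r / 2 : ℝ) : ℂ) * I, by simpa using hr0, by
      rw [norm_mul, norm_I, mul_one, norm_real, Real.norm_eq_abs, abs_of_pos] <;> linarith⟩
  have hB0 : 0 ≤ B := by positivity
  refine ⟨‖H w₀‖ + B * (2 * r) + |b| * π, ?_⟩
  filter_upwards [h.eventually_mem_halfDisc hΩ hr0] with z hz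
  rw [← hz.2]
  set w := (z - bdry p s) / edge p (⌊s⌋ : ZMod N)
  have hw := hz.1
  have k1 := (convex_halfDisc r).norm_image_sub_le_of_norm_hasDerivWithin_le hHd hHb hw₀ hw
  have k2 : ‖w - w₀‖ ≤ 2 * r := by
    have := norm_sub_le w w₀
    linarith [hw.2, hw₀.2]
  have k3 : ‖H w‖ ≤ ‖H w₀‖ + B * (2 * r) := by
    have k4 := norm_sub_norm_le (H w) (H w₀)
    have k5 : B * ‖w - w₀‖ ≤ B * (2 * r) := by gcongr
    linarith
  have k6 : (G (bdryChart p s 1 w)).re = (H w).re - b * w.arg := by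
    simp [hH, Complex.log_im]
  rw [k6]
  have k7 : |b * w.arg| ≤ |b| * π := by
    rw [abs_mul]
    gcongr
    exact abs_arg_le_pi w
  calc |(H w).re - b * w.arg| ≤ |(H w).re| + |b * w.arg| := abs_sub _ _
    _ ≤ ‖H w‖ + |b| * π := add_le_add (abs_re_le_norm _) k7
    _ ≤ _ := by linarith

end Local

/-! ### Vanishing components and unmarked boundary points -/

section Components

variable {N : ℕ} [NeZero N] {p : ZMod N → ℂ} {Ω : Set ℂ}

/-- Since Im w = Re (-I w), both boundary problems take the common form Re (c i * w) = 0 and can be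
treated together. -/
theorem isF_iff {W : Set (ZMod N)} {q : ℂ} {f : ℂ → ℂ} :
    IsF p Ω W q f ↔ IsSolution p Ω W q lam (fun i w => (![1, -I] i * w).re) f := by
  have : (![fun w : ℂ => w.re, fun w => w.im] : Fin 2 → ℂ → ℝ)
      = fun i w => ((![1, -I] : Fin 2 → ℂ) i * w).re := by
    funext i w
    fin_cases i <;> simp
  rw [IsF, this]

theorem isG_iff {B : Set (ZMod N)} {q : ℂ} {g : ℂ → ℂ} :
    IsG p Ω B q g ↔ IsSolution p Ω B q I (fun i w => (![conj lam, lam] i * w).re) g := by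
  have : (![fun w : ℂ => (conj lam * w).re, fun w => (lam * w).re] : Fin 2 → ℂ → ℝ)
      = fun i w => ((![conj lam, lam] : Fin 2 → ℂ) i * w).re := by
    funext i w
    fin_cases i <;> simp
  rw [IsG, this]

/-- The point `bdry p s` is not a corner from the set `M`. -/
def Unmarked (M : Set (ZMod N)) (s : ℝ) : Prop := ∀ k : ℤ, s = k → (k : ZMod N) ∉ M

theorem unmarked_of_ne_intCast (M : Set (ZMod N)) {s : ℝ} (hs : ∀ k : ℤ, s ≠ k) : Unmarked M s :=
  fun k hk => (hs k hk).elim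

theorem Unmarked.bdry_not_mem_image {M : Set (ZMod N)} {s : ℝ} (h : Unmarked M s)
    (hΩ : IsPolygon p Ω) : bdry p s ∉ p '' M := by
  rintro ⟨m, hm, hms⟩
  have h1 : bdry p (m.val : ℤ) = bdry p s := by
    rw [bdry_intCast, ← hms]
    simp
  obtain ⟨n, hn⟩ := (bdry_eq_bdry_iff hΩ).1 h1
  refine h (m.val + n * N) (by rw [hn]; push_cast; ring) ?_
  simpa using hm

theorem Unmarked.eventually {M : Set (ZMod N)} {s : ℝ} (h : Unmarked M s) :
    ∀ᶠ s' in 𝓝 s, Unmarked M s' := by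
  have h1 : (⌈s⌉ : ℝ) - 1 < s := by linarith [Int.ceil_lt_add_one s]
  filter_upwards [lt_mem_nhds h1, gt_mem_nhds (Int.lt_floor_add_one s)] with s' h2 h3 k hk
  have h4 : ⌈s⌉ ≤ k := by
    have : ((⌈s⌉ - 1 : ℤ) : ℝ) < k := by push_cast; rwa [← hk]
    have := Int.cast_lt.1 this
    omega
  have h5 : k ≤ ⌊s⌋ := by
    have : (k : ℝ) < ((⌊s⌋ + 1 : ℤ) : ℝ) := by push_cast; rwa [← hk]
    have := Int.cast_lt.1 this
    omega
  refine h k (le_antisymm ?_ ?_)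
  · exact (Int.le_ceil s).trans (by exact_mod_cast h4)
  · exact le_trans (by exact_mod_cast h5) (Int.floor_le s)

/-- The vanishing component does not change at an unmarked point. -/
theorem Unmarked.eventually_floor {M : Set (ZMod N)} {s : ℝ} (h : Unmarked M s)
    {τ : ZMod N → Fin 2} (hτ : ∀ k, τ (k - 1) ≠ τ k ↔ k ∈ M) :
    ∀ᶠ s' in 𝓝 s, τ (⌊s'⌋ : ZMod N) = τ (⌊s⌋ : ZMod N) := by
  have h1 : (⌈s⌉ : ℝ) - 1 < s := by linarith [Int.ceil_lt_add_one s]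
  filter_upwards [lt_mem_nhds h1, gt_mem_nhds (Int.lt_floor_add_one s)] with s' h2 h3
  by_cases hs : ∀ k : ℤ, s ≠ k
  · have : ⌊s'⌋ = ⌊s⌋ := by
      rw [← floor_eq_ceil_sub_one hs, Int.floor_eq_iff]
      have := floor_eq_ceil_sub_one hs
      have e : (⌊s⌋ : ℝ) = ⌈s⌉ - 1 := by rw [← this]; push_cast; ring
      push_cast
      exact ⟨h2.le, by linarith⟩
    rw [this]
  · push Not at hs
    obtain ⟨k, rfl⟩ := hs
    rw [Int.ceil_intCast] at h2
    rw [Int.floor_intCast] at h3 ⊢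
    rcases lt_or_ge s' k with h4 | h4
    · have : ⌊s'⌋ = k - 1 := by
        rw [Int.floor_eq_iff]
        push_cast
        exact ⟨h2.le, by linarith⟩
      rw [this]
      have := h k rfl
      rw [← hτ, not_not] at this
      simpa using this
    · have : ⌊s'⌋ = k := by
        rw [Int.floor_eq_iff]
        exact ⟨h4, h3⟩
      rw [this]

theorem eventually_bdry_ne (hΩ : IsPolygon p Ω) (s t : ℝ) :
    ∀ᶠ s' in 𝓝[≠] s, bdry p s' ≠ bdry p t := by
  have hN : (0 : ℝ) < N := Nat.cast_pos.2 (NeZero.pos N)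
  rcases eq_or_ne (bdry p s) (bdry p t) with h | h
  · rw [← h]
    have h1 : s - N / 2 < s := by linarith
    have h2 : s < s - N / 2 + N := by linarith
    filter_upwards [nhdsWithin_le_nhds (lt_mem_nhds h1), nhdsWithin_le_nhds (gt_mem_nhds h2),
      self_mem_nhdsWithin] with s' h3 h4 h5 h6
    exact h5 (bdry_injOn_Ico hΩ _ ⟨h3.le, h4⟩ ⟨h1.le, h2⟩ h6)
  · exact nhdsWithin_le_nhds (((continuous_bdry p).continuousAt.eventually_ne h))

end Components

/-! ### Boundary conditions, residues and parity -/

section Solution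

variable {N : ℕ} [NeZero N] {p : ZMod N → ℂ} {Ω : Set ℂ} {M : Set (ZMod N)} {s₀ : ℝ} {r : ℂ}
  {c : Fin 2 → ℂ} {f : ℂ → ℂ} {τ : ZMod N → Fin 2}

/-- The boundary conditions in the problem `IsSolution`, for the components
`fun w => (c i * w).re`, with a given choice of the vanishing components. -/
structure HasBdryCond (p : ZMod N → ℂ) (Ω : Set ℂ) (M : Set (ZMod N)) (q : ℂ) (c : Fin 2 → ℂ)
    (f : ℂ → ℂ) (τ : ZMod N → Fin 2) : Prop where
  change : ∀ k, τ (k - 1) ≠ τ k ↔ k ∈ M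
  tendsto : ∀ s : ℝ, bdry p s ∉ p '' M → bdry p s ≠ q →
    Tendsto (fun z => (c (τ (⌊s⌋ : ZMod N)) * f z).re) (𝓝[Ω] (bdry p s)) (𝓝 0)

theorem IsSolution.exists_hasBdryCond {q : ℂ}
    (h : IsSolution p Ω M q r (fun i w => (c i * w).re) f) : ∃ τ, HasBdryCond p Ω M q c f τ := by
  obtain ⟨τ, h1, h2⟩ := h.boundary
  exact ⟨τ, h1, h2⟩

/-- The puncture allows `s` to be the pole itself, which is the case needed for the residue. -/
theorem HasBdryCond.eventually_punctured (h : HasBdryCond p Ω M (bdry p s₀) c f τ)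
    (hΩ : IsPolygon p Ω) {s : ℝ} (hs : Unmarked M s) :
    ∀ᶠ s' in 𝓝[≠] s, Tendsto (fun z => (c (τ (⌊s⌋ : ZMod N)) * f z).re) (𝓝[Ω] (bdry p s'))
      (𝓝 0) := by
  filter_upwards [nhdsWithin_le_nhds hs.eventually, eventually_bdry_ne hΩ s s₀,
    nhdsWithin_le_nhds (hs.eventually_floor h.change)] with s' h1 h2 h3
  rw [← h3]
  exact h.tendsto s' (h1.bdry_not_mem_image hΩ) h2

theorem HasBdryCond.eventually (h : HasBdryCond p Ω M (bdry p s₀) c f τ)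
    (hΩ : IsPolygon p Ω) {s : ℝ} (hs : Unmarked M s) (hs₀ : bdry p s ≠ bdry p s₀) :
    ∀ᶠ s' in 𝓝 s, Tendsto (fun z => (c (τ (⌊s⌋ : ZMod N)) * f z).re) (𝓝[Ω] (bdry p s'))
      (𝓝 0) := by
  have h1 := h.eventually_punctured hΩ hs
  rw [eventually_nhdsWithin_iff] at h1
  filter_upwards [h1] with s' h2
  rcases eq_or_ne s' s with rfl | h3
  · exact h.tendsto s' (hs.bdry_not_mem_image hΩ) hs₀
  · exact h2 h3

/-- The residue at the pole is compatible with the boundary condition. -/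
theorem HasBdryCond.re_residue_eq_zero (h : HasBdryCond p Ω M (bdry p s₀) c f τ)
    (hΩ : IsPolygon p Ω) (hs : ∀ k : ℤ, s₀ ≠ k)
    (hpole : (fun z => f z - r / (z - bdry p s₀)) =O[𝓝[Ω] (bdry p s₀)] (fun _ => (1 : ℝ))) :
    (c (τ (⌊s₀⌋ : ZMod N)) * (r / edge p (⌊s₀⌋ : ZMod N))).re = 0 := by
  set γ := c (τ (⌊s₀⌋ : ZMod N)) with hγ
  set κ := edge p (⌊s₀⌋ : ZMod N) with hκdef
  have hκ : κ ≠ 0 := edge_ne_zero hΩ _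
  obtain ⟨C, hC0, hC⟩ := hpole.exists_pos
  have hC1 := hC.bound
  have h1 : (⌊s₀⌋ : ℝ) < s₀ := lt_of_le_of_ne (Int.floor_le s₀) (hs _).symm
  have hfl : ∀ᶠ s' in 𝓝 s₀, bdry p s' = bdry p s₀ + ((s' - s₀ : ℝ) : ℂ) * κ := by
    filter_upwards [lt_mem_nhds h1, gt_mem_nhds (Int.lt_floor_add_one s₀)] with s' h2 h3
    rw [bdry_eq_of_mem_Icc p (k := ⌊s₀⌋) ⟨h2.le, h3.le⟩,
      bdry_eq_of_mem_Icc p (k := ⌊s₀⌋) ⟨h1.le, (Int.lt_floor_add_one s₀).le⟩]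
    push_cast
    ring
  have hev := (continuous_bdry p).continuousAt.eventually (eventually_nhds_nhdsWithin.2 hC1)
  -- On the side of the pole z - q = (s' - s₀) κ. There Re (γ f) tends to 0 and f differs from r /
  -- (z - q) by at most C, so Re (γ r / κ) / (s' - s₀) stays bounded.
  have hbound : ∀ᶠ s' in 𝓝[≠] s₀, |(γ * (r / κ)).re| ≤ ‖γ‖ * C * |s' - s₀| := by
    filter_upwards [h.eventually_punctured hΩ (unmarked_of_ne_intCast M hs),
      nhdsWithin_le_nhds hfl, nhdsWithin_le_nhds hev, self_mem_nhdsWithin] with s' h2 h3 h4 h5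
    have hne : s' - s₀ ≠ 0 := sub_ne_zero.2 h5
    have hne' : bdry p s' - bdry p s₀ ≠ 0 := by
      rw [h3, add_sub_cancel_left]
      exact mul_ne_zero (ofReal_ne_zero.2 hne) hκ
    have := nhdsWithin_bdry_neBot hΩ s'
    have hlim : Tendsto (fun z => |(γ * f z).re - (γ * (r / (z - bdry p s₀))).re|)
        (𝓝[Ω] (bdry p s')) (𝓝 |0 - (γ * (r / (bdry p s' - bdry p s₀))).re|) := by
      refine (h2.sub ?_).abs
      have : ContinuousAt (fun z => (γ * (r / (z - bdry p s₀))).re) (bdry p s') := by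
        refine continuous_re.continuousAt.comp (continuousAt_const.mul
          (continuousAt_const.div (by fun_prop) hne'))
      exact this.tendsto.mono_left nhdsWithin_le_nhds
    have hle := le_of_tendsto hlim (b := ‖γ‖ * C) (by
      filter_upwards [h4] with z hz
      rw [← sub_re, ← mul_sub]
      refine (abs_re_le_norm _).trans ?_
      rw [norm_mul]
      gcongr
      simpa using hz)
    have e : γ * (r / (bdry p s' - bdry p s₀)) = (γ * (r / κ)) / ((s' - s₀ : ℝ) : ℂ) := by
      rw [h3, add_sub_cancel_left]
      have : ((s' - s₀ : ℝ) : ℂ) ≠ 0 := ofReal_ne_zero.2 hne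
      field_simp
    rw [e, div_ofReal_re, zero_sub, abs_neg, abs_div, div_le_iff₀ (abs_pos.2 hne)] at hle
    exact hle
  have hlim0 : Tendsto (fun s' => ‖γ‖ * C * |s' - s₀|) (𝓝[≠] s₀) (𝓝 0) := by
    have : ContinuousAt (fun s' => ‖γ‖ * C * |s' - s₀|) s₀ := by fun_prop
    have h2 := this.tendsto.mono_left (nhdsWithin_le_nhds (s := {s₀}ᶜ))
    simpa using h2
  exact abs_nonpos_iff.1 (ge_of_tendsto hlim0 hbound)

/-- The parity of the number of marked corners on an arc tells whether the vanishing component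
is the same at both ends. -/
theorem even_ncard_marked_iff (hτ : ∀ k, τ (k - 1) ≠ τ k ↔ k ∈ M) (m : ℤ) (n : ℕ) :
    Even {j : ℤ | m < j ∧ j ≤ m + n ∧ (j : ZMod N) ∈ M}.ncard ↔
      τ ((m + n : ℤ) : ZMod N) = τ (m : ZMod N) := by
  induction n with
  | zero =>
    have : {j : ℤ | m < j ∧ j ≤ m + (0 : ℕ) ∧ (j : ZMod N) ∈ M} = ∅ := by
      ext j
      simp only [mem_ofPred_eq, mem_empty_iff_false, iff_false]
      intro h
      have := h.2.1
      push_cast at this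
      omega
    rw [this]
    simp
  | succ n ih =>
    have hstep := hτ ((m + (n + 1 : ℕ) : ℤ) : ZMod N)
    have hpred : ((m + (n + 1 : ℕ) : ℤ) : ZMod N) - 1 = ((m + n : ℤ) : ZMod N) := by
      push_cast
      ring
    rw [hpred] at hstep
    have hfin : {j : ℤ | m < j ∧ j ≤ m + n ∧ (j : ZMod N) ∈ M}.Finite :=
      (Set.finite_Ioc m (m + n)).subset fun j hj => ⟨hj.1, hj.2.1⟩
    by_cases hM : ((m + (n + 1 : ℕ) : ℤ) : ZMod N) ∈ M
    · have e : {j : ℤ | m < j ∧ j ≤ m + (n + 1 : ℕ) ∧ (j : ZMod N) ∈ M}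
          = insert (m + (n + 1 : ℕ) : ℤ) {j : ℤ | m < j ∧ j ≤ m + n ∧ (j : ZMod N) ∈ M} := by
        ext j
        simp only [mem_ofPred_eq, mem_insert_iff]
        constructor
        · rintro ⟨h1, h2, h3⟩
          by_cases hj : j = m + (n + 1 : ℕ)
          · exact Or.inl hj
          · push_cast at hj h2
            exact Or.inr ⟨h1, by omega, h3⟩
        · rintro (rfl | ⟨h1, h2, h3⟩)
          · exact ⟨by push_cast; omega, le_rfl, hM⟩
          · exact ⟨h1, by push_cast; omega, h3⟩
      rw [e, ncard_insert_of_notMem (fun h => by have := h.2.1; push_cast at this; omega) hfin,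
        Nat.even_add_one, ih]
      -- In `Fin 2`, if two elements differ, a third one equals exactly one of them.
      have := hstep.2 hM
      generalize τ ((m + (n + 1 : ℕ) : ℤ) : ZMod N) = x at *
      generalize τ ((m + n : ℤ) : ZMod N) = y at *
      generalize τ (m : ZMod N) = z at *
      revert this
      clear * -
      decide +revert
    · have e : {j : ℤ | m < j ∧ j ≤ m + (n + 1 : ℕ) ∧ (j : ZMod N) ∈ M}
          = {j : ℤ | m < j ∧ j ≤ m + n ∧ (j : ZMod N) ∈ M} := by
        ext j
        simp only [mem_ofPred_eq]
        constructor
        · rintro ⟨h1, h2, h3⟩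
          by_cases hj : j = m + (n + 1 : ℕ)
          · exact (hM (hj ▸ h3)).elim
          · push_cast at hj h2
            exact ⟨h1, by omega, h3⟩
        · rintro ⟨h1, h2, h3⟩
          exact ⟨h1, by push_cast; omega, h3⟩
      rw [e, ih, not_not.1 (mt hstep.1 hM)]

end Solution

/-! ### The form f g dz is imaginary along the whole boundary -/

section Direction

variable {N : ℕ} [NeZero N] {p : ZMod N → ℂ} {Ω : Set ℂ} {W : Set (ZMod N)}
  {τ σ : ZMod N → Fin 2}

/-- If `Re (c (τ k) * x) = 0` and `Re (d (σ k) * y) = 0` force `x * y * edge p k` to be imaginary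
for one side, then for all sides. -/
theorem exists_edge_eq (hΩ : IsPolygon p Ω) (hτ : ∀ k, τ (k - 1) ≠ τ k ↔ k ∈ W)
    (hσ : ∀ k, σ (k - 1) ≠ σ k ↔ k ∈ Wᶜ) {c d : Fin 2 → ℂ} (hc : c 1 = -I * c 0)
    (hd : d 1 = I * d 0) {k₀ : ZMod N}
    (h₀ : ∃ T : ℝ, edge p k₀ = I * T * (c (τ k₀) * d (σ k₀))) (k : ZMod N) :
    ∃ T : ℝ, edge p k = I * T * (c (τ k) * d (σ k)) := by
  -- Switching the component multiplies the coefficient by I up to a real factor, which is also what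
  -- a corner does to the side vector. As W and its complement share out the corners, exactly one
  -- coefficient switches each time.
  have hflip : ∀ (e : Fin 2 → ℂ) (ε : ℝ), ε ^ 2 = 1 → e 1 = ε * I * e 0 →
      ∀ i j : Fin 2, i ≠ j → ∃ t : ℝ, I * e i = t * e j := by
    intro e ε hε he i j hij
    have hε' : (ε : ℂ) ^ 2 = 1 := by exact_mod_cast hε
    fin_cases i <;> fin_cases j <;> simp only [ne_eq, not_true_eq_false] at hij
    · refine ⟨ε, ?_⟩
      simp only [Fin.zero_eta, Fin.mk_one, he]
      linear_combination -I * e 0 * hε'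
    · refine ⟨-ε, ?_⟩
      simp only [Fin.zero_eta, Fin.mk_one, he]
      push_cast
      linear_combination ε * e 0 * I_sq
  have hstep : ∀ k, (∃ T : ℝ, edge p (k - 1) = I * T * (c (τ (k - 1)) * d (σ (k - 1)))) →
      ∃ T : ℝ, edge p k = I * T * (c (τ k) * d (σ k)) := by
    rintro k ⟨T, hT⟩
    obtain ⟨a, ha, -⟩ := edge_succ_eq hΩ k
    by_cases hk : k ∈ W
    · have h2 : σ (k - 1) = σ k := not_not.1 (mt (hσ k).1 (fun h => h hk))
      obtain ⟨t, ht⟩ := hflip c (-1) (by norm_num) (by simpa using hc) _ _ ((hτ k).2 hk)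
      refine ⟨a * T * t, ?_⟩
      rw [ha, hT, h2]
      push_cast
      linear_combination a * I * T * d (σ k) * ht
    · have h2 : τ (k - 1) = τ k := not_not.1 (mt (hτ k).1 hk)
      obtain ⟨t, ht⟩ := hflip d 1 (by norm_num) (by simpa using hd) _ _ ((hσ k).2 hk)
      refine ⟨a * T * t, ?_⟩
      rw [ha, hT, h2]
      push_cast
      linear_combination a * I * T * c (τ k) * ht
  have hall : ∀ n : ℕ, ∃ T : ℝ,
      edge p (k₀ + n) = I * T * (c (τ (k₀ + n)) * d (σ (k₀ + n))) := by
    intro n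
    induction n with
    | zero => simpa using h₀
    | succ n ih =>
      have e : k₀ + ((n + 1 : ℕ) : ZMod N) - 1 = k₀ + (n : ZMod N) := by push_cast; ring
      exact hstep _ (e ▸ ih)
  have := hall (k - k₀).val
  simpa using this

/-- The condition on the colours and the pole residues imply that the differential `f g dz` is
imaginary along the boundary. -/
theorem re_mul_edge_eq_zero (hΩ : IsPolygon p Ω) {a b : ℝ} (hab : a < b)
    (ha : ∀ j : ℤ, a ≠ j) (hb : ∀ j : ℤ, b ≠ j)
    (hcol : Even {j : ℤ | a < j ∧ (j : ℝ) < b ∧ ((j : ℤ) : ZMod N) ∈ W}.ncard ↔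
      ∃ t : ℝ, edge p ((⌊b⌋ : ℤ) : ZMod N) = t * lam)
    {f g : ℂ → ℂ} (hf : IsSolution p Ω W (bdry p b) lam (fun i w => (![1, -I] i * w).re) f)
    (hg : IsSolution p Ω Wᶜ (bdry p a) I (fun i w => (![conj lam, lam] i * w).re) g)
    (hτ : HasBdryCond p Ω W (bdry p b) ![1, -I] f τ)
    (hσ : HasBdryCond p Ω Wᶜ (bdry p a) ![conj lam, lam] g σ) (k : ZMod N) (x y : ℂ)
    (hx : ((![1, -I] : Fin 2 → ℂ) (τ k) * x).re = 0)
    (hy : ((![conj lam, lam] : Fin 2 → ℂ) (σ k) * y).re = 0) :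
    (x * y * edge p k).re = 0 := by
  have hlam : lam ≠ 0 := left_ne_zero_of_mul (lam_mul_conj_lam.symm ▸ one_ne_zero)
  have him : ∀ {u κ : ℂ}, κ ≠ 0 → (u / κ).re = 0 → u ≠ 0 → ∃ t : ℝ, κ = t * (I * u) := by
    intro u κ hκ h hu
    have h1 : u / κ = (u / κ).im * I := by
      apply Complex.ext <;> simp [h]
    set t := (u / κ).im
    have ht : (t : ℂ) ≠ 0 := by
      intro h2
      rw [h2, zero_mul, div_eq_zero_iff] at h1
      tauto
    refine ⟨-t⁻¹, ?_⟩
    rw [div_eq_iff hκ] at h1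
    rw [h1]
    push_cast
    field_simp
    rw [I_sq]
    ring
  have hκb := edge_ne_zero hΩ (⌊b⌋ : ZMod N)
  have hκa := edge_ne_zero hΩ (⌊a⌋ : ZMod N)
  have hpb := hτ.re_residue_eq_zero hΩ hb hf.pole
  have hpa := hσ.re_residue_eq_zero hΩ ha hg.pole
  have hcount : Even {j : ℤ | a < j ∧ (j : ℝ) < b ∧ ((j : ℤ) : ZMod N) ∈ W}.ncard ↔
      τ (⌊b⌋ : ZMod N) = τ (⌊a⌋ : ZMod N) := by
    have hle : ⌊a⌋ ≤ ⌊b⌋ := Int.floor_le_floor hab.le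
    obtain ⟨n, hn⟩ := Int.le.dest hle
    rw [← hn, ← even_ncard_marked_iff hτ.change, hn]
    have : {j : ℤ | a < j ∧ (j : ℝ) < b ∧ ((j : ℤ) : ZMod N) ∈ W}
        = {j : ℤ | ⌊a⌋ < j ∧ j ≤ ⌊b⌋ ∧ ((j : ℤ) : ZMod N) ∈ W} := by
      ext j
      simp only [mem_ofPred_eq, Int.floor_lt, Int.le_floor]
      rw [(show ((j : ℝ) < b ↔ (j : ℝ) ≤ b) from
        ⟨le_of_lt, fun h => lt_of_le_of_ne h (hb j).symm⟩)]
    rw [this]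
  -- The residue lam makes Im f vanish at v₀ if that side is parallel to lam, and Re f otherwise.
  -- The number of switches between the two sides is even in the first case and odd in the second,
  -- so Im f vanishes at u₀ in both.
  have hτa : τ (⌊a⌋ : ZMod N) = 1 := by
    rw [hcount] at hcol
    have hfin : ∀ i : Fin 2, i = 0 ∨ i = 1 := by decide
    rcases hfin (τ (⌊b⌋ : ZMod N)) with h | h
    · have hnot : ¬ ∃ t : ℝ, edge p ((⌊b⌋ : ℤ) : ZMod N) = t * lam := by
        rintro ⟨t, ht⟩
        rw [h, ht] at hpb
        have ht0 : (t : ℂ) ≠ 0 := by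
          rintro h0
          rw [ht, h0, zero_mul] at hκb
          exact hκb rfl
        have e : lam / (t * lam) = ((t⁻¹ : ℝ) : ℂ) := by
          push_cast
          field_simp
        rw [e] at hpb
        have : t⁻¹ = 0 := by simpa using hpb
        rw [inv_eq_zero] at this
        exact ht0 (by exact_mod_cast this)
      rw [← hcol, h] at hnot
      exact (hfin _).resolve_left fun h1 => hnot h1.symm
    · obtain ⟨t, ht⟩ := him (u := -I * lam) hκb (by
        rw [h] at hpb
        rw [mul_div_assoc]
        simpa using hpb) (mul_ne_zero (neg_ne_zero.2 I_ne_zero) hlam)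
      have : τ (⌊b⌋ : ZMod N) = τ (⌊a⌋ : ZMod N) := hcol.2 ⟨t, by
        rw [ht]
        linear_combination -t * lam * I_sq⟩
      rw [← this, h]
  have hne : ∀ i : Fin 2, (![conj lam, lam] : Fin 2 → ℂ) i ≠ 0 := by
    intro i
    fin_cases i
    · simpa using hlam
    · simpa using hlam
  -- The residue I of g makes the side of u₀ a real multiple of the coefficient of g; with
  -- coefficient -I for f this is the required relation.
  have h₀ : ∃ T : ℝ, edge p (⌊a⌋ : ZMod N) = I * T * ((![1, -I] : Fin 2 → ℂ) (τ (⌊a⌋ : ZMod N)) *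
      (![conj lam, lam] : Fin 2 → ℂ) (σ (⌊a⌋ : ZMod N))) := by
    obtain ⟨t, ht⟩ := him hκa (by rwa [← mul_div_assoc] at hpa) (mul_ne_zero (hne _) I_ne_zero)
    refine ⟨-t, ?_⟩
    rw [hτa, ht]
    simp only [Matrix.cons_val_one, Matrix.cons_val_fin_one]
    push_cast
    ring
  obtain ⟨T, hT⟩ := exists_edge_eq hΩ hτ.change hσ.change (by simp)
    (by simpa using lam_eq) h₀ k
  have e : x * y * edge p k = I * T * (((![1, -I] : Fin 2 → ℂ) (τ k) * x) *
      ((![conj lam, lam] : Fin 2 → ℂ) (σ k) * y)) := by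
    rw [hT]
    ring
  have him' : ∀ u : ℂ, u.re = 0 → u = u.im * I := by
    intro u hu
    apply Complex.ext <;> simp [hu]
  rw [e, him' _ hx, him' _ hy]
  simp

end Direction

/-! ### Limits of the primitive at the corners -/

section Limits

variable {N : ℕ} [NeZero N] {p : ZMod N → ℂ} {Ω : Set ℂ} {M : Set (ZMod N)}

theorem SemiBoundedNear.neg {ζ : ℂ} {u : ℂ → ℝ} (h : SemiBoundedNear Ω ζ u) :
    SemiBoundedNear Ω ζ (fun z => -u z) := by
  rcases h with ⟨C, h⟩ | ⟨C, h⟩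
  · exact Or.inr ⟨-C, h.mono fun z hz => neg_le_neg hz⟩
  · exact Or.inl ⟨-C, h.mono fun z hz => neg_le_neg hz⟩

/-- At a corner which is marked for `φ` and not for `ψ`, the primitive of `φ ψ` has a limit. -/
theorem exists_tendsto_primitive_corner (hΩ : IsPolygon p Ω) {φ ψ G : ℂ → ℂ}
    (hG : ∀ z ∈ Ω, HasDerivAt G (φ z * ψ z) z) {q r : ℂ} {c d : Fin 2 → ℂ} {σ : ZMod N → Fin 2}
    {t : ℝ} (hφ : IsSolution p Ω M q r (fun i w => (c i * w).re) φ) (hc : c 0 ≠ 0)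
    (hc' : c 1 = I * c 0 ∨ c 1 = -I * c 0) (hψ : DifferentiableOn ℂ ψ Ω)
    (hσ : HasBdryCond p Ω Mᶜ (bdry p t) d ψ σ) (hd : ∀ i, d i ≠ 0) {k : ℤ}
    (hk : (k : ZMod N) ∈ M) (hkt : bdry p k ≠ bdry p t) :
    ∃ L, Tendsto G (𝓝[Ω] (bdry p k)) (𝓝 L) := by
  obtain ⟨α, h⟩ := exists_isBdryChart hΩ (k : ℝ)
  -- The corner has only one colour, so ψ keeps its vanishing component there and extends by
  -- reflection.
  have hun : Unmarked Mᶜ (k : ℝ) := by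
    intro j hj
    rw [← Int.cast_injective hj]
    exact fun h => h hk
  obtain ⟨K, -, r₀, hr₀, hb⟩ := h.exists_norm_mul_deriv_le hΩ.isOpen hφ.holomorphic rfl
    (fun h1 => by
      rw [bdry_intCast]
      exact hφ.convex _ hk h1) hc
    (fun h1 => by
      rw [bdry_intCast]
      refine ⟨hφ.concave _ hk h1 0, ?_⟩
      have h2 := hφ.concave _ hk h1 1
      rcases hc' with h3 | h3
      · convert h2.neg using 2 with z
        rw [h3, mul_assoc, I_mul_re, neg_neg]
      · convert h2 using 2 with z
        rw [h3, neg_mul, neg_mul, mul_assoc, neg_re, I_mul_re, neg_neg])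
  obtain ⟨r₁, hr₁, ψ₁, hψ₁, hψψ, -⟩ := h.exists_extension hΩ.isOpen hψ (hd _)
    (hσ.eventually hΩ hun hkt)
  have hcont : ContinuousAt ψ₁ 0 :=
    (hψ₁.differentiableAt (Metric.ball_mem_nhds 0 hr₁)).continuousAt
  refine h.exists_tendsto_primitive hG hr₀ hb (M := ‖ψ₁ 0‖ + 1) ?_
  filter_upwards [halfDisc_mem_nhdsWithin (r := r₁) (w := 0) (by simpa using hr₁),
    nhdsWithin_le_nhds (hcont.norm.eventually (gt_mem_nhds (lt_add_one _)))] with w h1 h2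
  rw [← (hψψ w h1).2]
  exact h2.le

end Limits

/-! ### From local to global: boundedness, constancy on arcs, non-vanishing -/

/-- A real function is locally bounded near the closure of a bounded set, hence bounded on it. -/
theorem exists_abs_le_of_locally {Ω : Set ℂ} (hb : Bornology.IsBounded Ω) {u : ℂ → ℝ}
    (h : ∀ ζ ∈ closure Ω, ∃ C : ℝ, ∀ᶠ z in 𝓝[Ω] ζ, |u z| ≤ C) : ∃ C : ℝ, ∀ z ∈ Ω, |u z| ≤ C := by
  have key := hb.isCompact_closure.induction_on
    (p := fun t => ∃ C : ℝ, ∀ z ∈ t, z ∈ Ω → |u z| ≤ C) ⟨0, by simp⟩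
    (fun s t hst ⟨C, hC⟩ => ⟨C, fun z hz => hC z (hst hz)⟩)
    (fun s t ⟨C, hC⟩ ⟨D, hD⟩ => ⟨max C D, fun z hz hzΩ => hz.elim
      (fun h => (hC z h hzΩ).trans (le_max_left _ _))
      fun h => (hD z h hzΩ).trans (le_max_right _ _)⟩)
    (fun ζ hζ => by
      obtain ⟨C, hC⟩ := h ζ hζ
      rw [eventually_nhdsWithin_iff] at hC
      exact ⟨_, nhdsWithin_le_nhds hC, C, fun z hz => hz⟩)
  obtain ⟨C, hC⟩ := key
  exact ⟨C, fun z hz => hC z (subset_closure hz) hz⟩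

/-- A function on an open interval with limits along `bdry p` that are locally constant off the
integers is constant. -/
theorem exists_tendsto_const {N : ℕ} [NeZero N] {p : ZMod N → ℂ} {Ω : Set ℂ}
    (hΩ : IsPolygon p Ω) {u : ℂ → ℝ} {x y : ℝ}
    (h1 : ∀ s ∈ Ioo x y, ∃ L, Tendsto u (𝓝[Ω] (bdry p s)) (𝓝 L))
    (h2 : ∀ s ∈ Ioo x y, (∀ k : ℤ, s ≠ k) →
      ∃ L, ∀ᶠ s' in 𝓝 s, Tendsto u (𝓝[Ω] (bdry p s')) (𝓝 L)) :
    ∃ L, ∀ s ∈ Ioo x y, Tendsto u (𝓝[Ω] (bdry p s)) (𝓝 L) := by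
  rcases (Ioo x y).eq_empty_or_nonempty with he | ⟨s₀, hs₀⟩
  · exact ⟨0, by simp [he]⟩
  have hne := fun s => nhdsWithin_bdry_neBot hΩ s
  -- The boundary value is continuous along the arc, corners included, and has zero derivative off
  -- the countable set of integers; hence it is constant.
  set H : ℝ → ℝ := fun s => extendFrom Ω u (bdry p s) with hH
  have hval : ∀ {s L}, Tendsto u (𝓝[Ω] (bdry p s)) (𝓝 L) → H s = L := fun {s L} h =>
    haveI := hne s
    extendFrom_eq (mem_closure_iff_nhdsWithin_neBot.2 (hne s)) h
  have hcont : ContinuousOn H (Ioo x y) := by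
    have := continuousOn_extendFrom (A := Ω) (B := bdry p '' Ioo x y) (f := u)
      (by
        rintro _ ⟨s, -, rfl⟩
        exact mem_closure_iff_nhdsWithin_neBot.2 (hne s))
      (by
        rintro _ ⟨s, hs, rfl⟩
        exact h1 s hs)
    exact this.comp (continuous_bdry p).continuousOn (mapsTo_image _ _)
  have hder : ∀ s ∈ Ioo x y, s ∉ range (fun k : ℤ => (k : ℝ)) → HasDerivAt H 0 s := by
    intro s hs hsk
    obtain ⟨L, hL⟩ := h2 s hs fun k hk => hsk ⟨k, hk.symm⟩
    exact (hasDerivAt_const s L).congr_of_eventuallyEq (hL.mono fun s' h => hval h)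
  refine ⟨H s₀, fun s hs => ?_⟩
  have hsub : uIcc s₀ s ⊆ Ioo x y := (convex_Ioo x y).ordConnected.uIcc_subset hs₀ hs
  have := integral_eq_of_hasDerivAt_off_countable H (fun _ => 0)
    (countable_range (fun k : ℤ => (k : ℝ))) (hcont.mono hsub)
    (fun t ht => hder t (hsub (uIoo_subset_uIcc_self ht.1)) ht.2)
    (by simp)
  rw [intervalIntegral.integral_zero] at this
  obtain ⟨L, hL⟩ := h1 s hs
  have h3 := hval hL
  have : H s₀ = L := by linarith
  rwa [this]

/-- If f were zero, multiplying the bounded difference by z - q would show that the constant -r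
tends to 0. -/
theorem ne_zero_of_residue {Ω : Set ℂ} {q r : ℂ} (hr : r ≠ 0) [(𝓝[Ω] q).NeBot] (hq : q ∉ Ω)
    {f : ℂ → ℂ} (hf : (fun z => f z - r / (z - q)) =O[𝓝[Ω] q] (fun _ => (1 : ℝ))) :
    ¬ ∀ z ∈ Ω, f z = 0 := by
  intro h
  have h1 : Tendsto (fun z : ℂ => z - q) (𝓝[Ω] q) (𝓝 0) := by
    have : ContinuousAt (fun z : ℂ => z - q) q := by fun_prop
    have := this.tendsto.mono_left (nhdsWithin_le_nhds (s := Ω))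
    simpa using this
  have h2 := (hf.mul_isLittleO ((isLittleO_one_iff ℝ).2 h1)).congr_right (fun _ => one_mul (1 : ℝ))
  have h3 : Tendsto (fun _ : ℂ => -r) (𝓝[Ω] q) (𝓝 0) := by
    refine ((isLittleO_one_iff ℝ).1 h2).congr' ?_
    filter_upwards [self_mem_nhdsWithin] with z hz
    have : z - q ≠ 0 := sub_ne_zero.2 fun h => hq (h ▸ hz)
    rw [h z hz]
    field_simp
    ring
  exact hr (neg_eq_zero.1 (tendsto_nhds_unique tendsto_const_nhds h3))

/-- The real differential of Re G is v ↦ Re (F v); its values at 1 and I are Re F and -Im F. -/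
theorem eq_zero_of_re_primitive_eq_zero {Ω : Set ℂ} (hΩ : IsOpen Ω) {F G : ℂ → ℂ}
    (hG : ∀ z ∈ Ω, HasDerivAt G (F z) z) (h : ∀ z ∈ Ω, (G z).re = 0) : ∀ z ∈ Ω, F z = 0 := by
  intro z hz
  have h1 := reCLM.hasFDerivAt.comp z ((hG z hz).hasFDerivAt.restrictScalars ℝ)
  have h2 : HasFDerivAt (fun z => (G z).re) (0 : ℂ →L[ℝ] ℝ) z :=
    (hasFDerivAt_const (0 : ℝ) z).congr_of_eventuallyEq
      (by filter_upwards [hΩ.mem_nhds hz] with w hw using h w hw)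
  have h3 := h1.unique h2
  have e1 := congrArg (fun L : ℂ →L[ℝ] ℝ => L 1) h3
  have e2 := congrArg (fun L : ℂ →L[ℝ] ℝ => L I) h3
  apply Complex.ext
  · simpa using e1
  · simpa using e2

/-! ### The primitive of f g as a multiple of the harmonic measure -/

section Main

variable {N : ℕ} [NeZero N] {p : ZMod N → ℂ} {Ω : Set ℂ} {W : Set (ZMod N)} {a b : ℝ}

theorem harmonicOnNhd_re_primitive (hΩ : IsOpen Ω) {F G : ℂ → ℂ}
    (hG : ∀ z ∈ Ω, HasDerivAt G (F z) z) :
    InnerProductSpace.HarmonicOnNhd (fun z => (G z).re) Ω := fun _ hz =>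
  AnalyticAt.harmonicAt_re (DifferentiableOn.analyticAt (s := Ω)
    (fun w hw => (hG w hw).differentiableAt.differentiableWithinAt) (hΩ.mem_nhds hz))

/-- The boundary points other than `bdry p a`, `bdry p b` lie on two open arcs. -/
theorem bdry_mem_arcs (hΩ : IsPolygon p Ω) {ζ : ℂ} (hζ : ζ ∈ frontier Ω)
    (ha : ζ ≠ bdry p a) (hb : ζ ≠ bdry p b) :
    (∃ s ∈ Ioo a b, bdry p s = ζ) ∨ ∃ s ∈ Ioo b (a + N), bdry p s = ζ := by
  rw [hΩ.frontier_eq] at hζ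
  obtain ⟨t, rfl⟩ := hζ
  obtain ⟨n, hn⟩ := exists_bdry_mem_Ico (N := N) t a
  rw [← bdry_add_int_mul p t n] at ha hb ⊢
  set s := t + n * N
  have h1 : a < s := lt_of_le_of_ne hn.1 fun h => ha (h ▸ rfl)
  rcases lt_trichotomy s b with h | h | h
  · exact Or.inl ⟨s, ⟨h1, h⟩, rfl⟩
  · exact (hb (h ▸ rfl)).elim
  · exact Or.inr ⟨s, ⟨h, hn.2⟩, rfl⟩

/-- The real part of the primitive of `f g` is a non-zero multiple of the harmonic measure. -/
theorem exists_primitive_mul (hΩ : IsPolygon p Ω) (hab : a < b) (hba : b < a + N)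
    (ha : ∀ j : ℤ, a ≠ j) (hb : ∀ j : ℤ, b ≠ j)
    (hcol : Even {j : ℤ | a < j ∧ (j : ℝ) < b ∧ ((j : ℤ) : ZMod N) ∈ W}.ncard ↔
      ∃ t : ℝ, edge p ((⌊b⌋ : ℤ) : ZMod N) = t * lam)
    {f g : ℂ → ℂ} (hf : IsF p Ω W (bdry p b) f) (hg : IsG p Ω Wᶜ (bdry p a) g) :
    ∃ G : ℂ → ℂ, ∃ c : ℝ, c ≠ 0 ∧ (∀ z ∈ Ω, HasDerivAt G (f z * g z) z) ∧
      (∃ C : ℝ, ∀ z ∈ Ω, |(G z).re| ≤ C) ∧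
      (∀ s ∈ Ioo a b, Tendsto (fun z => (G z).re) (𝓝[Ω] (bdry p s)) (𝓝 0)) ∧
      ∀ s ∈ Ioo b (a + N), Tendsto (fun z => (G z).re) (𝓝[Ω] (bdry p s)) (𝓝 c) := by
  rw [isF_iff] at hf
  rw [isG_iff] at hg
  have hlam : lam ≠ 0 := left_ne_zero_of_mul (lam_mul_conj_lam.symm ▸ one_ne_zero)
  obtain ⟨τ, hτ⟩ := hf.exists_hasBdryCond
  obtain ⟨σ, hσ⟩ := hg.exists_hasBdryCond
  have key := re_mul_edge_eq_zero hΩ hab ha hb hcol hf hg hτ hσ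
  have hc : ∀ i : Fin 2, (![1, -I] : Fin 2 → ℂ) i ≠ 0 := by
    intro i
    fin_cases i <;> simp
  have hd : ∀ i : Fin 2, (![conj lam, lam] : Fin 2 → ℂ) i ≠ 0 := by
    intro i
    fin_cases i <;> simpa using hlam
  have := hΩ.simplyConnected
  obtain ⟨G, hG⟩ := exists_primitive hΩ.isOpen (hf.holomorphic.mul hg.holomorphic)
  replace hG : ∀ z ∈ Ω, HasDerivAt G (f z * g z) z := hG
  have hG' : ∀ z ∈ Ω, HasDerivAt G (g z * f z) z := fun z hz => by
    rw [mul_comm]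
    exact hG z hz
  have hinj := bdry_injOn_Ico hΩ a
  have hma : a ∈ Ico a (a + N) := ⟨le_rfl, hab.trans hba⟩
  have hmb : b ∈ Ico a (a + N) := ⟨hab.le, hba⟩
  have hgood1 : ∀ s ∈ Ioo a b, bdry p s ≠ bdry p a ∧ bdry p s ≠ bdry p b := fun s hs =>
    ⟨fun h => hs.1.ne' (hinj ⟨hs.1.le, hs.2.trans hba⟩ hma h),
      fun h => hs.2.ne (hinj ⟨hs.1.le, hs.2.trans hba⟩ hmb h)⟩
  have hgood2 : ∀ s ∈ Ioo b (a + N), bdry p s ≠ bdry p a ∧ bdry p s ≠ bdry p b := fun s hs =>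
    ⟨fun h => (hab.trans hs.1).ne' (hinj ⟨(hab.trans hs.1).le, hs.2⟩ hma h),
      fun h => hs.1.ne' (hinj ⟨(hab.trans hs.1).le, hs.2⟩ hmb h)⟩
  have hside : ∀ s, bdry p s ≠ bdry p a ∧ bdry p s ≠ bdry p b → (∀ k : ℤ, s ≠ k) →
      ∃ L, ∀ᶠ s' in 𝓝 s, Tendsto (fun z => (G z).re) (𝓝[Ω] (bdry p s')) (𝓝 L) := by
    intro s hs hsk
    obtain ⟨α, h⟩ := exists_isBdryChart hΩ s
    obtain rfl := h.eq_one hsk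
    exact h.exists_tendsto_re_primitive hΩ hsk hG hf.holomorphic hg.holomorphic (hc _) (hd _)
      (hτ.eventually hΩ (unmarked_of_ne_intCast _ hsk) hs.2)
      (hσ.eventually hΩ (unmarked_of_ne_intCast _ hsk) hs.1) (key _)
  have hlimit : ∀ s, bdry p s ≠ bdry p a ∧ bdry p s ≠ bdry p b →
      ∃ L, Tendsto (fun z => (G z).re) (𝓝[Ω] (bdry p s)) (𝓝 L) := by
    intro s hs
    by_cases hsk : ∀ k : ℤ, s ≠ k
    · obtain ⟨L, hL⟩ := hside s hs hsk
      exact ⟨L, hL.self_of_nhds⟩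
    push Not at hsk
    obtain ⟨k, rfl⟩ := hsk
    -- White corners are marked for f and black ones for g, so the roles of f and g are exchanged.
    have : ∃ L, Tendsto G (𝓝[Ω] (bdry p k)) (𝓝 L) := by
      by_cases hk : (k : ZMod N) ∈ W
      · exact exists_tendsto_primitive_corner hΩ hG hf (hc 0) (Or.inr (by simp)) hg.holomorphic hσ
          hd hk hs.1
      · exact exists_tendsto_primitive_corner hΩ hG' hg (hd 0) (Or.inl (by simpa using lam_eq))
          hf.holomorphic ((compl_compl W).symm ▸ hτ) hc hk hs.2
    obtain ⟨L, hL⟩ := this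
    exact ⟨L.re, (continuous_re.tendsto L).comp hL⟩
  have hpole_b : ∃ C : ℝ, ∀ᶠ z in 𝓝[Ω] (bdry p b), |(G z).re| ≤ C := by
    obtain ⟨α, h⟩ := exists_isBdryChart hΩ b
    obtain rfl := h.eq_one hb
    refine h.exists_re_primitive_le hΩ hG hf.pole hg.holomorphic (hd _)
      (hσ.eventually hΩ (unmarked_of_ne_intCast _ hb) fun h => hab.ne' (hinj hmb hma h)) ?_
    intro y hy
    -- `key` is applied with residue / side vector in place of the value of f, which is admissible
    -- by `re_residue_eq_zero`; the side vector then cancels.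
    have h1 := key (⌊b⌋ : ZMod N) _ y (hτ.re_residue_eq_zero hΩ hb hf.pole) hy
    rwa [mul_right_comm, div_mul_cancel₀ _ (edge_ne_zero hΩ _)] at h1
  have hpole_a : ∃ C : ℝ, ∀ᶠ z in 𝓝[Ω] (bdry p a), |(G z).re| ≤ C := by
    obtain ⟨α, h⟩ := exists_isBdryChart hΩ a
    obtain rfl := h.eq_one ha
    refine h.exists_re_primitive_le hΩ hG' hg.pole hf.holomorphic (hc _)
      (hτ.eventually hΩ (unmarked_of_ne_intCast _ ha) fun h => hab.ne (hinj hma hmb h)) ?_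
    intro x hx
    have h1 := key (⌊a⌋ : ZMod N) x _ hx (hσ.re_residue_eq_zero hΩ ha hg.pole)
    rwa [mul_assoc, div_mul_cancel₀ _ (edge_ne_zero hΩ _), mul_comm] at h1
  obtain ⟨C, hC⟩ : ∃ C : ℝ, ∀ z ∈ Ω, |(G z).re| ≤ C := by
    refine exists_abs_le_of_locally hΩ.isBounded fun ζ hζ => ?_
    have hlim : ∀ L, Tendsto (fun z => (G z).re) (𝓝[Ω] ζ) (𝓝 L) →
        ∃ C : ℝ, ∀ᶠ z in 𝓝[Ω] ζ, |(G z).re| ≤ C := fun L hL =>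
      ⟨|L| + 1, (hL.abs.eventually (gt_mem_nhds (lt_add_one _))).mono fun _ h => h.le⟩
    by_cases hζΩ : ζ ∈ Ω
    · exact hlim (G ζ).re ((continuous_re.continuousAt.comp
        (hG ζ hζΩ).continuousAt).tendsto.mono_left nhdsWithin_le_nhds)
    have hfr : ζ ∈ frontier Ω := by
      rw [hΩ.isOpen.frontier_eq]
      exact ⟨hζ, hζΩ⟩
    rw [hΩ.frontier_eq] at hfr
    obtain ⟨s, rfl⟩ := hfr
    by_cases h1 : bdry p s = bdry p a
    · rwa [h1]
    by_cases h2 : bdry p s = bdry p b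
    · rwa [h2]
    obtain ⟨L, hL⟩ := hlimit s ⟨h1, h2⟩
    exact hlim L hL
  obtain ⟨L₁, hL₁⟩ := exists_tendsto_const hΩ (fun s hs => hlimit s (hgood1 s hs))
    fun s hs => hside s (hgood1 s hs)
  obtain ⟨L₂, hL₂⟩ := exists_tendsto_const hΩ (fun s hs => hlimit s (hgood2 s hs))
    fun s hs => hside s (hgood2 s hs)
  have hd0 : ∀ z ∈ Ω, HasDerivAt (fun z => G z - L₁) (f z * g z) z := fun z hz =>
    (hG z hz).sub_const _
  have hzero : ∀ s ∈ Ioo a b,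
      Tendsto (fun z => (G z - L₁).re) (𝓝[Ω] (bdry p s)) (𝓝 0) := fun s hs => by
    simpa using (hL₁ s hs).sub_const L₁
  have hother : ∀ s ∈ Ioo b (a + N),
      Tendsto (fun z => (G z - L₁).re) (𝓝[Ω] (bdry p s)) (𝓝 (L₂ - L₁)) := fun s hs => by
    simpa using (hL₂ s hs).sub_const L₁
  have hbound : ∀ z ∈ Ω, |(G z - L₁).re| ≤ C + |L₁| := fun z hz => by
    rw [sub_re, ofReal_re]
    exact (abs_sub _ _).trans (by linarith [hC z hz])
  -- If the two constants agreed, the maximum principle would give Re (G - L₁) = 0, hence f g = 0,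
  -- and the identity theorem on the connected Ω would make f or g vanish, against its pole.
  refine ⟨fun z => G z - L₁, L₂ - L₁, fun h0 => ?_, hd0, ⟨_, hbound⟩, hzero, hother⟩
  rw [h0] at hother
  have hG0 := harmonic_eq_zero_of_tendsto_zero hΩ.isOpen hΩ.isBounded
    (harmonicOnNhd_re_primitive hΩ.isOpen hd0) hbound (bdry_not_mem hΩ a) (bdry_not_mem hΩ b)
    (fun ζ hζ h1 h2 => by
      rcases bdry_mem_arcs hΩ hζ h1 h2 with ⟨s, hs, rfl⟩ | ⟨s, hs, rfl⟩
      · exact hzero s hs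
      · exact hother s hs)
  have hF0 := eq_zero_of_re_primitive_eq_zero hΩ.isOpen hd0 hG0
  have hconn : IsPreconnected Ω := isPreconnected_iff_preconnectedSpace.2 inferInstance
  have := nhdsWithin_bdry_neBot hΩ a
  have := nhdsWithin_bdry_neBot hΩ b
  rcases AnalyticOnNhd.eq_zero_or_eq_zero_of_mul_eq_zero
    (hf.holomorphic.analyticOnNhd hΩ.isOpen) (hg.holomorphic.analyticOnNhd hΩ.isOpen) hF0 hconn
    with h | h
  · exact ne_zero_of_residue hlam (bdry_not_mem hΩ b) hf.pole h
  · exact ne_zero_of_residue I_ne_zero (bdry_not_mem hΩ a) hg.pole h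

end Main

/-! ### Improper line integrals through the primitive -/

/-- The line integral `∫_γ Re[F dz]` from a boundary point where the real part of the primitive
`G` of `F` tends to `0`. -/
theorem hasReLineIntegral_of_primitive {Ω : Set ℂ} {F G : ℂ → ℂ}
    (hF : DifferentiableOn ℂ F Ω) (hG : ∀ z ∈ Ω, HasDerivAt G (F z) z) {a w : ℂ}
    (ha : Tendsto (fun z => (G z).re) (𝓝[Ω] a) (𝓝 0)) {γ : ℝ → ℂ} (hγ : IsPathFrom Ω a w γ) :
    HasReLineIntegral F γ (G w).re := by
  obtain ⟨S, hS, hdiff⟩ := hγ.differentiable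
  have hint : ∀ ε ∈ Ioo (0 : ℝ) 1,
      ∫ t in ε..1, (F (γ t) * deriv γ t).re = (G w).re - (G (γ ε)).re := by
    intro ε hε
    have hsub : Icc ε 1 ⊆ Ioc (0 : ℝ) 1 := fun t ht => ⟨hε.1.trans_le ht.1, ht.2⟩
    have hcγ : ContinuousOn γ (Icc ε 1) := hγ.continuousOn.mono (Icc_subset_Icc hε.1.le le_rfl)
    have hmaps : MapsTo γ (Icc ε 1) Ω := fun t ht => hγ.mem t (hsub ht)
    have hcG : ContinuousOn (fun t => (G (γ t)).re) (Icc ε 1) :=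
      continuous_re.comp_continuousOn (ContinuousOn.comp
        (fun z hz => (hG z hz).continuousAt.continuousWithinAt) hcγ hmaps)
    have hder : ∀ t ∈ Ioo ε 1 \ S,
        HasDerivAt (fun t => (G (γ t)).re) (F (γ t) * deriv γ t).re t := by
      intro t ht
      have h1 := (hdiff t ⟨⟨hε.1.trans ht.1.1, ht.1.2⟩, ht.2⟩).hasDerivAt
      have h2 := (hG (γ t) (hmaps ⟨ht.1.1.le, ht.1.2.le⟩)).comp_of_eq t h1 rfl
      exact reCLM.hasFDerivAt.comp_hasDerivAt t h2
    have hii : IntervalIntegrable (fun t => F (γ t) * deriv γ t) volume ε 1 := by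
      refine (hγ.integrable ε hε).continuousOn_mul ?_
      rw [uIcc_of_le hε.2.le]
      exact hF.continuousOn.comp hcγ hmaps
    have hre : IntervalIntegrable (fun t => (F (γ t) * deriv γ t).re) volume ε 1 :=
      ⟨hii.1.re, hii.2.re⟩
    rw [integral_eq_of_hasDerivAt_off_countable_of_le _ _ hε.2.le hS.countable hcG hder hre,
      hγ.target]
  have hlim : Tendsto γ (𝓝[>] 0) (𝓝[Ω] a) := by
    refine tendsto_nhdsWithin_iff.2 ⟨?_, ?_⟩
    · have h1 := hγ.continuousOn 0 ⟨le_rfl, zero_le_one⟩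
      rw [ContinuousWithinAt, hγ.source] at h1
      exact h1.mono_left (nhdsWithin_le_of_mem (Icc_mem_nhdsGT one_pos))
    · filter_upwards [Ioc_mem_nhdsGT (zero_lt_one (α := ℝ))] with t ht using hγ.mem t ht
  have h2 : Tendsto (fun ε => (G w).re - (G (γ ε)).re) (𝓝[>] 0) (𝓝 (G w).re) := by
    simpa using (tendsto_const_nhds (x := (G w).re)).sub (ha.comp hlim)
  refine h2.congr' ?_
  filter_upwards [Ioo_mem_nhdsGT (zero_lt_one (α := ℝ))] with ε hε using (hint ε hε).symm

/-! ### Uniqueness of the harmonic measure -/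

section Uniqueness

variable {N : ℕ} [NeZero N] {p : ZMod N → ℂ} {Ω : Set ℂ} {a b : ℝ}

/-- The closure of the arc lies in the compact image of [b, a + N], whose end a + N is the point of
parameter a, and `s` differs from all of these. This makes the zero boundary condition available on
the whole complementary open arc. -/
theorem bdry_not_mem_closure_arc (hΩ : IsPolygon p Ω) (hba : b < a + N) {s : ℝ}
    (hs : s ∈ Ioo a b) : bdry p s ∉ closure (bdry p '' Ioo b (a + N)) := by
  intro h
  have h1 : closure (bdry p '' Ioo b (a + N)) ⊆ bdry p '' Icc b (a + N) :=
    closure_minimal (image_mono Ioo_subset_Icc_self)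
      (isCompact_Icc.image (continuous_bdry p)).isClosed
  obtain ⟨t, ht, hts⟩ := h1 h
  have hinj := bdry_injOn_Ico hΩ a
  have hsI : s ∈ Ico a (a + N) := ⟨hs.1.le, hs.2.trans hba⟩
  have hab := hs.1.trans hs.2
  rcases ht.2.eq_or_lt with rfl | h2
  · rw [bdry_add_period] at hts
    exact hs.1.ne (hinj ⟨le_rfl, hab.trans hba⟩ hsI hts)
  · exact (hs.2.trans_le ht.1).ne' (hinj ⟨hab.le.trans ht.1, h2⟩ hsI hts)

/-- The difference has boundary value 0 except perhaps at u₀ and v₀, the two points that the maximum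
principle ignores. -/
theorem IsHarmonicMeasure.eqOn (hΩ : IsPolygon p Ω) (hba : b < a + N) {h₁ h₂ : ℂ → ℝ}
    (h1 : IsHarmonicMeasure Ω (bdry p '' Ioo b (a + N)) h₁)
    (h2 : IsHarmonicMeasure Ω (bdry p '' Ioo b (a + N)) h₂) : EqOn h₁ h₂ Ω := by
  obtain ⟨C₁, hC₁⟩ := h1.bounded
  obtain ⟨C₂, hC₂⟩ := h2.bounded
  have key := harmonic_eq_zero_of_tendsto_zero hΩ.isOpen hΩ.isBounded
    (h1.harmonic.sub h2.harmonic) (C := C₁ + C₂)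
    (fun z hz => (abs_sub _ _).trans (add_le_add (hC₁ z hz) (hC₂ z hz)))
    (bdry_not_mem hΩ a) (bdry_not_mem hΩ b) (fun ζ hζ ha hb => by
      rcases bdry_mem_arcs hΩ hζ ha hb with ⟨s, hs, rfl⟩ | ⟨s, hs, rfl⟩
      · have hm := bdry_not_mem_closure_arc hΩ hba hs
        have := (h1.zero _ ⟨hζ, hm⟩).sub (h2.zero _ ⟨hζ, hm⟩)
        rwa [sub_zero] at this
      · have hm := mem_image_of_mem (bdry p) hs
        have := (h1.one _ hm).sub (h2.one _ hm)
        rwa [sub_self] at this)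
  exact fun z hz => sub_eq_zero.1 (key z hz)

end Uniqueness

end PolygonHM

/-! ### The theorem -/

theorem mainTheorem9 {N : ℕ} [NeZero N] (p : ZMod N → ℂ) (Ω : Set ℂ)
    (hΩ : PolygonHM.IsPolygon p Ω)
    -- the white corners; all other corners are black
    (W : Set (ZMod N))
    (hW : {k | k ∈ W ∧ PolygonHM.ConvexCorner p k}.ncard
      = {k | k ∈ W ∧ PolygonHM.ConcaveCorner p k}.ncard + 2)
    (hB : {k | k ∉ W ∧ PolygonHM.ConvexCorner p k}.ncard
      = {k | k ∉ W ∧ PolygonHM.ConcaveCorner p k}.ncard + 2)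
    -- `u₀ = bdry p a` and `v₀ = bdry p b` are distinct boundary points which are not corners;
    -- the arc `(u₀v₀)` is the image of `(a, b)`, the arc `(v₀u₀)` is the image of `(b, a + N)`
    (a b : ℝ) (hab : a < b) (hba : b < a + N)
    (ha : ∀ j : ℤ, a ≠ j) (hb : ∀ j : ℤ, b ≠ j)
    -- compatibility of the colours of the corners with the positions of `u₀` and `v₀`
    (hcol : Even {j : ℤ | a < j ∧ (j : ℝ) < b ∧ ((j : ℤ) : ZMod N) ∈ W}.ncard ↔
      ∃ t : ℝ, PolygonHM.edge p ((⌊b⌋ : ℤ) : ZMod N) = t * PolygonHM.lam)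
    (h0 : (0 : ℂ) ∈ PolygonHM.bdry p '' Ioo a b)
    (f g : ℂ → ℂ)
    (hf : PolygonHM.IsF p Ω W (PolygonHM.bdry p b) f)
    (hg : PolygonHM.IsG p Ω Wᶜ (PolygonHM.bdry p a) g) :
    ∃ hm : ℂ → ℝ,
      PolygonHM.IsHarmonicMeasure Ω (PolygonHM.bdry p '' Ioo b (a + N)) hm ∧
      (∀ h : ℂ → ℝ, PolygonHM.IsHarmonicMeasure Ω (PolygonHM.bdry p '' Ioo b (a + N)) h →
        EqOn h hm Ω) ∧
      ∃ c : ℝ, c ≠ 0 ∧ ∀ w ∈ Ω, ∀ γ : ℝ → ℂ, PolygonHM.IsPathFrom Ω 0 w γ →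
        PolygonHM.HasReLineIntegral (fun z => f z * g z) γ (c * hm w) := by
  obtain ⟨G, c, hc, hG, ⟨C, hC⟩, hzero, hone⟩ :=
    PolygonHM.exists_primitive_mul hΩ hab hba ha hb hcol hf hg
  have hm : PolygonHM.IsHarmonicMeasure Ω (PolygonHM.bdry p '' Ioo b (a + N))
      (fun z => (G z).re / c) := by
    refine ⟨?_, ⟨C / |c|, fun z hz => ?_⟩, ?_, ?_⟩
    · have h1 : ∀ z ∈ Ω, HasDerivAt (fun z => G z / c) (f z * g z / c) z :=
        fun z hz => (hG z hz).div_const _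
      have h2 := PolygonHM.harmonicOnNhd_re_primitive hΩ.isOpen h1
      simpa only [div_ofReal_re] using h2
    · rw [abs_div]
      exact div_le_div_of_nonneg_right (hC z hz) (abs_nonneg c)
    · rintro _ ⟨s, hs, rfl⟩
      simpa [div_self hc] using (hone s hs).div_const c
    · rintro ζ ⟨hζ, hζE⟩
      -- Both end points belong to the closure of the arc, so only points of the complementary open
      -- arc remain. The point u₀ is reached at parameter a + N, as a lies outside [b, a + N].
      have hsub : PolygonHM.bdry p '' Icc b (a + N)
          ⊆ closure (PolygonHM.bdry p '' Ioo b (a + N)) := by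
        rw [← closure_Ioo hba.ne]
        exact image_closure_subset_closure_image (PolygonHM.continuous_bdry p)
      rcases PolygonHM.bdry_mem_arcs (a := a) (b := b) hΩ hζ
        (fun h => hζE (hsub ⟨a + N, ⟨hba.le, le_rfl⟩, by rw [PolygonHM.bdry_add_period, h]⟩))
        (fun h => hζE (hsub ⟨b, ⟨le_rfl, hba.le⟩, h.symm⟩)) with ⟨s, hs, rfl⟩ | ⟨s, hs, rfl⟩
      · simpa using (hzero s hs).div_const c
      · exact (hζE (subset_closure (mem_image_of_mem _ hs))).elim
  refine ⟨_, hm, fun h hh => hh.eqOn hΩ hba hm, c, hc, fun w _ γ hγ => ?_⟩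
  obtain ⟨s, hs, hs0⟩ := h0
  rw [mul_div_cancel₀ _ hc]
  exact PolygonHM.hasReLineIntegral_of_primitive (hf.holomorphic.mul hg.holomorphic)
    hG (hs0 ▸ hzero s hs) hγ
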